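/- Let $\Bbbk$ be an algebraically closed field and $A$ a basic finite-dimensional $\Bbbk$-algebra with a complete set $\{e_\lambda\}_{\lambda\in\Lambda}$ of orthogonal primitive idempotents, $\sum_\lambda e_\lambda=1$. Put $P_\lambda=Ae_\lambda$ and $S_\lambda=P_\lambda/\operatorname{rad}P_\lambda$; all modules are finitely generated left modules unless said otherwise. The \emph{associated category} of a $\Bbbk$-algebra with such a family of idempotents has object set $\Lambda$, morphism spaces $\mathcal A(\lambda,\mu)=e_\mu Ae_\lambda$, and composition given by multiplication. \emph{Stratification.} Let $\preccurlyeq$ be a linear order on $\Lambda$. $A$ is \emph{standardly stratified} for $\preccurlyeq$ if there are modules $\Delta_\lambda$ ($\lambda\in\Lambda$) such that $[\Delta_\lambda:S_\mu]=0$ unless $\mu\preccurlyeq\lambda$, and such that for each $\lambda$ there is an exact sequence $0\to K_\lambda\to P_\lambda\to\Delta_\lambda\to0$ where $K_\lambda$ has a filtration with factors $\Delta_\mu$, $\mu\succ\lambda$. The standard module $\Delta_\lambda$ is the largest quotient of $P_\lambda$ all of whose composition factors $S_\mu$ satisfy $\mu\preccurlyeq\lambda$; the proper standard module $\overline\Delta_\lambda$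 is the largest quotient of $P_\lambda$ all of whose composition factors $S_\mu$ satisfy $\mu\prec\lambda$, except for one copy of $S_\lambda$. $A$ is \emph{properly stratified} for $\preccurlyeq$ if ${}_AA$ has both a filtration with standard factors and a filtration with proper standard factors. \emph{Graded category.} Suppose that the associated category of $A$ is \emph{directed}: there is a partial order $\leqslant$ on $\Lambda$ such that $e_\mu Ae_\lambda\neq0$ implies $\lambda\leqslant\mu$. Then $J=\bigoplus_{\lambda\neq\mu}e_\mu Ae_\lambda$ is a two-sided ideal of $A$. Let $\check A=\bigoplus_{i\geqslant0}J^i/J^{i+1}$ with $J^0=A$, and let $\check{\mathcal A}$ be the associated category of $\check A$ with respect to the images of the $e_\lambda$ in degree $0$. \emph{Free directed categories.} Let $Q$ be a finite quiver without oriented cycles. Assign to every vertex $v$ a finite-dimensional local $\Bbbk$-algebra $f(v)$ and to every arrow $\alpha:v\to w$ a finite-dimensional $(f(w),f(v))$-bimodule $g(\alpha)$ on which $\Bbbk$ acts centrally. For a path $\gamma=\alpha_n\cdots\alpha_1$ from $v=v_0$ through $v_1,\dots,v_{n-1}$ to $w=v_n$ put $$M_\gamma=g(\alpha_n)\otimes_{f(v_{n-1})}\cdots\otimes_{f(v_1)}g(\alpha_1),$$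 with $M_\gamma=f(v)$ for the path of length $0$ at $v$. Let $\mathcal C$ be the $\Bbbk$-linear category whose objects are the vertices of $Q$, with $\mathcal C(v,w)=\bigoplus_\gamma M_\gamma$ over all paths $\gamma$ from $v$ to $w$, and with composition given by the tensor product. A $\Bbbk$-linear category isomorphic to such a $\mathcal C$ is called a \emph{free directed} category. It is \emph{left regular} if $f$ and $g$ can be chosen such that for every arrow $\alpha:v\to w$ the left $f(w)$-module $g(\alpha)$ is projective, and \emph{regular} if they can be chosen such that moreover every $g(\alpha)$ is projective as a right $f(v)$-module. \textbf{Theorem.} Let $A$ be a basic finite-dimensional $\Bbbk$-algebra whose associated category is directed. Then (a) $A$ is standardly stratified for all linear orders on $\Lambda$ if and only if $\check{\mathcal A}$ is a left regular free directed category; (b) $A$ is properly stratified for all linear orders on $\Lambda$ if and only if $\check{\mathcal A}$ is a regular free directed category. -/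

import Mathlib

open CategoryTheory
open scoped TensorProduct DirectSum

universe uk u w

noncomputable section

set_option linter.unusedSectionVars false

/-! ### Filtrations of modules and composition factors -/

section Modules

variable {A : Type u} [Ring A]

/-- The subquotient `N / (N ∩ L)` of a module; it is `N / L` when `L ≤ N`. -/
abbrev Subquot {M : Type u} [AddCommGroup M] [Module A M] (L N : Submodule A M) : Type u :=
  N ⧸ L.submoduleOf N

/-- The composition factor multiplicity `[M : S]` equals `n`: there is a composition series
`0 = M₀ < M₁ < ⋯ < M_r = M` in which exactly `n` of the factors are isomorphic to `S`. -/
def HasMultiplicity (S M : Type u) [AddCommGroup S] [Module A S] [AddCommGroup M] [Module A M]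
    (n : ℕ) : Prop :=
  ∃ s : CompositionSeries (Submodule A M), s.head = ⊥ ∧ s.last = ⊤ ∧
    Nat.card {i : Fin s.length //
      Nonempty (Subquot (s i.castSucc) (s i.succ) ≃ₗ[A] S)} = n

/-- `M` has a finite filtration `0 = M₀ ≤ M₁ ≤ ⋯ ≤ M_n = M` each of whose factors is isomorphic
to `X μ` for some index `μ` that satisfies `p`. -/
def HasFiltration {I : Type w} (X : I → Type u) [∀ i, AddCommGroup (X i)] [∀ i, Module A (X i)]
    (p : I → Prop) (M : Type u) [AddCommGroup M] [Module A M] : Prop :=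
  ∃ (n : ℕ) (F : ℕ → Submodule A M), F 0 = ⊥ ∧ F n = ⊤ ∧
    ∀ i < n, F i ≤ F (i + 1) ∧
      ∃ μ, p μ ∧ Nonempty (Subquot (F i) (F (i + 1)) ≃ₗ[A] X μ)

end Modules

/-! ### Stratified algebras -/

section Stratified

variable {A : Type u} [Ring A] {Λ : Type w}

/-- The left module `P_l = A e_l`. -/
abbrev Proj (e : Λ → A) (l : Λ) : Submodule A A := Submodule.span A {e l}

/-- The left module `S_l = P_l / rad P_l`. -/
abbrev Simp (e : Λ → A) (l : Λ) : Type u := Proj e l ⧸ Module.jacobson A (Proj e l)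

/-- A nonzero idempotent that is not a sum of two nonzero orthogonal idempotents. -/
def IsPrimitiveIdempotent (f : A) : Prop :=
  IsIdempotentElem f ∧ f ≠ 0 ∧
    ∀ x y : A, IsIdempotentElem x → IsIdempotentElem y → x * y = 0 → y * x = 0 → f = x + y →
      x = 0 ∨ y = 0

/-- `e` is a complete set of orthogonal primitive idempotents of a basic algebra: the
indecomposable projective modules `A e_l` are pairwise non-isomorphic. -/
structure IsBasicFamily [Fintype Λ] (e : Λ → A) : Prop extends
    CompleteOrthogonalIdempotents e where
  primitive : ∀ l, IsPrimitiveIdempotent (e l)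
  basic : ∀ l m, Nonempty (Proj e l ≃ₗ[A] Proj e m) → l = m

/-- `A` is standardly stratified with respect to a linear order: there are quotients
`Δ_l = P_l / K_l` with `[Δ_l : S_m] = 0` unless `m ≤ l`, such that `K_l` has a filtration
with factors `Δ_m`, `m > l`. -/
def IsStandardlyStratified (e : Λ → A) (o : LinearOrder Λ) : Prop :=
  ∃ K : ∀ l, Submodule A (Proj e l),
    (∀ l m, ¬ m ≤ l → HasMultiplicity (A := A) (Simp e m) (Proj e l ⧸ K l) 0) ∧
    ∀ l, HasFiltration (A := A) (fun m => Proj e m ⧸ K m) (fun m => l < m) (K l)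

/-- `P_l / U` is the standard module `Δ_l`: the largest quotient of `P_l` all of whose composition
factors `S_m` satisfy `m ≤ l`. -/
def IsStandardKernel (e : Λ → A) (o : LinearOrder Λ) (l : Λ) (U : Submodule A (Proj e l)) : Prop :=
  IsLeast {U | ∀ m, ¬ m ≤ l → HasMultiplicity (A := A) (Simp e m) (Proj e l ⧸ U) 0} U

/-- `P_l / U` is the proper standard module: the largest quotient of `P_l` all of whose
composition factors `S_m` satisfy `m < l` except for one copy of `S_l`. -/
def IsProperStandardKernel (e : Λ → A) (o : LinearOrder Λ) (l : Λ)
    (U : Submodule A (Proj e l)) : Prop :=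
  IsLeast {U | HasMultiplicity (A := A) (Simp e l) (Proj e l ⧸ U) 1 ∧
    ∀ m, ¬ m ≤ l → HasMultiplicity (A := A) (Simp e m) (Proj e l ⧸ U) 0} U

/-- `A` is properly stratified with respect to a linear order: the left regular module has both a
filtration by standard modules and a filtration by proper standard modules. -/
def IsProperlyStratified (e : Λ → A) (o : LinearOrder Λ) : Prop :=
  ∃ U V : ∀ l, Submodule A (Proj e l),
    (∀ l, IsStandardKernel e o l (U l)) ∧ (∀ l, IsProperStandardKernel e o l (V l)) ∧
    HasFiltration (A := A) (fun m => Proj e m ⧸ U m) (fun _ => True) A ∧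
    HasFiltration (A := A) (fun m => Proj e m ⧸ V m) (fun _ => True) A

end Stratified

/-! ### The associated category -/

section Associated

variable (k : Type uk) [Field k] {A : Type u} [Ring A] [Algebra k A] {Λ : Type w}

/-- The subspace `e_m A e_l`. -/
def corner (e : Λ → A) (l m : Λ) : Submodule k A :=
  LinearMap.range ((LinearMap.mulLeft k (e m)).comp (LinearMap.mulRight k (e l)))

variable {k} in
theorem mem_corner {e : Λ → A} {l m : Λ} {x : A} :
    x ∈ corner k e l m ↔ ∃ a, e m * (a * e l) = x := by
  simp [corner]

/-- The associated category of `A`: the objects are the `e_l`, `l ∈ Λ`, and the morphisms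
`l ⟶ m` form the space `e_m A e_l`. -/
structure AssocCat (k : Type uk) {A : Type u} [Ring A] {Λ : Type w} (e : Λ → A)
    (he : ∀ l, IsIdempotentElem (e l)) : Type w where
  /-- The index of the object. -/
  idx : Λ

variable {e : Λ → A} {he : ∀ l, IsIdempotentElem (e l)}

instance : Category.{u} (AssocCat k e he) where
  Hom X Y := corner k e X.idx Y.idx
  id X := ⟨e X.idx, mem_corner.2 ⟨1, by rw [one_mul]; exact he _⟩⟩
  comp {X Y Z} f g := ⟨g.1 * f.1, by
    obtain ⟨a, ha⟩ := mem_corner.1 f.2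
    obtain ⟨b, hb⟩ := mem_corner.1 g.2
    refine mem_corner.2 ⟨b * e Y.idx * (e Y.idx * a), ?_⟩
    rw [← ha, ← hb]
    simp only [mul_assoc]⟩
  id_comp {X Y} f := by
    obtain ⟨a, ha⟩ := mem_corner.1 f.2
    apply Subtype.ext
    change f.1 * e X.idx = f.1
    rw [← ha, mul_assoc, mul_assoc, (he X.idx).eq]
  comp_id {X Y} f := by
    obtain ⟨a, ha⟩ := mem_corner.1 f.2
    apply Subtype.ext
    change e Y.idx * f.1 = f.1
    rw [← ha, ← mul_assoc, (he Y.idx).eq]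
  assoc f g h := Subtype.ext (mul_assoc h.1 g.1 f.1).symm

instance : Preadditive (AssocCat k e he) where
  homGroup X Y := inferInstanceAs (AddCommGroup (corner k e X.idx Y.idx))
  add_comp _ _ _ f f' g := Subtype.ext (mul_add g.1 f.1 f'.1)
  comp_add _ _ _ f g g' := Subtype.ext (add_mul g.1 g'.1 f.1)

instance : Linear k (AssocCat k e he) where
  homModule X Y := inferInstanceAs (Module k (corner k e X.idx Y.idx))
  smul_comp _ _ _ r f g := Subtype.ext (mul_smul_comm r g.1 f.1)
  comp_smul _ _ _ f r g := Subtype.ext (smul_mul_assoc r g.1 f.1)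

/-- The associated category is directed: there is a partial order on `Λ` with `l ≤ m` whenever
`e_m A e_l ≠ 0`. -/
def IsDirectedFamily (e : Λ → A) : Prop :=
  ∃ _ : PartialOrder Λ, ∀ l m : Λ, corner k e l m ≠ ⊥ → l ≤ m

end Associated

/-! ### Associated graded algebras -/

/-- A decreasing multiplicative filtration `A ⊇ F₀ ⊇ F₁ ⊇ ⋯` of an algebra. -/
structure AlgFiltration (k : Type uk) [Field k] (A : Type u) [Ring A] [Algebra k A] where
  /-- The `i`-th step. -/
  step : ℕ → Submodule k A
  step_succ_le : ∀ i, step (i + 1) ≤ step i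
  one_mem : (1 : A) ∈ step 0
  mul_mem : ∀ {i j : ℕ} {x y : A}, x ∈ step i → y ∈ step j → x * y ∈ step (i + j)

namespace AlgFiltration

variable {k : Type uk} [Field k] {A : Type u} [Ring A] [Algebra k A] (F : AlgFiltration k A)

/-- The graded piece `F_i / F_{i+1}`. -/
def Piece (i : ℕ) : Type u := F.step i ⧸ (F.step (i + 1)).submoduleOf (F.step i)

instance (i : ℕ) : AddCommGroup (F.Piece i) :=
  inferInstanceAs (AddCommGroup (F.step i ⧸ (F.step (i + 1)).submoduleOf (F.step i)))

instance (i : ℕ) : Module k (F.Piece i) :=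
  inferInstanceAs (Module k (F.step i ⧸ (F.step (i + 1)).submoduleOf (F.step i)))

/-- The class in `F_i / F_{i+1}` of an element of `F_i`. -/
def cls {i : ℕ} (x : F.step i) : F.Piece i := Submodule.Quotient.mk x

theorem cls_surjective {i : ℕ} (x : F.Piece i) : ∃ a, F.cls a = x :=
  Submodule.Quotient.mk_surjective _ x

theorem cls_eq_cls {i : ℕ} (x y : F.step i) :
    F.cls x = F.cls y ↔ (x : A) - y ∈ F.step (i + 1) :=
  Submodule.Quotient.eq _

/-- Multiplication `F_i / F_{i+1} × F_j / F_{j+1} → F_{i+j} / F_{i+j+1}` induced by that of `A`. -/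
def pieceMul {i j : ℕ} (x : F.Piece i) (y : F.Piece j) : F.Piece (i + j) :=
  Quotient.liftOn₂' x y (fun a b => F.cls ⟨a.1 * b.1, F.mul_mem a.2 b.2⟩) (by
    intro a b a' b' ha hb
    have ha' : (a : A) - a' ∈ F.step (i + 1) := (F.cls_eq_cls a a').1 (Quotient.sound' ha)
    have hb' : (b : A) - b' ∈ F.step (j + 1) := (F.cls_eq_cls b b').1 (Quotient.sound' hb)
    refine (F.cls_eq_cls _ _).2 ?_
    have h₁ := F.mul_mem ha' b.2
    have h₂ := F.mul_mem a'.2 hb'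
    rw [show i + 1 + j = i + j + 1 by omega] at h₁
    have h₃ := (F.step (i + j + 1)).add_mem h₁ h₂
    convert h₃ using 1
    simp only [sub_mul, mul_sub]
    abel)

theorem pieceMul_cls {i j : ℕ} (a : F.step i) (b : F.step j) :
    F.pieceMul (F.cls a) (F.cls b) = F.cls ⟨a.1 * b.1, F.mul_mem a.2 b.2⟩ := rfl

theorem mk_cls_eq {i j : ℕ} (h : i = j) (a : F.step i) (b : F.step j) (hab : (a : A) = b) :
    GradedMonoid.mk (A := F.Piece) i (F.cls a) = GradedMonoid.mk j (F.cls b) := by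
  subst h
  rw [Subtype.ext hab]

theorem cls_add {i : ℕ} (a b : F.step i) : F.cls (a + b) = F.cls a + F.cls b := rfl

theorem cls_smul {i : ℕ} (r : k) (a : F.step i) : F.cls (r • a) = r • F.cls a := rfl

instance gMul : GradedMonoid.GMul F.Piece where
  mul x y := F.pieceMul x y

instance gOne : GradedMonoid.GOne F.Piece where
  one := F.cls ⟨1, F.one_mem⟩

instance gRing : DirectSum.GRing F.Piece where
  mul_zero x := by
    obtain ⟨a, rfl⟩ := F.cls_surjective x
    exact congrArg F.cls (Subtype.ext (mul_zero a.1))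
  zero_mul x := by
    obtain ⟨a, rfl⟩ := F.cls_surjective x
    exact congrArg F.cls (Subtype.ext (zero_mul a.1))
  mul_add x y z := by
    obtain ⟨a, rfl⟩ := F.cls_surjective x
    obtain ⟨b, rfl⟩ := F.cls_surjective y
    obtain ⟨c, rfl⟩ := F.cls_surjective z
    exact congrArg F.cls (Subtype.ext (mul_add a.1 b.1 c.1))
  add_mul x y z := by
    obtain ⟨a, rfl⟩ := F.cls_surjective x
    obtain ⟨b, rfl⟩ := F.cls_surjective y
    obtain ⟨c, rfl⟩ := F.cls_surjective z
    exact congrArg F.cls (Subtype.ext (add_mul a.1 b.1 c.1))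
  one_mul x := by
    obtain ⟨i, x⟩ := x
    obtain ⟨a, rfl⟩ := F.cls_surjective x
    exact F.mk_cls_eq (zero_add i) _ _ (one_mul a.1)
  mul_one x := by
    obtain ⟨i, x⟩ := x
    obtain ⟨a, rfl⟩ := F.cls_surjective x
    exact F.mk_cls_eq (add_zero i) _ _ (mul_one a.1)
  mul_assoc x y z := by
    obtain ⟨i, x⟩ := x
    obtain ⟨j, y⟩ := y
    obtain ⟨l, z⟩ := z
    obtain ⟨a, rfl⟩ := F.cls_surjective x
    obtain ⟨b, rfl⟩ := F.cls_surjective y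
    obtain ⟨c, rfl⟩ := F.cls_surjective z
    exact F.mk_cls_eq (add_assoc i j l) _ _ (mul_assoc a.1 b.1 c.1)
  natCast n := n • F.cls ⟨1, F.one_mem⟩
  natCast_zero := zero_smul ℕ _
  natCast_succ n := succ_nsmul _ n
  intCast n := n • F.cls ⟨1, F.one_mem⟩
  intCast_ofNat n := natCast_zsmul _ n
  intCast_negSucc_ofNat n := negSucc_zsmul _ n

instance gAlgebra : DirectSum.GAlgebra k F.Piece where
  toFun :=
    { toFun := fun r => r • F.cls ⟨1, F.one_mem⟩
      map_zero' := zero_smul k _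
      map_add' := fun r s => add_smul r s _ }
  map_one := one_smul k _
  map_mul r s := by
    refine F.mk_cls_eq (add_zero 0).symm ((r * s) • ⟨1, F.one_mem⟩)
      ⟨(r • (1 : A)) * (s • (1 : A)), F.mul_mem ((F.step 0).smul_mem r F.one_mem)
        ((F.step 0).smul_mem s F.one_mem)⟩ ?_
    simp [mul_smul, smul_comm r s]
  commutes r x := by
    obtain ⟨i, x⟩ := x
    obtain ⟨a, rfl⟩ := F.cls_surjective x
    refine F.mk_cls_eq (by simp) ⟨(r • (1 : A)) * a.1, F.mul_mem
        ((F.step 0).smul_mem r F.one_mem) a.2⟩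
      ⟨a.1 * (r • (1 : A)), F.mul_mem a.2 ((F.step 0).smul_mem r F.one_mem)⟩ ?_
    simp
  smul_def r x := by
    obtain ⟨i, x⟩ := x
    obtain ⟨a, rfl⟩ := F.cls_surjective x
    refine F.mk_cls_eq (zero_add i).symm (r • a)
      ⟨(r • (1 : A)) * a.1, F.mul_mem ((F.step 0).smul_mem r F.one_mem) a.2⟩ ?_
    simp

/-- The associated graded algebra `⨁ F_i / F_{i+1}`. -/
abbrev Gr : Type u := ⨁ i, F.Piece i

/-- The class in degree `0` of an element of `F₀`. -/
def degZero (a : F.step 0) : F.Gr := DirectSum.of F.Piece 0 (F.cls a)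

theorem degZero_idem (a : F.step 0) (ha : IsIdempotentElem a.1) :
    IsIdempotentElem (F.degZero a) := by
  change F.degZero a * F.degZero a = F.degZero a
  unfold degZero
  rw [DirectSum.of_mul_of]
  exact congrArg (DirectSum.of F.Piece 0) (congrArg F.cls (Subtype.ext ha))

end AlgFiltration

/-! ### The associated graded category of a directed algebra -/

section GradedCategory

variable (k : Type uk) [Field k] {A : Type u} [Ring A] [Algebra k A] {Λ : Type w}

/-- `J = ⨁_{l ≠ m} e_m A e_l`. -/
def offDiag (e : Λ → A) : Submodule k A :=
  ⨆ (l : Λ) (m : Λ) (_ : l ≠ m), corner k e l m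

/-- The powers of `J`, with `J⁰ = A`. -/
def offDiagPow (e : Λ → A) : ℕ → Submodule k A
  | 0 => ⊤
  | n + 1 => offDiag k e ^ (n + 1)

variable {k} [Fintype Λ] {e : Λ → A}

theorem corner_le_offDiag {l m : Λ} (h : l ≠ m) : corner k e l m ≤ offDiag k e :=
  le_iSup_of_le l (le_iSup_of_le m (le_iSup_of_le h le_rfl))

theorem corner_mul_corner (hd : IsDirectedFamily k e) {l m n : Λ} (h : l ≠ m) (h' : m ≠ n)
    {x y : A} (hx : x ∈ corner k e m n) (hy : y ∈ corner k e l m) : x * y ∈ offDiag k e := by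
  obtain ⟨a, rfl⟩ := mem_corner.1 hx
  obtain ⟨b, rfl⟩ := mem_corner.1 hy
  by_cases hln : l = n
  · subst hln
    obtain ⟨_, H⟩ := hd
    by_cases h₁ : corner k e m l = ⊥
    · have : e l * (a * e m) = 0 := by simpa [h₁] using hx
      rw [this, zero_mul]
      exact Submodule.zero_mem _
    · by_cases h₂ : corner k e l m = ⊥
      · have : e m * (b * e l) = 0 := by simpa [h₂] using hy
        rw [this, mul_zero]
        exact Submodule.zero_mem _
      · exact absurd (le_antisymm (H _ _ h₂) (H _ _ h₁)) h
  · refine corner_le_offDiag hln (mem_corner.2 ⟨a * e m * (e m * b), ?_⟩)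
    simp only [mul_assoc]

theorem offDiag_mul_mem (he : CompleteOrthogonalIdempotents e) (hd : IsDirectedFamily k e) (a : A)
    {x : A} (hx : x ∈ offDiag k e) : a * x ∈ offDiag k e := by
  have key : offDiag k e ≤ (offDiag k e).comap (LinearMap.mulLeft k a) := by
    refine iSup_le fun l => iSup_le fun m => iSup_le fun hlm => fun x hx => ?_
    obtain ⟨b, rfl⟩ := mem_corner.1 hx
    change a * (e m * (b * e l)) ∈ offDiag k e
    have h : a * (e m * (b * e l)) = ∑ n, (e n * (a * e m)) * (e m * (b * e l)) := by
      rw [← Finset.sum_mul, ← Finset.sum_mul, he.complete, one_mul, mul_assoc, ← mul_assoc (e m) (e m),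
        (he.idem m).eq]
    rw [h]
    refine Submodule.sum_mem _ fun n _ => ?_
    by_cases hmn : m = n
    · subst hmn
      refine corner_le_offDiag hlm (mem_corner.2 ⟨a * e m * (e m * b), ?_⟩)
      simp only [mul_assoc]
    · exact corner_mul_corner hd hlm hmn (mem_corner.2 ⟨a, rfl⟩) (mem_corner.2 ⟨b, rfl⟩)
  exact key hx

theorem mem_offDiag_mul (he : CompleteOrthogonalIdempotents e) (hd : IsDirectedFamily k e) (a : A)
    {x : A} (hx : x ∈ offDiag k e) : x * a ∈ offDiag k e := by
  have key : offDiag k e ≤ (offDiag k e).comap (LinearMap.mulRight k a) := by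
    refine iSup_le fun m => iSup_le fun n => iSup_le fun hmn => fun x hx => ?_
    obtain ⟨b, rfl⟩ := mem_corner.1 hx
    change e n * (b * e m) * a ∈ offDiag k e
    have h : e n * (b * e m) * a = ∑ l, (e n * (b * e m)) * (e m * (a * e l)) := by
      rw [← Finset.mul_sum, ← Finset.mul_sum, ← Finset.mul_sum, he.complete, mul_one,
        mul_assoc (e n), mul_assoc (e n), mul_assoc b, mul_assoc b, ← mul_assoc (e m) (e m),
        (he.idem m).eq]
    rw [h]
    refine Submodule.sum_mem _ fun l _ => ?_
    by_cases hlm : l = m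
    · subst hlm
      refine corner_le_offDiag hmn (mem_corner.2 ⟨b * e l * (e l * a), ?_⟩)
      simp only [mul_assoc]
    · exact corner_mul_corner hd hlm hmn (mem_corner.2 ⟨b, rfl⟩) (mem_corner.2 ⟨a, rfl⟩)
  exact key hx

theorem offDiagPow_mul_mem (he : CompleteOrthogonalIdempotents e) (hd : IsDirectedFamily k e)
    (a : A) : ∀ (i : ℕ) {x : A}, x ∈ offDiagPow k e i → a * x ∈ offDiagPow k e i
  | 0, _, _ => Submodule.mem_top
  | i + 1, x, hx => by
    change x ∈ offDiag k e ^ (i + 1) at hx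
    change a * x ∈ offDiag k e ^ (i + 1)
    rw [pow_succ'] at hx ⊢
    refine Submodule.mul_induction_on hx (fun m hm n hn => ?_) fun x y hx hy => ?_
    · rw [← mul_assoc]
      exact Submodule.mul_mem_mul (offDiag_mul_mem he hd a hm) hn
    · rw [mul_add]
      exact Submodule.add_mem _ hx hy

theorem mem_offDiagPow_mul (he : CompleteOrthogonalIdempotents e) (hd : IsDirectedFamily k e)
    (a : A) : ∀ (i : ℕ) {x : A}, x ∈ offDiagPow k e i → x * a ∈ offDiagPow k e i
  | 0, _, _ => Submodule.mem_top
  | i + 1, x, hx => by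
    change x ∈ offDiag k e ^ (i + 1) at hx
    change x * a ∈ offDiag k e ^ (i + 1)
    rw [pow_succ] at hx ⊢
    refine Submodule.mul_induction_on hx (fun m hm n hn => ?_) fun x y hx hy => ?_
    · rw [mul_assoc]
      exact Submodule.mul_mem_mul hm (mem_offDiag_mul he hd a hn)
    · rw [add_mul]
      exact Submodule.add_mem _ hx hy

/-- The filtration `A = J⁰ ⊇ J ⊇ J² ⊇ ⋯`. -/
def offDiagFiltration (he : CompleteOrthogonalIdempotents e) (hd : IsDirectedFamily k e) :
    AlgFiltration k A where
  step := offDiagPow k e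
  step_succ_le
    | 0 => le_top
    | i + 1 => by
      change offDiag k e ^ (i + 1 + 1) ≤ offDiag k e ^ (i + 1)
      rw [pow_succ']
      refine Submodule.mul_le.2 fun m _ n hn => ?_
      exact offDiagPow_mul_mem he hd m (i + 1) hn
  one_mem := Submodule.mem_top
  mul_mem := by
    rintro (_ | i) (_ | j) x y hx hy
    · exact Submodule.mem_top
    · rw [zero_add]
      exact offDiagPow_mul_mem he hd x (j + 1) hy
    · exact mem_offDiagPow_mul he hd y (i + 1) hx
    · change x * y ∈ offDiag k e ^ (i + 1 + (j + 1))
      rw [pow_add]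
      exact Submodule.mul_mem_mul hx hy

/-- The images of the idempotents `e_l` in degree `0` of the associated graded algebra. -/
def grIdem (he : CompleteOrthogonalIdempotents e) (hd : IsDirectedFamily k e) (l : Λ) :
    (offDiagFiltration he hd).Gr :=
  (offDiagFiltration he hd).degZero ⟨e l, Submodule.mem_top⟩

theorem grIdem_idem (he : CompleteOrthogonalIdempotents e) (hd : IsDirectedFamily k e) (l : Λ) :
    IsIdempotentElem (grIdem he hd l) :=
  AlgFiltration.degZero_idem _ _ (he.idem l)

/-- The associated graded category: the associated category of the graded algebra
`⨁ J^i / J^{i+1}` with respect to the idempotents `e_l` in degree `0`. -/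
abbrev GradedCat (he : CompleteOrthogonalIdempotents e) (hd : IsDirectedFamily k e) : Type w :=
  AssocCat k (grIdem he hd) (grIdem_idem he hd)

end GradedCategory

/-! ### Tensor products over noncommutative algebras -/

section Balanced

variable (k : Type uk) [Field k] (B C : Type u) [Ring B] [Algebra k B] [Ring C] [Algebra k C]
  (M : Type u) [AddCommGroup M] [Module k M] [Module C M] [Module Bᵐᵒᵖ M] [IsScalarTower k C M]
  [IsScalarTower k Bᵐᵒᵖ M] [SMulCommClass C Bᵐᵒᵖ M]
  (N : Type u) [AddCommGroup N] [Module k N] [Module B N] [IsScalarTower k B N]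

/-- The relations `m b ⊗ n = m ⊗ b n`. The set of these relations is stable under the left action
of `C` on `M`, so the `C`-submodule that they span is also the subgroup that they generate. -/
def balancedRel : Submodule C (M ⊗[k] N) :=
  Submodule.span C {t | ∃ (m : M) (b : B) (n : N), t = (MulOpposite.op b • m) ⊗ₜ n - m ⊗ₜ (b • n)}

/-- The left `C`-module `M ⊗_B N` for a `(C, B)`-bimodule `M` and a left `B`-module `N`. -/
abbrev BTensor : Type u := (M ⊗[k] N) ⧸ balancedRel k B C M N

variable {N}

/-- The element `m ⊗ n` of `M ⊗_B N`. -/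
def btmul (m : M) (n : N) : BTensor k B C M N := Submodule.Quotient.mk (m ⊗ₜ n)

variable {M}

theorem btmul_induction {p : BTensor k B C M N → Prop} (t : BTensor k B C M N)
    (h0 : p 0) (h1 : ∀ m n, p (btmul k B C M m n)) (h2 : ∀ x y, p x → p y → p (x + y)) : p t := by
  obtain ⟨t, rfl⟩ := Submodule.Quotient.mk_surjective _ t
  induction t using TensorProduct.induction_on with
  | zero => exact h0
  | tmul m n => exact h1 m n
  | add x y hx hy => exact h2 _ _ hx hy

variable (M) {N' : Type u} [AddCommGroup N'] [Module k N'] [Module B N'] [IsScalarTower k B N']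

/-- The map `id ⊗ f : M ⊗_B N → M ⊗_B N'` of left `C`-modules. -/
def blTensor (f : N →ₗ[B] N') : BTensor k B C M N →ₗ[C] BTensor k B C M N' :=
  Submodule.mapQ _ _ (TensorProduct.AlgebraTensorModule.map (LinearMap.id : M →ₗ[C] M)
    (f.restrictScalars k)) (by
    refine Submodule.span_le.2 ?_
    rintro _ ⟨m, b, n, rfl⟩
    refine Submodule.subset_span ⟨m, b, f n, ?_⟩
    simp)

theorem blTensor_btmul (f : N →ₗ[B] N') (m : M) (n : N) :
    blTensor k B C M f (btmul k B C M m n) = btmul k B C M m (f n) := rfl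

theorem btmul_add (m : M) (n n' : N) :
    btmul k B C M m (n + n') = btmul k B C M m n + btmul k B C M m n' := by
  simp [btmul, TensorProduct.tmul_add]

theorem btmul_smul (m : M) (r : k) (n : N) :
    btmul k B C M m (r • n) = r • btmul k B C M m n := by
  simp [btmul, TensorProduct.tmul_smul]

end Balanced

/-! ### Free directed categories -/

/-- A quiver of bimodules on a quiver with vertex set `V`: a finite-dimensional local algebra at
each vertex, and for each arrow `v ⟶ w` a finite-dimensional bimodule over the algebras at `w`
(acting on the left) and `v` (acting on the right). -/
structure BimoduleQuiver (k : Type uk) [Field k] (V : Type w) [Quiver.{w} V] where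
  /-- The algebra at a vertex. -/
  alg : V → Type u
  [ring : ∀ v, Ring (alg v)]
  [algebra : ∀ v, Algebra k (alg v)]
  [algFinite : ∀ v, FiniteDimensional k (alg v)]
  [isLocal : ∀ v, IsLocalRing (alg v)]
  /-- The bimodule on an arrow. -/
  bim : ∀ {v w : V}, (v ⟶ w) → Type u
  [bimAddCommGroup : ∀ {v w : V} (α : v ⟶ w), AddCommGroup (bim α)]
  [bimModule : ∀ {v w : V} (α : v ⟶ w), Module k (bim α)]
  [bimFinite : ∀ {v w : V} (α : v ⟶ w), FiniteDimensional k (bim α)]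
  [bimLeft : ∀ {v w : V} (α : v ⟶ w), Module (alg w) (bim α)]
  [bimRight : ∀ {v w : V} (α : v ⟶ w), Module (alg v)ᵐᵒᵖ (bim α)]
  [bimTowerLeft : ∀ {v w : V} (α : v ⟶ w), IsScalarTower k (alg w) (bim α)]
  [bimTowerRight : ∀ {v w : V} (α : v ⟶ w), IsScalarTower k (alg v)ᵐᵒᵖ (bim α)]
  [bimComm : ∀ {v w : V} (α : v ⟶ w), SMulCommClass (alg w) (alg v)ᵐᵒᵖ (bim α)]

namespace BimoduleQuiver

attribute [instance] ring algebra algFinite isLocal bimAddCommGroup bimModule bimFinite bimLeft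
  bimRight bimTowerLeft bimTowerRight bimComm

/-- A left module over a `k`-algebra, bundled. -/
structure LeftMod (k : Type uk) [Field k] (B : Type u) [Ring B] [Algebra k B] where
  /-- The underlying type. -/
  carrier : Type u
  [addCommGroup : AddCommGroup carrier]
  [moduleBase : Module k carrier]
  [moduleLeft : Module B carrier]
  [tower : IsScalarTower k B carrier]

attribute [instance] LeftMod.addCommGroup LeftMod.moduleBase LeftMod.moduleLeft LeftMod.tower

variable {k : Type uk} [Field k] {V : Type w} [Quiver.{w} V] (Q : BimoduleQuiver.{uk, u, w} k V)

/-- The module `M_γ = g(α_n) ⊗ ⋯ ⊗ g(α_1)` of a path `γ = α_n ⋯ α_1` from `v` to `w`, as a left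
module over the algebra at `w`; for the path of length `0` it is the algebra at `v`. (The right
action of the algebra at `v`, which the construction does not need, is `pathMul` with the path of
length `0` at `v`.) -/
def pathMod {v : V} : ∀ {w : V}, Quiver.Path v w → LeftMod k (Q.alg w)
  | _, .nil => ⟨Q.alg v⟩
  | w, .cons (b := u) p α => ⟨BTensor k (Q.alg u) (Q.alg w) (Q.bim α) (pathMod p).carrier⟩

/-- The underlying space of `M_γ`. -/
abbrev PathSpace {v w : V} (p : Quiver.Path v w) : Type u := (Q.pathMod p).carrier

/-- The multiplication `M_δ × M_γ → M_{δγ}`, `(y, x) ↦ y ⊗ x`, for a path `γ` followed by a path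
`δ`. It is the action of the algebra on `M_γ` when `δ` has length `0`. -/
def pathMul {u v : V} (γ : Quiver.Path u v) (x : Q.PathSpace γ) : ∀ {w : V} (δ : Quiver.Path v w),
    Q.PathSpace δ →ₗ[Q.alg w] Q.PathSpace (γ.comp δ)
  | _, .nil => LinearMap.toSpanSingleton (Q.alg v) (Q.PathSpace γ) x
  | w, .cons (b := b) δ α => blTensor k (Q.alg b) (Q.alg w) (Q.bim α) (pathMul γ x δ)

/-- An element of the algebra at `v` as an element of the module of the path of length `0`. -/
def nilElt (v : V) (a : Q.alg v) : Q.PathSpace (Quiver.Path.nil : Quiver.Path v v) := a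

/-- The element `m ⊗ x` of the module of a path followed by an arrow. -/
def consElt {v b c : V} (p : Quiver.Path v b) (α : b ⟶ c) (m : Q.bim α) :
    Q.PathSpace p →ₗ[k] Q.PathSpace (p.cons α) where
  toFun x := btmul k (Q.alg b) (Q.alg c) (Q.bim α) m x
  map_add' x y := btmul_add k (Q.alg b) (Q.alg c) (Q.bim α) m x y
  map_smul' r x := btmul_smul k (Q.alg b) (Q.alg c) (Q.bim α) m r x

theorem nilElt_surjective {v : V} (y : Q.PathSpace (Quiver.Path.nil : Quiver.Path v v)) :
    ∃ a, Q.nilElt v a = y := ⟨y, rfl⟩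

@[elab_as_elim]
theorem consElt_induction {v b c : V} {q : Quiver.Path v b} {α : b ⟶ c}
    {p : Q.PathSpace (q.cons α) → Prop} (t : Q.PathSpace (q.cons α))
    (h0 : p 0) (h1 : ∀ m x, p (Q.consElt q α m x)) (h2 : ∀ x y, p x → p y → p (x + y)) : p t :=
  btmul_induction k (Q.alg b) (Q.alg c) (M := Q.bim α) (N := Q.PathSpace q) t h0 h1 h2

theorem pathMul_nilElt {u v : V} (γ : Quiver.Path u v) (x : Q.PathSpace γ) (a : Q.alg v) :
    Q.pathMul γ x Quiver.Path.nil (Q.nilElt v a) = a • x := rfl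

theorem pathMul_consElt {u v b c : V} (γ : Quiver.Path u v) (x : Q.PathSpace γ)
    (δ : Quiver.Path v b) (α : b ⟶ c) (m : Q.bim α) (y : Q.PathSpace δ) :
    Q.pathMul γ x (δ.cons α) (Q.consElt δ α m y) =
      Q.consElt (γ.comp δ) α m (Q.pathMul γ x δ y) := rfl

theorem pathMul_add {u v : V} (γ : Quiver.Path u v) (x y : Q.PathSpace γ) {w : V}
    (δ : Quiver.Path v w) (z : Q.PathSpace δ) :
    Q.pathMul γ (x + y) δ z = Q.pathMul γ x δ z + Q.pathMul γ y δ z := by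
  induction δ with
  | nil =>
    obtain ⟨a, rfl⟩ := Q.nilElt_surjective z
    exact smul_add a x y
  | @cons b c δ α ih =>
    refine Q.consElt_induction z ?_ (fun m n => ?_) fun s t hs ht => ?_
    · rw [map_zero, map_zero, map_zero, add_zero]
    · rw [pathMul_consElt, ih, map_add]
      rfl
    · rw [map_add, map_add, map_add, hs, ht, add_add_add_comm]

theorem pathMul_smul {u v : V} (γ : Quiver.Path u v) (r : k) (x : Q.PathSpace γ) {w : V}
    (δ : Quiver.Path v w) (z : Q.PathSpace δ) :
    Q.pathMul γ (r • x) δ z = r • Q.pathMul γ x δ z := by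
  induction δ with
  | nil =>
    obtain ⟨a, rfl⟩ := Q.nilElt_surjective z
    exact smul_comm a r x
  | @cons b c δ α ih =>
    refine Q.consElt_induction z ?_ (fun m n => ?_) fun s t hs ht => ?_
    · rw [map_zero, map_zero, smul_zero]
    · rw [pathMul_consElt, ih, map_smul]
      rfl
    · rw [map_add, map_add, hs, ht, smul_add]

/-- The multiplication of path modules as a `k`-bilinear map. -/
def pathMulBilin {u v w : V} (γ : Quiver.Path u v) (δ : Quiver.Path v w) :
    Q.PathSpace γ →ₗ[k] Q.PathSpace δ →ₗ[k] Q.PathSpace (γ.comp δ) where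
  toFun x := (Q.pathMul γ x δ).restrictScalars k
  map_add' x y := LinearMap.ext fun z => Q.pathMul_add γ x y δ z
  map_smul' r x := LinearMap.ext fun z => Q.pathMul_smul γ r x δ z

/-- The space of morphisms `v ⟶ w`: the direct sum of the `M_γ` over all paths `γ` from `v`
to `w`. -/
abbrev HomSpace (v w : V) : Type (max u w) := ⨁ p : Quiver.Path v w, Q.PathSpace p

open scoped Classical in
/-- The inclusion of `M_γ` into the space of morphisms. -/
def inj {v w : V} (p : Quiver.Path v w) : Q.PathSpace p →ₗ[k] Q.HomSpace v w :=
  DirectSum.lof k (Quiver.Path v w) (fun p => Q.PathSpace p) p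

open scoped Classical in
/-- Composition of morphisms, given on the summands `M_γ` and `M_δ` by the tensor product. -/
def compBilin (u v w : V) : Q.HomSpace u v →ₗ[k] Q.HomSpace v w →ₗ[k] Q.HomSpace u w :=
  DirectSum.toModule k _ _ fun γ => LinearMap.flip <| DirectSum.toModule k _ _ fun δ =>
    LinearMap.flip <| (Q.pathMulBilin γ δ).compr₂ (Q.inj (γ.comp δ))

open scoped Classical in
theorem compBilin_inj {u v w : V} (γ : Quiver.Path u v) (δ : Quiver.Path v w) (x : Q.PathSpace γ)
    (y : Q.PathSpace δ) :
    Q.compBilin u v w (Q.inj γ x) (Q.inj δ y) = Q.inj (γ.comp δ) (Q.pathMul γ x δ y) := by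
  simp only [compBilin, inj, DirectSum.toModule_lof, LinearMap.flip_apply,
    LinearMap.compr₂_apply]
  rfl

open scoped Classical in
@[elab_as_elim]
theorem homSpace_induction {v w : V} {p : Q.HomSpace v w → Prop} (f : Q.HomSpace v w) (h0 : p 0)
    (h1 : ∀ γ x, p (Q.inj γ x)) (h2 : ∀ x y, p x → p y → p (x + y)) : p f :=
  DirectSum.induction_on f h0 h1 h2

open scoped Classical in
/-- The map `t ↦ m ⊗ t` on morphisms given by an element `m` of the bimodule on an arrow. -/
def arrowMap {u v w : V} (α : v ⟶ w) (m : Q.bim α) : Q.HomSpace u v →ₗ[k] Q.HomSpace u w :=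
  DirectSum.toModule k _ _ fun γ => (Q.inj (γ.cons α)).comp (Q.consElt γ α m)

open scoped Classical in
theorem arrowMap_inj {u v w : V} (α : v ⟶ w) (m : Q.bim α) (γ : Quiver.Path u v)
    (x : Q.PathSpace γ) : Q.arrowMap α m (Q.inj γ x) = Q.inj (γ.cons α) (Q.consElt γ α m x) := by
  simp only [arrowMap, inj, DirectSum.toModule_lof, LinearMap.comp_apply]

theorem inj_pathMul_assoc {t u v : V} (γ : Quiver.Path t u) (δ : Quiver.Path u v)
    (x : Q.PathSpace γ) (y : Q.PathSpace δ) {w : V} (ε : Quiver.Path v w) (z : Q.PathSpace ε) :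
    Q.inj ((γ.comp δ).comp ε) (Q.pathMul (γ.comp δ) (Q.pathMul γ x δ y) ε z) =
      Q.inj (γ.comp (δ.comp ε)) (Q.pathMul γ x (δ.comp ε) (Q.pathMul δ y ε z)) := by
  induction ε with
  | nil =>
    obtain ⟨a, rfl⟩ := Q.nilElt_surjective z
    exact congrArg (Q.inj (γ.comp δ)) ((Q.pathMul γ x δ).map_smul a y).symm
  | @cons b c ε α ih =>
    refine Q.consElt_induction z ?_ (fun m n => ?_) fun s t hs ht => ?_
    · simp only [map_zero]
    · have := congrArg (Q.arrowMap α m) (ih n)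
      rwa [arrowMap_inj, arrowMap_inj] at this
    · simp only [map_add, hs, ht]

theorem inj_one_pathMul {v w : V} (δ : Quiver.Path v w) (y : Q.PathSpace δ) :
    Q.inj (Quiver.Path.nil.comp δ) (Q.pathMul Quiver.Path.nil (Q.nilElt v 1) δ y) = Q.inj δ y := by
  induction δ with
  | nil =>
    obtain ⟨a, rfl⟩ := Q.nilElt_surjective y
    exact congrArg (fun a => Q.inj Quiver.Path.nil (Q.nilElt v a)) (mul_one a)
  | @cons b c δ α ih =>
    refine Q.consElt_induction y ?_ (fun m n => ?_) fun s t hs ht => ?_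
    · simp only [map_zero]
    · have := congrArg (Q.arrowMap α m) (ih n)
      rwa [arrowMap_inj, arrowMap_inj] at this
    · simp only [map_add, hs, ht]

theorem compBilin_one_left {v w : V} (f : Q.HomSpace v w) :
    Q.compBilin v v w (Q.inj Quiver.Path.nil (Q.nilElt v 1)) f = f := by
  refine Q.homSpace_induction f (map_zero _) (fun γ x => ?_) fun x y hx hy => ?_
  · rw [compBilin_inj]
    exact Q.inj_one_pathMul γ x
  · rw [map_add, hx, hy]

theorem compBilin_one_right {v w : V} (f : Q.HomSpace v w) :
    Q.compBilin v w w f (Q.inj Quiver.Path.nil (Q.nilElt w 1)) = f := by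
  refine Q.homSpace_induction f (LinearMap.map_zero₂ _ _) (fun γ x => ?_) fun x y hx hy => ?_
  · rw [compBilin_inj, pathMul_nilElt, one_smul]
    rfl
  · rw [LinearMap.map_add₂, hx, hy]

theorem compBilin_assoc {t u v w : V} (f : Q.HomSpace t u) (g : Q.HomSpace u v)
    (h : Q.HomSpace v w) : Q.compBilin t v w (Q.compBilin t u v f g) h =
      Q.compBilin t u w f (Q.compBilin u v w g h) := by
  refine Q.homSpace_induction f (by simp) (fun γ x => ?_) fun x y hx hy => ?_
  · refine Q.homSpace_induction g (by simp) (fun δ y => ?_) fun x y hx hy => ?_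
    · refine Q.homSpace_induction h (by simp) (fun ε z => ?_) fun x y hx hy => ?_
      · simp only [compBilin_inj]
        exact Q.inj_pathMul_assoc γ δ x y ε z
      · simp only [map_add, hx, hy]
    · simp only [map_add, LinearMap.add_apply, hx, hy]
  · simp only [map_add, LinearMap.add_apply, hx, hy]

/-- The category determined by a quiver of bimodules: its objects are the vertices. -/
structure FreeCat (Q : BimoduleQuiver.{uk, u, w} k V) : Type w where
  /-- The vertex. -/
  vertex : V

instance : Category.{max u w} Q.FreeCat where
  Hom X Y := Q.HomSpace X.vertex Y.vertex
  id X := Q.inj Quiver.Path.nil (Q.nilElt X.vertex 1)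
  comp f g := Q.compBilin _ _ _ f g
  id_comp f := Q.compBilin_one_left f
  comp_id f := Q.compBilin_one_right f
  assoc f g h := Q.compBilin_assoc f g h

instance : Preadditive Q.FreeCat where
  homGroup X Y := inferInstanceAs (AddCommGroup (Q.HomSpace X.vertex Y.vertex))
  add_comp _ _ _ f f' g := (Q.compBilin _ _ _).map_add₂ f f' g
  comp_add _ _ _ f g g' := (Q.compBilin _ _ _ f).map_add g g'

instance : Linear k Q.FreeCat where
  homModule X Y := inferInstanceAs (Module k (Q.HomSpace X.vertex Y.vertex))
  smul_comp _ _ _ r f g := (Q.compBilin _ _ _).map_smul₂ r f g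
  comp_smul _ _ _ f r g := (Q.compBilin _ _ _ f).map_smul r g

/-- The bimodule on each arrow `v ⟶ w` is projective as a left module over the algebra at `w`. -/
def LeftRegular : Prop :=
  ∀ {v w : V} (α : v ⟶ w), Module.Projective (Q.alg w) (Q.bim α)

/-- The bimodule on each arrow `v ⟶ w` is projective as a right module over the algebra at `v`. -/
def RightRegular : Prop :=
  ∀ {v w : V} (α : v ⟶ w), Module.Projective (Q.alg v)ᵐᵒᵖ (Q.bim α)

/-- The category determined by `Q` is isomorphic to `D` as a `k`-linear category: there is a
`k`-linear functor that is bijective on objects and on morphisms. -/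
def Presents (D : Type w) [Category.{u} D] [Preadditive D] [Linear k D] : Prop :=
  ∃ F : Q.FreeCat ⥤ D, F.Additive ∧ F.Linear k ∧ F.Full ∧ F.Faithful ∧ Function.Bijective F.obj

end BimoduleQuiver

/-- A finite quiver without oriented cycles. -/
structure IsFiniteAcyclic (V : Type w) [Quiver.{w} V] : Prop where
  finite_vertices : Finite V
  finite_arrows : ∀ v w : V, Finite (v ⟶ w)
  acyclic : ∀ (v : V) (p : Quiver.Path v v), p.length = 0

/-- `D` is a left regular free directed category. -/
def IsLeftRegularFreeDirected (k : Type uk) [Field k] (D : Type w) [Category.{u} D] [Preadditive D]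
    [Linear k D] : Prop :=
  ∃ (V : Type w) (_ : Quiver.{w} V) (Q : BimoduleQuiver.{uk, u, w} k V),
    IsFiniteAcyclic V ∧ Q.LeftRegular ∧ Q.Presents D

/-- `D` is a regular (left and right regular) free directed category. -/
def IsRegularFreeDirected (k : Type uk) [Field k] (D : Type w) [Category.{u} D] [Preadditive D]
    [Linear k D] : Prop :=
  ∃ (V : Type w) (_ : Quiver.{w} V) (Q : BimoduleQuiver.{uk, u, w} k V),
    IsFiniteAcyclic V ∧ (Q.LeftRegular ∧ Q.RightRegular) ∧ Q.Presents D

end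

noncomputable section

set_option linter.unusedSectionVars false

/-! ### Local finite-dimensional algebras -/

section LocalAlgebra

/-! Write J for the off-diagonal ideal and Δ, Δ̄ for standard and proper standard modules.
Everything passes through two conditions: `LeftFreeAt e l` says that the left module J e_l is
projective, split into copies of A e_m with m ≠ l, and `RightFreeAt e p` says the same of the right
module e_p J. Being standardly stratified for all orders, and having a left regular free graded
category, are both equivalent to left freeness at every vertex. Being properly stratified for all
orders, and regularity, are equivalent to freeness on both sides at every vertex.

From freeness to stratification: let T be an upward closed set of vertices without l. Because J e_l
is a sum of copies of A e_m, the trace of the A e_t, t ∈ T, in A e_l is the direct sum of the traces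
in those copies. Recursion along the directed order filters all traces by standard modules
(`filt_traceIdeal`), and the kernel of P_l → Δ_l is such a trace. If A is also free on the right,
then Δ_μ is a free right module over e_μ A e_μ (`exists_corner_basis_mod_traceIdeal`), and a chain
of left ideals of this local algebra refines Δ_μ into proper standard modules
(`filt_propIdeal_sup`).

From stratification to freeness, one linear order for each vertex suffices. With l at the bottom and
the directed order reversed elsewhere, Δ_m = P_m for m ≠ l and the kernel of P_l → Δ_l is J e_l, so
the filtration yields free generators (`exists_free_family`). With p at the bottom and the directed
order kept elsewhere, the only factors of Δ̄_m for m ≠ p are its top and copies of S_p; bases of the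
spaces e_p Δ̄_m lift to free generators of e_p J (`rightFreeAt_of_isProperlyStratified`).

From A to the graded algebra: corresponding corners have equal dimension (`nonempty_corner_equiv`).
Generators pass in both directions through leading terms, since J is nilpotent, and counting
dimensions shows that they stay independent (`exists_gr_left_basis`, `leftFreeAt_of_gr_basis` and
their mirror images).

From the graded algebra to free categories: over local algebras regular bimodules are free. In a
left regular free category each morphism between distinct vertices is then uniquely a sum of
morphisms preceded by basis elements of the bimodules on the first arrows (`injective_firstMap`,
`exists_eq_firstMap`), which is left freeness of the graded algebra. Conversely, left freeness shows
by induction that the free category on degrees zero and one maps bijectively to the graded category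
(`presents_grQuiver`). -/

theorem isUnit_or_isNilpotent_of_idempotents (k : Type uk) [Field k] {R : Type u} [Ring R]
    [Algebra k R] [FiniteDimensional k R] (h : ∀ x : R, IsIdempotentElem x → x = 0 ∨ x = 1)
    (z : R) : IsUnit z ∨ IsNilpotent z := by
  have hint : IsIntegral k z := IsIntegral.of_finite k z
  obtain ⟨q, hq, hnd⟩ := Polynomial.exists_eq_pow_rootMultiplicity_mul_and_not_dvd
    (minpoly k z) (minpoly.ne_zero hint) 0
  rw [Polynomial.C_0, sub_zero] at hq hnd
  set n := (minpoly k z).rootMultiplicity 0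
  -- The exponent is `n + 1` and not `n` so that the idempotent `u(z) z^(n+1)` has a factor `z` even
  -- if `n = 0`. If the idempotent is `1`, then `z` is invertible; if it is `0`, then `z` is
  -- nilpotent.
  have hcop : IsCoprime (Polynomial.X ^ (n + 1) : Polynomial k) q :=
    IsCoprime.pow_left ((Polynomial.irreducible_X.coprime_iff_not_dvd).2 hnd)
  obtain ⟨u, v, huv⟩ := hcop
  have hz : Polynomial.aeval z (Polynomial.X ^ (n + 1) * q) = 0 := by
    rw [pow_succ', mul_assoc, ← hq, map_mul, minpoly.aeval, mul_zero]
  have h1 : Polynomial.aeval z (u * Polynomial.X ^ (n + 1)) + Polynomial.aeval z (v * q) = 1 := by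
    rw [← map_add, huv, map_one]
  have h2 : Polynomial.aeval z (u * Polynomial.X ^ (n + 1)) * Polynomial.aeval z (v * q) = 0 := by
    rw [← map_mul, show u * Polynomial.X ^ (n + 1) * (v * q) =
      u * v * (Polynomial.X ^ (n + 1) * q) by ring, map_mul, hz, mul_zero]
  have hid : IsIdempotentElem (Polynomial.aeval z (u * Polynomial.X ^ (n + 1))) := by
    have h3 := h1
    rw [← eq_sub_iff_add_eq'] at h3
    rw [h3, mul_sub, mul_one, sub_eq_zero] at h2
    exact h2.symm
  rcases h _ hid with h0 | h0
  · right
    rw [h0, zero_add] at h1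
    refine ⟨n + 1, ?_⟩
    have : z ^ (n + 1) = Polynomial.aeval z (v * (Polynomial.X ^ (n + 1) * q)) := by
      rw [show v * (Polynomial.X ^ (n + 1) * q) = Polynomial.X ^ (n + 1) * (v * q) by ring,
        map_mul, h1, mul_one, map_pow, Polynomial.aeval_X]
    rw [this, map_mul, hz, mul_zero]
  · left
    have e1 : z * Polynomial.aeval z (u * Polynomial.X ^ n) = 1 := by
      have : Polynomial.aeval z (Polynomial.X * (u * Polynomial.X ^ n)) = 1 := by
        rw [show Polynomial.X * (u * Polynomial.X ^ n) = u * Polynomial.X ^ (n + 1) by ring, h0]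
      rwa [map_mul, Polynomial.aeval_X] at this
    have e2 : Polynomial.aeval z (u * Polynomial.X ^ n) * z = 1 := by
      have : Polynomial.aeval z ((u * Polynomial.X ^ n) * Polynomial.X) = 1 := by
        rw [show u * Polynomial.X ^ n * Polynomial.X = u * Polynomial.X ^ (n + 1) by ring, h0]
      rwa [map_mul, Polynomial.aeval_X] at this
    exact ⟨⟨z, _, e1, e2⟩, rfl⟩

/-- In a finite-dimensional algebra a left inverse is a right inverse. -/
theorem mul_eq_one_comm_of_finiteDimensional (k : Type uk) [Field k] {R : Type u} [Ring R]
    [Algebra k R] [FiniteDimensional k R] {a b : R} (h : a * b = 1) : b * a = 1 := by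
  have : IsDedekindFiniteMonoid R := by
    have : IsArtinianRing R := IsArtinianRing.of_finite k R
    infer_instance
  exact mul_eq_one_symm h

/-- Each element is a unit or nilpotent, and the nilpotent elements form a two-sided ideal because
one-sided inverses are two-sided in finite dimension. Over an algebraically closed field each `a`
has a spectral value `r`, and `a - r` is then nilpotent; `r` is unique, so `a ↦ r` is multiplicative
and additive. -/
theorem exists_character_of_idempotents (k : Type uk) [Field k] [IsAlgClosed k] {R : Type u}
    [Ring R] [Nontrivial R] [Algebra k R] [FiniteDimensional k R]
    (h : ∀ x : R, IsIdempotentElem x → x = 0 ∨ x = 1) :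
    ∃ χ : R →ₐ[k] k, ∀ a, χ a = 0 → IsNilpotent a := by
  have hun := isUnit_or_isNilpotent_of_idempotents k h
  have hnot : ∀ a : R, IsNilpotent a → ¬ IsUnit a := fun a ha hu => by
    obtain ⟨n, hn⟩ := ha
    have := hu.pow n
    rw [hn] at this
    exact not_isUnit_zero this
  have hmulr : ∀ a b : R, IsNilpotent a → IsNilpotent (a * b) := fun a b ha => by
    refine (hun _).resolve_left fun hu => hnot a ha ?_
    obtain ⟨u, hu⟩ := hu
    have e : a * (b * ↑u⁻¹) = 1 := by rw [← mul_assoc, ← hu, Units.mul_inv]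
    exact ⟨⟨a, _, e, mul_eq_one_comm_of_finiteDimensional k e⟩, rfl⟩
  have hmull : ∀ a b : R, IsNilpotent b → IsNilpotent (a * b) := fun a b hb => by
    refine (hun _).resolve_left fun hu => hnot b hb ?_
    obtain ⟨u, hu⟩ := hu
    have e : (↑u⁻¹ * a) * b = 1 := by rw [mul_assoc, ← hu, Units.inv_mul]
    exact ⟨⟨b, _, mul_eq_one_comm_of_finiteDimensional k e, e⟩, rfl⟩
  have hadd : ∀ a b : R, IsNilpotent a → IsNilpotent b → IsNilpotent (a + b) := fun a b ha hb => by
    refine (hun _).resolve_left fun hu => ?_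
    obtain ⟨u, hu⟩ := hu
    have e : ↑u⁻¹ * a = 1 - ↑u⁻¹ * b := by
      rw [eq_sub_iff_add_eq, ← mul_add, ← hu, Units.inv_mul]
    refine hnot _ (hmull (↑u⁻¹) a ha) ?_
    rw [e]
    exact (hmull _ _ hb).isUnit_one_sub
  have hex : ∀ a : R, ∃ r : k, IsNilpotent (a - algebraMap k R r) := fun a => by
    obtain ⟨r, hr⟩ := spectrum.nonempty_of_isAlgClosed_of_finiteDimensional k a
    refine ⟨r, (hun _).resolve_left fun hu => hr ?_⟩
    have := hu.neg
    rwa [neg_sub] at this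
  have huniq : ∀ (a : R) (r s : k), IsNilpotent (a - algebraMap k R r) →
      IsNilpotent (a - algebraMap k R s) → r = s := fun a r s hr hs => by
    by_contra hne
    have h1 := hadd _ _ hr.neg hs
    rw [neg_sub, sub_add_sub_cancel, ← map_sub] at h1
    refine hnot _ h1 ?_
    exact (IsUnit.mk0 _ (sub_ne_zero.2 hne)).map (algebraMap k R)
  choose χ hχ using hex
  refine ⟨AlgHom.mk ⟨⟨⟨χ, ?_⟩, ?_⟩, ?_, ?_⟩ ?_, fun a ha => ?_⟩
  · refine huniq 1 _ _ (hχ 1) ?_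
    rw [map_one, sub_self]
    exact IsNilpotent.zero
  · intro a b
    refine huniq (a * b) _ _ (hχ _) ?_
    have : a * b - algebraMap k R (χ a * χ b) = (a - algebraMap k R (χ a)) * b +
        algebraMap k R (χ a) * (b - algebraMap k R (χ b)) := by
      rw [map_mul]; noncomm_ring
    rw [this]
    exact hadd _ _ (hmulr _ _ (hχ a)) (hmull _ _ (hχ b))
  · refine huniq 0 _ _ (hχ 0) ?_
    change IsNilpotent (0 - algebraMap k R 0)
    rw [map_zero, sub_self]
    exact IsNilpotent.zero
  · intro a b
    refine huniq (a + b) _ _ (hχ _) ?_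
    have : a + b - algebraMap k R (χ a + χ b) = (a - algebraMap k R (χ a)) +
        (b - algebraMap k R (χ b)) := by
      rw [map_add]; abel
    change IsNilpotent (a + b - algebraMap k R (χ a + χ b))
    rw [this]
    exact hadd _ _ (hχ a) (hχ b)
  · intro r
    refine huniq (algebraMap k R r) _ _ (hχ _) ?_
    change IsNilpotent (algebraMap k R r - algebraMap k R r)
    rw [sub_self]
    exact IsNilpotent.zero
  · have := hχ a
    change χ a = 0 at ha
    rwa [ha, map_zero, sub_zero] at this

end LocalAlgebra

/-! ### Directed algebras and their characters -/

theorem mem_corner_iff {k : Type uk} [Field k] {A : Type u} [Ring A] [Algebra k A] {Λ : Type w}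
    {e : Λ → A} (he : ∀ l, IsIdempotentElem (e l)) {l m : Λ} {z : A} :
    z ∈ corner k e l m ↔ e m * z = z ∧ z * e l = z := by
  rw [mem_corner]
  constructor
  · rintro ⟨a, rfl⟩
    refine ⟨?_, ?_⟩
    · rw [← mul_assoc, (he m).eq]
    · rw [mul_assoc, mul_assoc, (he l).eq]
  · rintro ⟨h1, h2⟩
    exact ⟨z, by rw [h2, h1]⟩

/-- A directed algebra with its order relation, in which every corner `e_l A e_l` is local with
residue field `k`; the projection of `A` to the residue field at `l` is the character `χ l`. -/
structure DirectedStructure (k : Type uk) [Field k] {A : Type u} [Ring A] [Algebra k A]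
    {Λ : Type w} [Fintype Λ] (e : Λ → A) where
  /-- The family is complete and orthogonal. -/
  idem : CompleteOrthogonalIdempotents e
  /-- The strict order relation. -/
  lt : Λ → Λ → Prop
  trans : ∀ {a b c}, lt a b → lt b c → lt a c
  irrefl : ∀ a, ¬ lt a a
  eq_zero : ∀ {l m : Λ} {z : A}, l ≠ m → ¬ lt l m → e m * z = z → z * e l = z → z = 0
  /-- The character at `l`. -/
  χ : Λ → A →ₐ[k] k
  χ_self : ∀ l, χ l (e l) = 1
  nilp : ∀ {l : Λ} {a : A}, χ l a = 0 → IsNilpotent (e l * a * e l)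

/-- Directedness makes the compression `a ↦ e l * a * e l` multiplicative, hence an algebra map onto
the corner at `l`. Primitivity leaves the corner only trivial idempotents, so it has a character
with nilpotent kernel, and `χ l` is the composite. -/
theorem exists_directedStructure {k : Type uk} [Field k] [IsAlgClosed k] {A : Type u} [Ring A]
    [Algebra k A] [FiniteDimensional k A] {Λ : Type w} [Fintype Λ] {e : Λ → A}
    (he : IsBasicFamily e) (hd : IsDirectedFamily k e) : Nonempty (DirectedStructure k e) := by
  obtain ⟨P, hP⟩ := hd
  have hc := he.toCompleteOrthogonalIdempotents
  have hzero : ∀ {l m : Λ} {z : A}, l ≠ m → ¬ l < m → e m * z = z → z * e l = z → z = 0 := by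
    intro l m z hne hlt h1 h2
    by_contra h0
    have hmem : z ∈ corner k e l m := (mem_corner_iff hc.idem).2 ⟨h1, h2⟩
    have hbot : corner k e l m ≠ ⊥ := fun h => h0 (by rw [h] at hmem; simpa using hmem)
    exact hlt (lt_of_le_of_ne (hP l m hbot) hne)
  have hχ : ∀ l, ∃ χ : A →ₐ[k] k, χ (e l) = 1 ∧ ∀ a, χ a = 0 → IsNilpotent (e l * a * e l) := by
    intro l
    let X : AssocCat k e hc.idem := ⟨l⟩
    have fin : FiniteDimensional k (End X) :=
      inferInstanceAs (FiniteDimensional k (corner k e l l))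
    have nt : Nontrivial (End X) := by
      refine ⟨⟨1, 0, fun h => ?_⟩⟩
      exact (he.primitive l).2.1 (congrArg Subtype.val h)
    have hid : ∀ x : End X, IsIdempotentElem x → x = 0 ∨ x = 1 := by
      intro x hx
      obtain ⟨h1, h2⟩ := (mem_corner_iff hc.idem).1 x.2
      change e l * x.1 = x.1 at h1
      change x.1 * e l = x.1 at h2
      have hx' : x.1 * x.1 = x.1 := congrArg Subtype.val hx
      -- An idempotent `x` of the corner splits `e l` as `x + (e l - x)`.
      rcases (he.primitive l).2.2 x.1 (e l - x.1) hx'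
        (by
          change (e l - x.1) * (e l - x.1) = e l - x.1
          rw [mul_sub, sub_mul, sub_mul, (hc.idem l).eq, h1, h2, hx', sub_self, sub_zero])
        (by rw [mul_sub, h2, hx', sub_self]) (by rw [sub_mul, h1, hx', sub_self])
        (by abel) with h | h
      · exact Or.inl (Subtype.ext h)
      · exact Or.inr (Subtype.ext (sub_eq_zero.1 h).symm)
    obtain ⟨χ, hχ⟩ := exists_character_of_idempotents k hid
    let φ : A →ₐ[k] End X := AlgHom.mk
      ⟨⟨⟨fun a => ⟨e l * (a * e l), mem_corner.2 ⟨a, rfl⟩⟩, by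
          apply Subtype.ext
          change e l * (1 * e l) = e l
          rw [one_mul, (hc.idem l).eq]⟩, by
          intro a b
          apply Subtype.ext
          change e l * (a * b * e l) = e l * (a * e l) * (e l * (b * e l))
          have h1 : e l * (a * b * e l) = ∑ m, e l * (a * e m) * (e m * (b * e l)) := by
            have : ∀ m, e l * (a * e m) * (e m * (b * e l)) = e l * a * e m * (b * e l) := by
              intro m
              simp only [← mul_assoc]
              rw [mul_assoc (e l * a), (hc.idem m).eq]
            rw [Finset.sum_congr rfl fun m _ => this m, ← Finset.sum_mul, ← Finset.mul_sum,
              hc.complete]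
            simp only [mul_assoc, one_mul]
          -- A term with `m ≠ l` is a product along a cycle from `l` through `m` back to `l`, so one
          -- of its factors vanishes.
          rw [h1, Finset.sum_eq_single l _ (fun h => absurd (Finset.mem_univ l) h)]
          intro m _ hm
          by_cases hlm : l < m
          · have : e l * (a * e m) = 0 := hzero hm (not_lt_of_gt hlm)
              (by rw [← mul_assoc, (hc.idem l).eq]) (by rw [mul_assoc, mul_assoc, (hc.idem m).eq])
            rw [this, zero_mul]
          · have : e m * (b * e l) = 0 := hzero hm.symm hlm
              (by rw [← mul_assoc, (hc.idem m).eq]) (by rw [mul_assoc, mul_assoc, (hc.idem l).eq])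
            rw [this, mul_zero]⟩, by
          apply Subtype.ext
          change e l * (0 * e l) = 0
          rw [zero_mul, mul_zero], by
          intro a b
          apply Subtype.ext
          change e l * ((a + b) * e l) = e l * (a * e l) + e l * (b * e l)
          rw [add_mul, mul_add]⟩ (by
          intro r
          apply Subtype.ext
          change e l * (algebraMap k A r * e l) = r • e l
          rw [← Algebra.smul_def, mul_smul_comm, (hc.idem l).eq])
    have hφ : φ (e l) = 1 := by
      apply Subtype.ext
      change e l * (e l * e l) = e l
      rw [(hc.idem l).eq, (hc.idem l).eq]
    refine ⟨χ.comp φ, ?_, fun a ha => ?_⟩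
    · rw [AlgHom.comp_apply, hφ, map_one]
    · obtain ⟨n, hn⟩ := hχ (φ a) ha
      -- Only positive powers agree: the zeroth power is `e l` in the corner and `1` in `A`.
      have key : ∀ n : ℕ, ((φ a) ^ (n + 1)).1 = (e l * a * e l) ^ (n + 1) := by
        intro n
        induction n with
        | zero =>
          rw [zero_add, pow_one, pow_one, mul_assoc]
          rfl
        | succ n ih =>
          rw [pow_succ, pow_succ (e l * a * e l)]
          change ((φ a) ^ (n + 1)).1 * (e l * (a * e l)) = _
          rw [ih, mul_assoc (e l) a]
      refine ⟨n + 1, ?_⟩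
      rw [← key n, pow_succ, hn, zero_mul]
      rfl
  choose χ h1 h2 using hχ
  exact ⟨⟨hc, (· < ·), lt_trans, lt_irrefl, hzero, χ, h1, fun h => h2 _ _ h⟩⟩

namespace DirectedStructure

variable {k : Type uk} [Field k] {A : Type u} [Ring A] [Algebra k A] {Λ : Type w} [Fintype Λ]
  {e : Λ → A} (d : DirectedStructure k e)

theorem idem_mul (d : DirectedStructure k e) (l : Λ) : e l * e l = e l := d.idem.idem l

theorem ortho (d : DirectedStructure k e) {l m : Λ} (h : l ≠ m) : e l * e m = 0 := d.idem.ortho h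

theorem sum_mul (d : DirectedStructure k e) (a : A) : ∑ l, e l * a = a := by
  rw [← Finset.sum_mul, d.idem.complete, one_mul]

theorem mul_sum (d : DirectedStructure k e) (a : A) : ∑ l, a * e l = a := by
  rw [← Finset.mul_sum, d.idem.complete, mul_one]

theorem χ_of_ne {l m : Λ} (h : l ≠ m) : d.χ l (e m) = 0 := by
  have := congrArg (d.χ l) (d.ortho h)
  rwa [map_mul, d.χ_self, one_mul, map_zero] at this

theorem e_ne_zero (d : DirectedStructure k e) (l : Λ) : e l ≠ 0 := fun h => by
  have := d.χ_self l
  rw [h, map_zero] at this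
  exact zero_ne_one this

theorem χ_of_corner {l m n : Λ} {z : A} (hn : l ≠ m) (h1 : e m * z = z) (h2 : z * e l = z) :
    d.χ n z = 0 := by
  by_cases h : n = m
  · rw [← h2, map_mul, d.χ_of_ne (h.trans_ne hn.symm), mul_zero]
  · rw [← h1, map_mul, d.χ_of_ne h, zero_mul]

theorem wf_lt : WellFounded d.lt := by
  have : IsTrans Λ d.lt := ⟨fun _ _ _ => d.trans⟩
  have : Std.Irrefl d.lt := ⟨d.irrefl⟩
  exact Finite.wellFounded_of_trans_of_irrefl d.lt

theorem wf_gt : WellFounded fun a b => d.lt b a := by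
  have : IsTrans Λ fun a b => d.lt b a := ⟨fun _ _ _ h h' => d.trans h' h⟩
  have : Std.Irrefl fun a b => d.lt b a := ⟨d.irrefl⟩
  exact Finite.wellFounded_of_trans_of_irrefl _

/-- The radical of a directed algebra: the intersection of the kernels of the characters. -/
def rad : Submodule k A := ⨅ l, LinearMap.ker (d.χ l).toLinearMap

theorem mem_rad {a : A} : a ∈ d.rad ↔ ∀ l, d.χ l a = 0 := by
  simp [rad, Submodule.mem_iInf]

theorem mul_mem_rad (b : A) {a : A} (h : a ∈ d.rad) : b * a ∈ d.rad :=
  d.mem_rad.2 fun l => by rw [map_mul, d.mem_rad.1 h l, mul_zero]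

/-- This is injectivity of left multiplication by `1 + a`. Once the components `e q * b` with `q`
below `p` vanish, the `p`-component of the equation involves only the nilpotent element `e p * a * e
p`, and iterating it kills `e p * b`. -/
theorem eq_zero_of_add_mul_eq_zero {a : A} (h : a ∈ d.rad) {b : A} (hb : b + a * b = 0) :
    b = 0 := by
  have key : ∀ p, e p * b = 0 := by
    intro p
    induction p using d.wf_lt.induction with
    | _ p ih =>
      have h1 : e p * (a * b) = e p * a * e p * (e p * b) := by
        have : e p * (a * b) = ∑ q, (e p * a * e q) * (e q * b) := by
          have h2 : ∀ q, (e p * a * e q) * (e q * b) = (e p * a * e q) * b := fun q => by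
            rw [mul_assoc, ← mul_assoc (e q), d.idem_mul, ← mul_assoc]
          rw [Finset.sum_congr rfl fun q _ => h2 q, ← Finset.sum_mul, d.mul_sum, mul_assoc]
        rw [this, Finset.sum_eq_single p _ (fun h => absurd (Finset.mem_univ p) h)]
        intro q _ hq
        by_cases hlt : d.lt q p
        · rw [ih q hlt, mul_zero]
        · rw [d.eq_zero hq hlt (z := e p * a * e q)
            (by rw [← mul_assoc, ← mul_assoc, d.idem_mul]) (by rw [mul_assoc, d.idem_mul]),
            zero_mul]
      have h3 : e p * b = -((e p * a * e p) * (e p * b)) := by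
        rw [← h1, eq_neg_iff_add_eq_zero, ← mul_add, hb, mul_zero]
      obtain ⟨n, hn⟩ := d.nilp (d.mem_rad.1 h p)
      have h4 : ∀ n : ℕ, e p * b = (-(e p * a * e p)) ^ n * (e p * b) := by
        intro n
        induction n with
        | zero => rw [pow_zero, one_mul]
        | succ n ih => rw [pow_succ, mul_assoc, neg_mul (e p * a * e p), ← h3, ← ih]
      rw [h4 n, neg_pow, hn, mul_zero, zero_mul]
  rw [← d.sum_mul b]
  exact Finset.sum_eq_zero fun p _ => key p

variable [FiniteDimensional k A]

theorem exists_mul_one_add_eq_one (d : DirectedStructure k e) {a : A} (h : a ∈ d.rad) :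
    ∃ b, b * (1 + a) = 1 := by
  have hinj : Function.Injective (LinearMap.mulLeft k (1 + a)) := by
    rw [← LinearMap.ker_eq_bot, LinearMap.ker_eq_bot']
    intro b hb
    refine d.eq_zero_of_add_mul_eq_zero h ?_
    simpa [add_mul] using hb
  obtain ⟨b, hb⟩ := (LinearMap.injective_iff_surjective.1 hinj) 1
  exact ⟨b, mul_eq_one_comm_of_finiteDimensional k hb⟩

theorem mem_jacobson_of_mem_rad {a : A} (h : a ∈ d.rad) : a ∈ Ring.jacobson A := by
  rw [← Ideal.jacobson_bot, Ideal.mem_jacobson_iff]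
  intro y
  obtain ⟨b, hb⟩ := d.exists_mul_one_add_eq_one (d.mul_mem_rad y h)
  refine ⟨b, ?_⟩
  rw [mul_add, mul_one] at hb
  rw [mul_assoc, add_comm, hb, sub_self]
  exact Submodule.zero_mem _

theorem exists_rad_pow_eq_bot : ∃ n, d.rad ^ n = ⊥ := by
  have : IsArtinianRing A := IsArtinianRing.of_finite k A
  obtain ⟨n, hn⟩ := IsArtinianRing.isNilpotent_jacobson_bot (R := A)
  rw [Ideal.jacobson_bot] at hn
  have key : ∀ n, d.rad ^ n ≤ (Ring.jacobson A ^ n : Ideal A).restrictScalars k := by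
    intro n
    induction n with
    | zero =>
      intro x _
      rw [Submodule.pow_zero, Ideal.one_eq_top]
      exact Submodule.mem_top
    | succ n ih =>
      rw [pow_succ, Submodule.pow_succ]
      refine Submodule.mul_le.2 fun x hx y hy => ?_
      exact Ideal.mul_mem_mul (ih hx) (d.mem_jacobson_of_mem_rad hy)
  refine ⟨n, le_bot_iff.1 fun x hx => ?_⟩
  have := key n hx
  rw [hn] at this
  exact this

/-- If `X ⊆ Y + X rad` for subspaces with `Y rad ⊆ Y`, then `X ⊆ Y`. -/
theorem le_of_le_sup_mul_rad {X Y : Submodule k A} (h : X ≤ Y ⊔ X * d.rad)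
    (hY : Y * d.rad ≤ Y) : X ≤ Y := by
  -- Nakayama's argument: the inclusion is substituted into itself until the power of the radical is
  -- zero.
  have key : ∀ n : ℕ, X ≤ Y ⊔ X * d.rad ^ n := by
    intro n
    induction n with
    | zero => rw [pow_zero, mul_one]; exact le_sup_right
    | succ n ih =>
      calc X ≤ Y ⊔ X * d.rad := h
        _ ≤ Y ⊔ (Y ⊔ X * d.rad ^ n) * d.rad := by gcongr
        _ ≤ Y ⊔ X * d.rad ^ (n + 1) := by
          rw [Submodule.sup_mul, pow_succ, mul_assoc, ← sup_assoc]
          exact sup_le_sup_right (sup_le le_rfl hY) _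
  obtain ⟨n, hn⟩ := d.exists_rad_pow_eq_bot
  have := key n
  rwa [hn, Submodule.mul_bot, sup_bot_eq] at this

end DirectedStructure

/-! ### Composition factors over a directed algebra -/

namespace DirectedStructure

variable {k : Type uk} [Field k] {A : Type u} [Ring A] [Algebra k A] {Λ : Type w} [Fintype Λ]
  {e : Λ → A} (d : DirectedStructure k e)

theorem mem_proj (d : DirectedStructure k e) {l : Λ} {a : A} : a ∈ Proj e l ↔ a * e l = a := by
  rw [Submodule.mem_span_singleton]
  constructor
  · rintro ⟨b, rfl⟩
    rw [smul_eq_mul, mul_assoc, d.idem_mul]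
  · intro h
    exact ⟨a, h⟩

theorem e_mem_proj (l : Λ) : e l ∈ Proj e l := Submodule.mem_span_singleton_self _

theorem mul_e_mem_proj (a : A) (l : Λ) : a * e l ∈ Proj e l :=
  Submodule.smul_mem _ a (e_mem_proj l)

variable [FiniteDimensional k A]

/-- Up to the scalar `χ m a`, the element `e m * a` is `(1 + r) e m` with `r` in the radical, and `1
+ r` has a left inverse. -/
theorem exists_mul_eq_e (d : DirectedStructure k e) {m : Λ} {a : A} (ha : a * e m = a)
    (h : d.χ m a ≠ 0) : ∃ b, b * (e m * a) = e m := by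
  set r := d.χ m a
  have hrad : r⁻¹ • (e m * a) - e m ∈ d.rad := by
    rw [d.mem_rad]
    intro n
    by_cases hn : n = m
    · subst hn
      rw [map_sub, map_smul, map_mul, d.χ_self, one_mul, smul_eq_mul, inv_mul_cancel₀ h, sub_self]
    · rw [map_sub, map_smul, map_mul, d.χ_of_ne hn, zero_mul, smul_zero, sub_zero]
  obtain ⟨b, hb⟩ := d.exists_mul_one_add_eq_one hrad
  refine ⟨r⁻¹ • b, ?_⟩
  have h1 : (1 + (r⁻¹ • (e m * a) - e m)) * e m = r⁻¹ • (e m * a) := by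
    rw [add_mul, sub_mul, smul_mul_assoc, mul_assoc, ha, d.idem_mul, one_mul]
    abel
  rw [smul_mul_assoc, ← mul_smul_comm, ← h1, ← mul_assoc, hb, one_mul]

/-- The maximal submodule of `P_l`. -/
def maxSub (l : Λ) : Submodule A (Proj e l) where
  carrier := {x | d.χ l x = 0}
  add_mem' {x y} hx hy := by
    change d.χ l (x + y : A) = 0
    rw [map_add, show d.χ l x = 0 from hx, show d.χ l y = 0 from hy, add_zero]
  zero_mem' := map_zero (d.χ l)
  smul_mem' a x hx := by
    change d.χ l (a * x) = 0
    rw [map_mul, show d.χ l x = 0 from hx, mul_zero]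

theorem mem_maxSub {l : Λ} {x : Proj e l} : x ∈ d.maxSub l ↔ d.χ l x = 0 := Iff.rfl

theorem eq_top_of_e_mem (d : DirectedStructure k e) {l : Λ} {U : Submodule A (Proj e l)}
    (h : (⟨e l, e_mem_proj l⟩ : Proj e l) ∈ U) : U = ⊤ := by
  refine top_le_iff.1 fun x _ => ?_
  have : x = (x : A) • (⟨e l, e_mem_proj l⟩ : Proj e l) :=
    Subtype.ext (d.mem_proj.1 x.2).symm
  rw [this]
  exact U.smul_mem _ h

theorem eq_top_of_mem {l : Λ} {U : Submodule A (Proj e l)} {x : Proj e l} (hx : x ∈ U)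
    (h : d.χ l x ≠ 0) : U = ⊤ := by
  obtain ⟨b, hb⟩ := d.exists_mul_eq_e (d.mem_proj.1 x.2) h
  refine d.eq_top_of_e_mem ?_
  have : (⟨e l, e_mem_proj l⟩ : Proj e l) = (b * e l) • x := by
    apply Subtype.ext
    change e l = b * e l * x
    rw [mul_assoc, hb]
  rw [this]
  exact U.smul_mem _ hx

/-- An element on which `χ l` does not vanish generates `P_l`, so every proper submodule lies in the
kernel of `χ l`, which is therefore the unique maximal submodule. -/
theorem jacobson_proj (l : Λ) : Module.jacobson A (Proj e l) = d.maxSub l := by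
  have hle : ∀ U : Submodule A (Proj e l), U ≠ ⊤ → U ≤ d.maxSub l := fun U hU x hx => by
    by_contra h
    exact hU (d.eq_top_of_mem hx h)
  have hne : d.maxSub l ≠ ⊤ := fun h => by
    have : (⟨e l, e_mem_proj l⟩ : Proj e l) ∈ d.maxSub l := by rw [h]; exact Submodule.mem_top
    rw [mem_maxSub, d.χ_self] at this
    exact one_ne_zero this
  have hco : IsCoatom (d.maxSub l) := ⟨hne, fun U hU => by
    by_contra h
    exact not_le_of_gt hU (hle U h)⟩
  refine le_antisymm (sInf_le hco) (le_sInf fun U hU => ?_)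
  rcases hU.le_iff.1 (hle U hU.1) with h | h
  · exact absurd h hne
  · exact h.le

theorem mem_jacobson_proj {l : Λ} {x : Proj e l} :
    x ∈ Module.jacobson A (Proj e l) ↔ d.χ l x = 0 := by
  rw [d.jacobson_proj, mem_maxSub]

section Factors

variable {M : Type u} [AddCommGroup M] [Module A M]

theorem sum_smul (d : DirectedStructure k e) (x : M) : ∑ l, e l • x = x := by
  rw [← Finset.sum_smul, d.idem.complete, one_smul]

theorem e_smul_simp_of_ne (d : DirectedStructure k e) {l m : Λ} (h : l ≠ m) (x : Simp e l) : e m • x = 0 := by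
  obtain ⟨x, rfl⟩ := Submodule.Quotient.mk_surjective _ x
  rw [← Submodule.Quotient.mk_smul, Submodule.Quotient.mk_eq_zero, d.mem_jacobson_proj]
  change d.χ l (e m * x) = 0
  rw [map_mul, d.χ_of_ne h, zero_mul]

variable [Module k M] [IsScalarTower k A M]

/-- A simple subquotient is killed by the radical, so `A` acts on a component `e m • x` through `χ
m` alone. Any such component outside `N` spans the subquotient over `k`; this is the concrete form
of "the factor is S_m". -/
theorem exists_of_covBy {N N' : Submodule A M} (h : N ⋖ N') : ∃ m, ∃ y ∈ N', e m • y = y ∧ y ∉ N ∧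
    (∀ a : A, a • y - d.χ m a • y ∈ N) ∧ ∀ x ∈ N', ∃ c : k, x - c • y ∈ N := by
  have hs : IsSimpleModule A (N' ⧸ N.submoduleOf N') := (covBy_iff_quot_is_simple h.le).1 h
  have hrad : ∀ a ∈ d.rad, ∀ x ∈ N', a • x ∈ N := by
    intro a ha x hx
    have h1 := IsSemisimpleModule.jacobson_le_annihilator A (N' ⧸ N.submoduleOf N')
      (d.mem_jacobson_of_mem_rad ha)
    rw [Module.mem_annihilator] at h1
    have h2 := h1 (Submodule.Quotient.mk ⟨x, hx⟩)
    rw [← Submodule.Quotient.mk_smul, Submodule.Quotient.mk_eq_zero] at h2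
    exact h2
  obtain ⟨x, hx, hxN⟩ := SetLike.exists_of_lt h.lt
  obtain ⟨m, hm⟩ : ∃ m, e m • x ∉ N := by
    by_contra hcon
    push Not at hcon
    exact hxN (d.sum_smul x ▸ N.sum_mem fun m _ => hcon m)
  have hy : e m • x ∈ N' := N'.smul_mem _ hx
  have hmy : e m • e m • x = e m • x := by rw [← mul_smul, d.idem_mul]
  have key : ∀ a : A, a • e m • x - d.χ m a • e m • x ∈ N := by
    intro a
    have : a • e m • x - d.χ m a • e m • x = (a * e m - d.χ m a • e m) • e m • x := by
      rw [sub_smul, mul_smul, hmy, smul_assoc, hmy]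
    rw [this]
    refine hrad _ (d.mem_rad.2 fun n => ?_) _ hy
    by_cases hn : n = m
    · subst hn
      rw [map_sub, map_mul, map_smul, smul_eq_mul, sub_self]
    · rw [map_sub, map_mul, map_smul, d.χ_of_ne hn, mul_zero, smul_zero, sub_zero]
  refine ⟨m, e m • x, hy, hmy, hm, key, fun z hz => ?_⟩
  -- The sum is strictly larger than `N` and contained in `N'`, and nothing lies strictly between.
  have hsup : N ⊔ Submodule.span A {e m • x} = N' := by
    refine (h.eq_or_eq le_sup_left (sup_le h.le ?_)).resolve_left fun heq => hm ?_
    · rwa [Submodule.span_le, Set.singleton_subset_iff]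
    · rw [← heq]
      exact Submodule.mem_sup_right (Submodule.mem_span_singleton_self _)
  rw [← hsup] at hz
  obtain ⟨n, hn, t, ht, rfl⟩ := Submodule.mem_sup.1 hz
  obtain ⟨a, rfl⟩ := Submodule.mem_span_singleton.1 ht
  refine ⟨d.χ m a, ?_⟩
  rw [add_sub_assoc]
  exact N.add_mem hn (key a)

theorem nonempty_equiv_simp {N N' : Submodule A M} {m : Λ} {y : M} (hyN' : y ∈ N')
    (hm : e m • y = y) (hyN : y ∉ N) (hχ : ∀ a : A, a • y - d.χ m a • y ∈ N)
    (hspan : ∀ x ∈ N', ∃ c : k, x - c • y ∈ N) :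
    Nonempty (Subquot N N' ≃ₗ[A] Simp e m) := by
  let f : Proj e m →ₗ[A] Subquot N N' :=
    ((N.submoduleOf N').mkQ.comp (LinearMap.toSpanSingleton A N' ⟨y, hyN'⟩)).comp
      (Proj e m).subtype
  have hf : ∀ x : Proj e m, f x = Submodule.Quotient.mk ⟨(x : A) • y, N'.smul_mem _ hyN'⟩ :=
    fun x => rfl
  have hker : Module.jacobson A (Proj e m) = LinearMap.ker f := by
    ext x
    rw [d.mem_jacobson_proj, LinearMap.mem_ker, hf, Submodule.Quotient.mk_eq_zero]
    change _ ↔ (x : A) • y ∈ N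
    constructor
    · intro h
      have := hχ x
      rwa [h, zero_smul, sub_zero] at this
    · intro h
      by_contra h0
      have h1 := N.sub_mem h (hχ x)
      rw [sub_sub_cancel] at h1
      have h2 : (d.χ m x)⁻¹ • d.χ m x • y ∈ N := by
        rw [← algebraMap_smul A (d.χ m (x : A))⁻¹]
        exact N.smul_mem _ h1
      rw [smul_smul, inv_mul_cancel₀ h0, one_smul] at h2
      exact hyN h2
  have hsurj : Function.Surjective f := by
    intro z
    obtain ⟨⟨x, hx⟩, rfl⟩ := Submodule.Quotient.mk_surjective _ z
    obtain ⟨c, hc⟩ := hspan x hx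
    refine ⟨algebraMap k A c • ⟨e m, e_mem_proj m⟩, ?_⟩
    rw [hf, Submodule.Quotient.eq]
    change (algebraMap k A c * e m) • y - x ∈ N
    rw [mul_smul, hm, algebraMap_smul, ← neg_sub]
    exact N.neg_mem hc
  exact ⟨((Submodule.quotEquivOfEq _ _ hker).trans
    (f.quotKerEquivOfSurjective hsurj)).symm⟩

variable (k) in
/-- The dimension of `e_l N` for a submodule `N`. -/
def eDim (e : Λ → A) (l : Λ) (N : Submodule A M) : ℕ :=
  Module.finrank k ((N.restrictScalars k).map (Algebra.lsmul k k M (e l)))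

variable [FiniteDimensional k M]

open scoped Classical in
-- The space `e l • S_m` is one-dimensional for `m = l` and zero otherwise, so the dimension jumps
-- exactly at the factors isomorphic to `S_l`.
theorem eDim_of_covBy (d : DirectedStructure k e) (l : Λ) {N N' : Submodule A M} (h : N ⋖ N') : eDim k e l N' =
    eDim k e l N + if Nonempty (Subquot N N' ≃ₗ[A] Simp e l) then 1 else 0 := by
  obtain ⟨m, y, hyN', hm, hyN, hχ, hspan⟩ := d.exists_of_covBy h
  obtain ⟨φ⟩ := d.nonempty_equiv_simp hyN' hm hyN hχ hspan
  have hle : N.restrictScalars k ≤ N'.restrictScalars k := h.le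
  by_cases hlm : l = m
  · subst hlm
    rw [if_pos ⟨φ⟩]
    have h1 : (N'.restrictScalars k).map (Algebra.lsmul k k M (e l)) =
        (N.restrictScalars k).map (Algebra.lsmul k k M (e l)) ⊔ Submodule.span k {y} := by
      apply le_antisymm
      · rintro _ ⟨x, hx, rfl⟩
        obtain ⟨c, hc⟩ := hspan x hx
        have : Algebra.lsmul k k M (e l) x = Algebra.lsmul k k M (e l) (x - c • y) + c • y := by
          rw [map_sub, map_smul]
          simp [hm]
        rw [this]
        exact Submodule.add_mem_sup (Submodule.mem_map_of_mem hc)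
          (Submodule.smul_mem _ _ (Submodule.mem_span_singleton_self y))
      · refine sup_le (Submodule.map_mono hle) ?_
        rw [Submodule.span_le, Set.singleton_subset_iff]
        exact ⟨y, hyN', by simpa using hm⟩
    unfold eDim
    rw [h1]
    have hy0 : y ≠ 0 := fun h => hyN (h ▸ N.zero_mem)
    have h2 := Submodule.finrank_sup_add_finrank_inf_eq
      ((N.restrictScalars k).map (Algebra.lsmul k k M (e l))) (Submodule.span k {y})
    have h3 : (N.restrictScalars k).map (Algebra.lsmul k k M (e l)) ⊓ Submodule.span k {y} = ⊥ := by
      rw [← disjoint_iff, Submodule.disjoint_span_singleton' hy0]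
      rintro ⟨x, hx, hxy⟩
      refine hyN (hxy ▸ ?_)
      exact N.smul_mem _ hx
    rw [h3, finrank_bot, add_zero, finrank_span_singleton hy0] at h2
    exact h2
  · rw [if_neg, add_zero]
    · unfold eDim
      have h1 : (N'.restrictScalars k).map (Algebra.lsmul k k M (e l)) =
          (N.restrictScalars k).map (Algebra.lsmul k k M (e l)) := by
        apply le_antisymm _ (Submodule.map_mono hle)
        rintro _ ⟨x, hx, rfl⟩
        obtain ⟨c, hc⟩ := hspan x hx
        refine ⟨x - c • y, hc, ?_⟩
        rw [map_sub, map_smul]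
        have : e l • y = 0 := by rw [← hm, smul_smul, d.ortho hlm, zero_smul]
        simp [this]
      rw [h1]
    · rintro ⟨ψ⟩
      have h1 := d.e_smul_simp_of_ne hlm (ψ (Submodule.Quotient.mk ⟨y, hyN'⟩))
      rw [← map_smul, LinearEquiv.map_eq_zero_iff, ← Submodule.Quotient.mk_smul,
        Submodule.Quotient.mk_eq_zero] at h1
      refine hyN ?_
      rw [← hm]
      exact h1

theorem telescope_fin : ∀ (n : ℕ) (f : Fin (n + 1) → ℕ) (g : Fin n → ℕ),
    (∀ i : Fin n, f i.succ = f i.castSucc + g i) → f (Fin.last n) = f 0 + ∑ i, g i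
  | 0, f, g, _ => by simp
  | n + 1, f, g, h => by
    rw [Fin.sum_univ_castSucc, ← add_assoc, ← Fin.succ_last, h (Fin.last n)]
    have := telescope_fin n (fun i => f i.castSucc) (fun i => g i.castSucc) (fun i => by
      have := h i.castSucc
      rw [← this, Fin.succ_castSucc])
    rw [this]
    rfl

open scoped Classical in
-- Adding the jumps along a composition series gives the same number for every series, so the
-- existential definition of multiplicity is a genuine function of the module.
theorem hasMultiplicity_iff (d : DirectedStructure k e) (l : Λ) (n : ℕ) :
    HasMultiplicity (A := A) (Simp e l) M n ↔ eDim k e l (⊤ : Submodule A M) = n := by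
  have key : ∀ s : CompositionSeries (Submodule A M), s.head = ⊥ → s.last = ⊤ →
      Nat.card {i : Fin s.length // Nonempty (Subquot (s i.castSucc) (s i.succ) ≃ₗ[A] Simp e l)} =
        eDim k e l (⊤ : Submodule A M) := by
    intro s h0 h1
    have h2 := telescope_fin s.length (fun i => eDim k e l (s i))
      (fun i => if Nonempty (Subquot (s i.castSucc) (s i.succ) ≃ₗ[A] Simp e l) then 1 else 0)
      (fun i => d.eDim_of_covBy l (s.step i))
    have h3 : eDim k e l (s 0) = 0 := by
      have : s 0 = ⊥ := h0
      rw [this]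
      unfold eDim
      rw [show (⊥ : Submodule A M).restrictScalars k = ⊥ from rfl,
        Submodule.map_bot, finrank_bot]
    have h4 : s (Fin.last s.length) = ⊤ := h1
    rw [h3, zero_add, h4] at h2
    rw [h2, Nat.card_eq_fintype_card, Fintype.card_subtype, Finset.card_filter]
  constructor
  · rintro ⟨s, h0, h1, rfl⟩
    exact (key s h0 h1).symm
  · rintro rfl
    have : IsArtinian A M := isArtinian_of_tower k inferInstance
    have : IsNoetherian A M := isNoetherian_of_tower k inferInstance
    obtain ⟨s, h0, h1⟩ := exists_compositionSeries_of_isNoetherian_isArtinian A M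
    exact ⟨s, h0, h1, key s h0 h1⟩

theorem hasMultiplicity_zero_iff (d : DirectedStructure k e) (l : Λ) :
    HasMultiplicity (A := A) (Simp e l) M 0 ↔ ∀ x : M, e l • x = 0 := by
  rw [d.hasMultiplicity_iff l 0]
  unfold eDim
  rw [Submodule.finrank_eq_zero, eq_bot_iff]
  constructor
  · intro h x
    exact h ⟨x, trivial, rfl⟩
  · rintro h _ ⟨x, -, rfl⟩
    exact h x

end Factors

instance (l : Λ) : FiniteDimensional k (Proj e l) :=
  inferInstanceAs (FiniteDimensional k ((Proj e l).restrictScalars k))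

theorem hasMultiplicity_quotient_zero_iff (d : DirectedStructure k e) (l m : Λ) (U : Submodule A (Proj e l)) :
    HasMultiplicity (A := A) (Simp e m) (Proj e l ⧸ U) 0 ↔ ∀ x : Proj e l, e m • x ∈ U := by
  have : FiniteDimensional k (Proj e l ⧸ U) :=
    inferInstanceAs (FiniteDimensional k (Proj e l ⧸ U.restrictScalars k))
  rw [d.hasMultiplicity_zero_iff m]
  constructor
  · intro h x
    have := h (Submodule.Quotient.mk x)
    rwa [← Submodule.Quotient.mk_smul, Submodule.Quotient.mk_eq_zero] at this
  · intro h x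
    obtain ⟨x, rfl⟩ := Submodule.Quotient.mk_surjective _ x
    rw [← Submodule.Quotient.mk_smul, Submodule.Quotient.mk_eq_zero]
    exact h x

/-- The space `e l • (P_l / U)` always contains the class of `e l`, which is nonzero when `U` is
proper. It is one-dimensional exactly when this class spans it, that is, when the radical of the
corner acts as zero. -/
theorem hasMultiplicity_quotient_one_iff (l : Λ) (U : Submodule A (Proj e l)) :
    HasMultiplicity (A := A) (Simp e l) (Proj e l ⧸ U) 1 ↔
      U ≠ ⊤ ∧ ∀ x : Proj e l, d.χ l x = 0 → e l • x ∈ U := by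
  have : FiniteDimensional k (Proj e l ⧸ U) :=
    inferInstanceAs (FiniteDimensional k (Proj e l ⧸ U.restrictScalars k))
  rw [d.hasMultiplicity_iff l 1]
  unfold eDim
  rw [show (⊤ : Submodule A (Proj e l ⧸ U)).restrictScalars k = ⊤ from rfl]
  let y : Proj e l := ⟨e l, e_mem_proj l⟩
  have hy : e l • y = y := Subtype.ext (d.idem_mul l)
  have hχy : d.χ l y = 1 := d.χ_self l
  constructor
  · intro h
    have hU : U ≠ ⊤ := by
      rintro rfl
      have : Subsingleton (Proj e l ⧸ (⊤ : Submodule A (Proj e l))) :=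
        Submodule.Quotient.subsingleton_iff.2 rfl
      rw [Module.finrank_zero_of_subsingleton] at h
      exact zero_ne_one h
    refine ⟨hU, fun x hx => ?_⟩
    have hyU : y ∉ U := fun h => hU (d.eq_top_of_e_mem h)
    have hmem : ∀ z : Proj e l, (Submodule.Quotient.mk (e l • z) : Proj e l ⧸ U) ∈
        (⊤ : Submodule k (Proj e l ⧸ U)).map (Algebra.lsmul k k (Proj e l ⧸ U) (e l)) :=
      fun z => ⟨Submodule.Quotient.mk z, trivial, rfl⟩
    obtain ⟨c, hc⟩ := exists_smul_eq_of_finrank_eq_one h (x := ⟨_, hmem y⟩)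
      (by
        intro h0
        have h1 : (Submodule.Quotient.mk (e l • y) : Proj e l ⧸ U) = 0 := congrArg Subtype.val h0
        rw [hy, Submodule.Quotient.mk_eq_zero] at h1
        exact hyU h1) ⟨_, hmem x⟩
    have hc' : (Submodule.Quotient.mk (c • y) : Proj e l ⧸ U) = Submodule.Quotient.mk (e l • x) := by
      have := congrArg Subtype.val hc
      rw [← hy]
      exact this
    rw [Submodule.Quotient.eq] at hc'
    -- If `c` were nonzero, then `c • y - e l • x` would be an element of `U` with `χ l` equal to
    -- `c`, and it would generate `P_l`.
    have hc0 : c = 0 := by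
      by_contra hc0
      refine hU (d.eq_top_of_mem hc' ?_)
      change d.χ l (c • (y : A) - e l * x) ≠ 0
      rw [map_sub, map_smul, map_mul, hχy, hx, mul_zero, sub_zero, smul_eq_mul, mul_one]
      exact hc0
    rw [hc0, zero_smul, zero_sub] at hc'
    exact (Submodule.neg_mem_iff U).1 hc'
  · rintro ⟨hU, h⟩
    have hyU : (Submodule.Quotient.mk y : Proj e l ⧸ U) ≠ 0 := fun h0 =>
      hU (d.eq_top_of_e_mem ((Submodule.Quotient.mk_eq_zero U).1 h0))
    rw [← finrank_span_singleton (K := k) hyU]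
    have : (⊤ : Submodule k (Proj e l ⧸ U)).map (Algebra.lsmul k k (Proj e l ⧸ U) (e l)) =
        Submodule.span k {Submodule.Quotient.mk y} := by
      apply le_antisymm
      · rintro _ ⟨x, -, rfl⟩
        obtain ⟨x, rfl⟩ := Submodule.Quotient.mk_surjective _ x
        rw [Submodule.mem_span_singleton]
        refine ⟨d.χ l x, ?_⟩
        have h1 := h (x - d.χ l x • y) (by
          change d.χ l ((x : A) - d.χ l x • (y : A)) = 0
          rw [map_sub, map_smul, hχy, smul_eq_mul, mul_one, sub_self])
        rw [smul_sub, smul_comm, hy] at h1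
        exact ((Submodule.Quotient.eq U).2 h1).symm
      · rw [Submodule.span_le, Set.singleton_subset_iff]
        exact ⟨Submodule.Quotient.mk y, trivial, congrArg Submodule.Quotient.mk hy⟩
    rw [this]

end DirectedStructure

/-! ### Filtrations of left ideals by cyclic modules -/

section Filt

variable {A : Type u} [Ring A] {Λ : Type w}

/-- A left ideal has a finite filtration in which each step adjoins a generator `y = e_μ y` such
that the step is isomorphic to `A e_μ / K_μ` through `a ↦ a y`. -/
inductive Filt (e : Λ → A) (K : Λ → Submodule A A) (p : Λ → Prop) : Submodule A A → Prop
  | bot : Filt e K p ⊥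
  | step {F : Submodule A A} (μ : Λ) (y : A) : Filt e K p F → p μ → e μ * y = y →
      (∀ a, a * e μ = a → (a * y ∈ F ↔ a ∈ K μ)) → Filt e K p (F ⊔ Submodule.span A {y})

/-- The kernel of `A e_l → (A e_l) / U` as a left ideal. -/
abbrev idealOf {e : Λ → A} (K : ∀ l, Submodule A (Proj e l)) (l : Λ) : Submodule A A :=
  (K l).map (Proj e l).subtype

theorem mem_idealOf {e : Λ → A} {K : ∀ l, Submodule A (Proj e l)} {l : Λ} (x : Proj e l) :
    (x : A) ∈ idealOf K l ↔ x ∈ K l := by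
  constructor
  · rintro ⟨y, hy, hxy⟩
    rwa [← Subtype.ext hxy]
  · intro h
    exact ⟨x, h, rfl⟩

theorem Filt.mono_pred {e : Λ → A} {K : Λ → Submodule A A} {p q : Λ → Prop}
    (h : ∀ l, p l → q l) {G : Submodule A A} (hG : Filt e K p G) : Filt e K q G := by
  induction hG with
  | bot => exact .bot
  | step μ y _ hμ hy hK ih => exact .step μ y ih (h μ hμ) hy hK

theorem Filt.exists_chain {e : Λ → A} {K : Λ → Submodule A A} {p : Λ → Prop}
    {G : Submodule A A} (hG : Filt e K p G) : ∃ (n : ℕ) (F : ℕ → Submodule A A), F 0 = ⊥ ∧ F n = G ∧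
      ∀ i < n, ∃ μ y, p μ ∧ e μ * y = y ∧ F (i + 1) = F i ⊔ Submodule.span A {y} ∧
        ∀ a, a * e μ = a → (a * y ∈ F i ↔ a ∈ K μ) := by
  induction hG with
  | bot => exact ⟨0, fun _ => ⊥, rfl, rfl, fun i hi => absurd hi (Nat.not_lt_zero i)⟩
  | @step F' μ y _ hμ hy hK ih =>
    obtain ⟨n, F, h0, hn, h⟩ := ih
    refine ⟨n + 1, fun i => if i ≤ n then F i else F' ⊔ Submodule.span A {y}, ?_, ?_, ?_⟩
    · simp [h0]
    · simp
    · intro i hi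
      rcases Nat.lt_succ_iff_lt_or_eq.1 hi with hi | rfl
      · obtain ⟨μ', y', h1, h2, h3, h4⟩ := h i hi
        refine ⟨μ', y', h1, h2, ?_, ?_⟩
        · simp only [if_pos (Nat.succ_le_of_lt hi), if_pos hi.le, h3]
        · simpa only [if_pos hi.le] using h4
      · refine ⟨μ, y, hμ, hy, ?_, ?_⟩
        · simp [hn]
        · simpa [hn] using hK

end Filt

namespace DirectedStructure

variable {k : Type uk} [Field k] {A : Type u} [Ring A] [Algebra k A] {Λ : Type w} [Fintype Λ]
  {e : Λ → A} (d : DirectedStructure k e)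

/-- Embedding the module in `A` replaces abstract isomorphisms of subquotients by generators and
annihilator conditions in `A`. All later arguments about filtrations are inductions on `Filt`. -/
theorem hasFiltration_iff (d : DirectedStructure k e) (K : ∀ l, Submodule A (Proj e l))
    (p : Λ → Prop) {M : Type u} [AddCommGroup M] [Module A M] (j : M →ₗ[A] A)
    (hj : Function.Injective j) :
    HasFiltration (A := A) (fun m => Proj e m ⧸ K m) p M ↔
      Filt e (idealOf K) p (LinearMap.range j) := by
  constructor
  · rintro ⟨n, F, h0, hn, h⟩
    have key : ∀ i ≤ n, Filt e (idealOf K) p ((F i).map j) := by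
      intro i
      induction i with
      | zero => intro _; rw [h0, Submodule.map_bot]; exact .bot
      | succ i ih =>
        intro hi
        obtain ⟨hle, μ, hμ, ⟨φ⟩⟩ := h i hi
        let u : Proj e μ ⧸ K μ := Submodule.Quotient.mk ⟨e μ, e_mem_proj μ⟩
        obtain ⟨⟨y, hy⟩, hyu⟩ := Submodule.Quotient.mk_surjective _ (φ.symm u)
        have hu : e μ • u = u :=
          congrArg Submodule.Quotient.mk (Subtype.ext (d.idem_mul μ))
        -- A lift `y` of the generator is replaced by `e μ • y`, which represents the same class and
        -- is fixed by `e μ`.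
        have hey : e μ • y ∈ F (i + 1) := Submodule.smul_mem _ _ hy
        have hyu' : (Submodule.Quotient.mk ⟨e μ • y, hey⟩ : Subquot (F i) (F (i + 1))) =
            φ.symm u := by
          rw [← hu, map_smul, ← hyu]
          rfl
        have hmem : ∀ (x : M) (hx : x ∈ F (i + 1)) (a : Proj e μ),
            x - (a : A) • e μ • y ∈ F i ↔
            φ (Submodule.Quotient.mk ⟨x, hx⟩) = Submodule.Quotient.mk a := by
          intro x hx a
          have ha : (Submodule.Quotient.mk a : Proj e μ ⧸ K μ) = (a : A) • u :=
            congrArg Submodule.Quotient.mk (Subtype.ext (d.mem_proj.1 a.2).symm)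
          rw [ha, ← LinearEquiv.eq_symm_apply, map_smul, ← hyu', ← Submodule.Quotient.mk_smul,
            Submodule.Quotient.eq]
          rfl
        have hG : (F (i + 1)).map j = (F i).map j ⊔ Submodule.span A {j (e μ • y)} := by
          apply le_antisymm
          · rintro _ ⟨x, hx, rfl⟩
            obtain ⟨a, ha⟩ := Submodule.Quotient.mk_surjective _
              (φ (Submodule.Quotient.mk ⟨x, hx⟩))
            have h1 := (hmem x hx a).2 ha.symm
            rw [← sub_add_cancel x ((a : A) • e μ • y), LinearMap.map_add]
            refine Submodule.add_mem_sup (S := (F i).map j) ⟨_, h1, rfl⟩ ?_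
            exact Submodule.mem_span_singleton.2 ⟨(a : A), (j.map_smul _ _).symm⟩
          · refine sup_le (Submodule.map_mono hle) ?_
            rw [Submodule.span_le, Set.singleton_subset_iff]
            exact ⟨_, hey, rfl⟩
        rw [hG]
        refine .step μ _ (ih (Nat.le_of_succ_le hi)) hμ ?_ fun a ha => ?_
        · rw [← smul_eq_mul, ← map_smul, ← mul_smul, d.idem_mul]
        -- Evaluating `hmem` at `0` and `-a` turns membership of `a • e μ • y` in `F i` into
        -- vanishing of the class of `a`.
        · have h1 := hmem 0 (Submodule.zero_mem _) (-⟨a, d.mem_proj.2 ha⟩)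
          rw [show (⟨0, Submodule.zero_mem _⟩ : F (i + 1)) = 0 from rfl,
            Submodule.Quotient.mk_zero, map_zero, eq_comm (a := (0 : Proj e μ ⧸ K μ)), Submodule.Quotient.mk_eq_zero,
            Submodule.neg_mem_iff] at h1
          have h2 : (0 : M) - ((-⟨a, d.mem_proj.2 ha⟩ : Proj e μ) : A) • e μ • y = a • e μ • y := by
            rw [Submodule.coe_neg, neg_smul, zero_sub, neg_neg]
          rw [h2] at h1
          have h3 : j (a • e μ • y) ∈ (F i).map j ↔ a • e μ • y ∈ F i := hj.mem_set_image
          rw [← smul_eq_mul, ← map_smul, h3, h1]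
          exact (mem_idealOf (K := K) ⟨a, d.mem_proj.2 ha⟩).symm
    have := key n le_rfl
    rwa [hn, Submodule.map_top] at this
  · intro hF
    obtain ⟨n, F, h0, hn, h⟩ := hF.exists_chain
    have hle : ∀ i < n, F i ≤ F (i + 1) := fun i hi => by
      obtain ⟨μ, y, -, -, h3, -⟩ := h i hi
      rw [h3]; exact le_sup_left
    -- The chain increases up to the range of `j`, so every generator comes from an element of `M`.
    have hrange : ∀ i ≤ n, F i ≤ LinearMap.range j := by
      intro i hi
      rw [← hn]
      induction hi using Nat.decreasingInduction with
      | self => exact le_rfl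
      | of_succ i hi ih => exact (hle i hi).trans ih
    refine ⟨n, fun i => (F i).comap j, ?_, ?_, fun i hi => ⟨Submodule.comap_mono (hle i hi), ?_⟩⟩
    · change (F 0).comap j = ⊥
      rw [h0, Submodule.comap_bot, LinearMap.ker_eq_bot.2 hj]
    · change (F n).comap j = ⊤
      rw [hn, eq_top_iff]
      exact fun x _ => ⟨x, rfl⟩
    · obtain ⟨μ, y, hμ, hy, h3, h4⟩ := h i hi
      refine ⟨μ, hμ, ?_⟩
      have hyF : y ∈ F (i + 1) := by
        rw [h3]; exact Submodule.mem_sup_right (Submodule.mem_span_singleton_self _)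
      obtain ⟨y, rfl⟩ := hrange (i + 1) hi hyF
      let f : Proj e μ →ₗ[A] Subquot ((F i).comap j) ((F (i + 1)).comap j) :=
        ((((F i).comap j).submoduleOf ((F (i + 1)).comap j)).mkQ.comp
          (LinearMap.toSpanSingleton A ((F (i + 1)).comap j) ⟨y, hyF⟩)).comp (Proj e μ).subtype
      have hf : ∀ x : Proj e μ, f x = Submodule.Quotient.mk
          ⟨(x : A) • y, Submodule.smul_mem _ (x : A) (show y ∈ (F (i + 1)).comap j from hyF)⟩ :=
        fun x => rfl
      have hker : K μ = LinearMap.ker f := by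
        ext x
        rw [LinearMap.mem_ker, hf, Submodule.Quotient.mk_eq_zero, ← mem_idealOf (K := K),
          ← h4 x (d.mem_proj.1 x.2), ← smul_eq_mul, ← map_smul]
        rfl
      have hsurj : Function.Surjective f := by
        intro z
        obtain ⟨⟨x, hx⟩, rfl⟩ := Submodule.Quotient.mk_surjective _ z
        have hx' : j x ∈ F (i + 1) := hx
        rw [h3] at hx'
        obtain ⟨b, hb, t, ht, hbt⟩ := Submodule.mem_sup.1 hx'
        obtain ⟨a, rfl⟩ := Submodule.mem_span_singleton.1 ht
        refine ⟨⟨a * e μ, mul_e_mem_proj a μ⟩, ?_⟩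
        rw [hf, Submodule.Quotient.eq]
        change j ((a * e μ) • y - x) ∈ F i
        have : j ((a * e μ) • y - x) = -b := by
          rw [map_sub, ← hbt, map_smul, mul_smul, smul_eq_mul (e μ), hy, sub_add_cancel_right]
        rw [this]
        exact (F i).neg_mem hb
      exact ⟨((Submodule.quotEquivOfEq _ _ hker).trans (f.quotKerEquivOfSurjective hsurj)).symm⟩

/-- A filtration of a submodule of `P_l` in terms of the left ideal that it gives. -/
theorem hasFiltration_submodule_iff (d : DirectedStructure k e) (K : ∀ l, Submodule A (Proj e l))
    (p : Λ → Prop) {l : Λ} (U : Submodule A (Proj e l)) :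
    HasFiltration (A := A) (fun m => Proj e m ⧸ K m) p U ↔
      Filt e (idealOf K) p (U.map (Proj e l).subtype) := by
  rw [d.hasFiltration_iff K p ((Proj e l).subtype.comp U.subtype)
    ((Subtype.val_injective).comp Subtype.val_injective), LinearMap.range_comp,
    Submodule.range_subtype]

theorem hasFiltration_self_iff (d : DirectedStructure k e) (K : ∀ l, Submodule A (Proj e l))
    (p : Λ → Prop) :
    HasFiltration (A := A) (fun m => Proj e m ⧸ K m) p A ↔ Filt e (idealOf K) p ⊤ := by
  rw [d.hasFiltration_iff K p LinearMap.id Function.injective_id, LinearMap.range_id]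

end DirectedStructure

/-! ### Freeness of the off-diagonal ideal and standard filtrations -/

section FreeAt

variable {A : Type u} [Ring A] {Λ : Type w}

/-- The left ideal `J e_l` is a direct sum of modules `A x_i ≅ A e_{m_i}` with `x_i ∈ e_{m_i} A e_l`
and `m_i ≠ l`. -/
def LeftFreeAt (e : Λ → A) (l : Λ) : Prop :=
  ∃ (ι : Type) (_ : Fintype ι) (m : ι → Λ) (x : ι → A), (∀ i, m i ≠ l) ∧
    (∀ i, e (m i) * x i = x i) ∧ (∀ i, x i * e l = x i) ∧
    (∀ a : ι → A, (∀ i, a i * e (m i) = a i) → ∑ i, a i * x i = 0 → ∀ i, a i = 0) ∧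
    ∀ t a, t ≠ l → e t * a = a → a * e l = a →
      ∃ c : ι → A, (∀ i, c i * e (m i) = c i) ∧ a = ∑ i, c i * x i

/-- The right ideal `e_p J` is a direct sum of modules `y_i A ≅ e_{q_i} A` with
`y_i ∈ e_p A e_{q_i}` and `q_i ≠ p`. -/
def RightFreeAt (e : Λ → A) (p : Λ) : Prop :=
  ∃ (ι : Type) (_ : Fintype ι) (q : ι → Λ) (y : ι → A), (∀ i, q i ≠ p) ∧
    (∀ i, e p * y i = y i) ∧ (∀ i, y i * e (q i) = y i) ∧
    (∀ a : ι → A, (∀ i, e (q i) * a i = a i) → ∑ i, y i * a i = 0 → ∀ i, a i = 0) ∧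
    ∀ t a, t ≠ p → e p * a = a → a * e t = a →
      ∃ c : ι → A, (∀ i, e (q i) * c i = c i) ∧ a = ∑ i, y i * c i

/-- The trace in `A e_l` of the modules `A e_t`, where `t` satisfies `T`. -/
def traceIdeal (e : Λ → A) (T : Λ → Prop) (l : Λ) : Submodule A A :=
  Submodule.span A {z | ∃ t, T t ∧ e t * z = z ∧ z * e l = z}

/-- The kernel of `P_l → Δ_l` as a left ideal. -/
abbrev stdIdeal (e : Λ → A) (o : LinearOrder Λ) (l : Λ) : Submodule A A :=
  traceIdeal e (fun t => l < t) l

variable {e : Λ → A} {K : Λ → Submodule A A} {p : Λ → Prop}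

theorem mem_traceIdeal {T : Λ → Prop} {l t : Λ} (ht : T t) {z : A} (h1 : e t * z = z)
    (h2 : z * e l = z) : z ∈ traceIdeal e T l :=
  Submodule.subset_span ⟨t, ht, h1, h2⟩

theorem traceIdeal_mul_mem {T : Λ → Prop} {l l' : Λ} {z x : A} (hz : z ∈ traceIdeal e T l)
    (hx' : x * e l' = x) : z * x ∈ traceIdeal e T l' := by
  refine Submodule.span_induction (p := fun z _ => z * x ∈ traceIdeal e T l') ?_ ?_ ?_ ?_ hz
  · rintro z ⟨t, ht, h1, h2⟩
    exact mem_traceIdeal ht (by rw [← mul_assoc, h1]) (by rw [mul_assoc, hx'])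
  · rw [zero_mul]; exact Submodule.zero_mem _
  · intro z z' _ _ h h'
    rw [add_mul]; exact Submodule.add_mem _ h h'
  · intro a z _ h
    rw [smul_eq_mul, mul_assoc]; exact Submodule.smul_mem _ a h

theorem traceIdeal_mul_e {T : Λ → Prop} {l : Λ} {z : A} (hz : z ∈ traceIdeal e T l) :
    z * e l = z := by
  refine Submodule.span_induction (p := fun z _ => z * e l = z) ?_ ?_ ?_ ?_ hz
  · rintro z ⟨t, ht, h1, h2⟩
    exact h2
  · rw [zero_mul]
  · intro z z' _ _ h h'
    rw [add_mul, h, h']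
  · intro a z _ h
    rw [smul_eq_mul, mul_assoc, h]

/-- The hypothesis `hx` says at once that right multiplication by `x` is injective on `L` and that
`L x` meets `N` only in zero. The filtration of `L` is therefore carried, step by step, to one of `N
⊕ L x` above `N`. -/
theorem Filt.sup_map_mul {N L : Submodule A A} (hN : Filt e K p N) (hL : Filt e K p L) (x : A)
    (hx : ∀ a ∈ L, a * x ∈ N → a = 0) :
    Filt e K p (N ⊔ L.map (LinearMap.toSpanSingleton A A x)) := by
  induction hL with
  | bot => rwa [Submodule.map_bot, sup_bot_eq]
  | @step F μ y hF hμ hy hK ih =>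
    rw [Submodule.map_sup, ← sup_assoc, Submodule.map_span, Set.image_singleton,
      LinearMap.toSpanSingleton_apply, smul_eq_mul]
    refine .step μ _ (ih fun a ha => hx a (Submodule.mem_sup_left ha)) hμ
      (by rw [← mul_assoc, hy]) fun a ha => ?_
    rw [← hK a ha]
    constructor
    · intro h
      obtain ⟨n, hn, _, ⟨f, hf, rfl⟩, hnf⟩ := Submodule.mem_sup.1 h
      have h1 : (a * y - f) * x = n := by
        rw [sub_mul, mul_assoc, ← hnf]
        exact add_sub_cancel_right _ _
      have h2 : a * y - f = 0 := by
        refine hx _ ?_ (h1 ▸ hn)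
        exact Submodule.sub_mem _ (Submodule.mem_sup_right
          (Submodule.smul_mem _ a (Submodule.mem_span_singleton_self y)))
          (Submodule.mem_sup_left hf)
      rw [sub_eq_zero.1 h2]
      exact hf
    · intro h
      exact Submodule.mem_sup_right ⟨_, h, mul_assoc _ _ _⟩

/-- The summands `L i * x i` are adjoined one at a time; independence provides the hypothesis of
`Filt.sup_map_mul`. -/
theorem Filt.exists_sum {ι : Type*} [Fintype ι] (L : ι → Submodule A A) (x : ι → A)
    (hL : ∀ i, Filt e K p (L i))
    (hind : ∀ a : ι → A, (∀ i, a i ∈ L i) → ∑ i, a i * x i = 0 → ∀ i, a i = 0) :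
    ∃ N, Filt e K p N ∧
      ∀ z, z ∈ N ↔ ∃ b : ι → A, (∀ i, b i ∈ L i) ∧ z = ∑ i, b i * x i := by
  classical
  have key : ∀ s : Finset ι, ∃ N, Filt e K p N ∧
      ∀ z, z ∈ N ↔ ∃ b : ι → A, (∀ i, b i ∈ L i) ∧ z = ∑ i ∈ s, b i * x i := by
    intro s
    induction s using Finset.induction_on with
    | empty =>
      refine ⟨⊥, .bot, fun z => ?_⟩
      simp only [Submodule.mem_bot, Finset.sum_empty]
      exact ⟨fun h => ⟨0, fun i => Submodule.zero_mem _, h⟩, fun ⟨_, _, h⟩ => h⟩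
    | insert i s hi ih =>
      obtain ⟨N, hN, hz⟩ := ih
      refine ⟨_, hN.sup_map_mul (hL i) (x i) fun a ha hax => ?_, fun z => ?_⟩
      · obtain ⟨b, hb, hab⟩ := (hz _).1 hax
        -- The equation `a * x i = ∑ b j * x j` over `s`, read as a relation among all the `x j`.
        have := hind (fun j => if j = i then a else if j ∈ s then -b j else 0) (fun j => by
          split_ifs with h1 h2
          · rwa [h1]
          · exact Submodule.neg_mem _ (hb j)
          · exact Submodule.zero_mem _) (by
          rw [← Finset.sum_subset (Finset.subset_univ (insert i s)), Finset.sum_insert hi,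
            if_pos rfl, hab, ← Finset.sum_add_distrib]
          · refine Finset.sum_eq_zero fun j hj => ?_
            rw [if_neg (fun h : j = i => hi (h ▸ hj)), if_pos hj, neg_mul, add_neg_cancel]
          · intro j _ hj
            rw [Finset.mem_insert, not_or] at hj
            rw [if_neg hj.1, if_neg hj.2, zero_mul]) i
        rwa [if_pos rfl] at this
      · rw [Submodule.mem_sup]
        constructor
        · rintro ⟨n, hn, _, ⟨f, hf, rfl⟩, rfl⟩
          obtain ⟨b, hb, rfl⟩ := (hz n).1 hn
          refine ⟨Function.update b i f, fun j => ?_, ?_⟩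
          · by_cases h : j = i
            · subst h; rwa [Function.update_self]
            · rw [Function.update_of_ne h]; exact hb j
          · rw [Finset.sum_insert hi, Function.update_self, add_comm]
            congr 1
            refine Finset.sum_congr rfl fun j hj => ?_
            rw [Function.update_of_ne fun h : j = i => hi (h ▸ hj)]
        · rintro ⟨b, hb, rfl⟩
          refine ⟨∑ j ∈ s, b j * x j, (hz _).2 ⟨b, hb, rfl⟩, b i * x i, ⟨b i, hb i, rfl⟩, ?_⟩
          rw [Finset.sum_insert hi, add_comm]
  exact key Finset.univ

end FreeAt

namespace DirectedStructure

variable {k : Type uk} [Field k] {A : Type u} [Ring A] [Algebra k A] {Λ : Type w} [Fintype Λ]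
  {e : Λ → A} (d : DirectedStructure k e)

theorem traceIdeal_eq_proj (d : DirectedStructure k e) {T : Λ → Prop} {l : Λ} (h : T l) :
    traceIdeal e T l = Proj e l := by
  apply le_antisymm
  · intro z hz
    exact d.mem_proj.2 (traceIdeal_mul_e hz)
  · rw [Submodule.span_le, Set.singleton_subset_iff]
    exact mem_traceIdeal h (d.idem_mul l) (d.idem_mul l)

/-- The statement is made for all upward closed `T` at once, because the recursion keeps `T` fixed
and moves from `l` to the larger vertices `m i`. If `l ∉ T`, the trace in `A e_l` is the direct sum
of the traces in the summands of `J e_l`; if `l ∈ T`, it is all of `A e_l`, an extension of `Δ_l` by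
the trace for `T = {t | l < t}`. -/
theorem filt_traceIdeal (d : DirectedStructure k e) (h : ∀ l, LeftFreeAt e l) (o : LinearOrder Λ) (l : Λ) :
    ∀ T : Λ → Prop, (∀ s t, T s → s < t → T t) → Filt e (stdIdeal e o) T (traceIdeal e T l) := by
  induction l using d.wf_gt.induction with
  | _ l ih =>
    have hnot : ∀ T : Λ → Prop, (∀ s t, T s → s < t → T t) → ¬ T l →
        Filt e (stdIdeal e o) T (traceIdeal e T l) := by
      intro T hT hl
      obtain ⟨ι, _, m, x, hm, hx1, hx2, hind, hgen⟩ := h l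
      -- A generator whose target is not above `l` would be zero, and then the coefficient `e (m i)`
      -- would give a nontrivial relation.
      have hlt : ∀ i, d.lt l (m i) := by
        classical
        intro i
        by_contra hlt
        have hx0 : x i = 0 := d.eq_zero (hm i).symm hlt (hx1 i) (hx2 i)
        have := hind (fun j => if j = i then e (m i) else 0) (fun j => by
          split_ifs with hj
          · rw [hj, d.idem_mul]
          · rw [zero_mul]) (by simp [hx0]) i
        rw [if_pos rfl] at this
        exact d.e_ne_zero _ this
      obtain ⟨N, hN, hz⟩ := Filt.exists_sum (fun i => traceIdeal e T (m i)) x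
        (fun i => ih (m i) (hlt i) T hT)
        (fun a ha => hind a fun i => traceIdeal_mul_e (ha i))
      -- A generator `z = e t * z` of the trace has coordinates `e t * c i`, which lie in the traces
      -- of the `A e_{m i}`.
      have : traceIdeal e T l = N := by
        apply le_antisymm
        · refine Submodule.span_le.2 ?_
          rintro z ⟨t, ht, h1, h2⟩
          obtain ⟨c, hc, hzc⟩ := hgen t z (fun h => hl (h ▸ ht)) h1 h2
          refine (hz z).2 ⟨fun i => e t * c i, fun i => ?_, ?_⟩
          · exact mem_traceIdeal ht (by rw [← mul_assoc, d.idem_mul]) (by rw [mul_assoc, hc])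
          · rw [← h1, hzc, Finset.mul_sum]
            exact Finset.sum_congr rfl fun i _ => (mul_assoc _ _ _).symm
        · intro z hzN
          obtain ⟨b, hb, rfl⟩ := (hz z).1 hzN
          exact Submodule.sum_mem _ fun i _ => traceIdeal_mul_mem (hb i) (hx2 i)
      rw [this]
      exact hN
    intro T hT
    by_cases hl : T l
    -- The set of vertices above `l` does not contain `l`, so the case already proved filters the
    -- kernel of `P_l → Δ_l`.
    · have h1 := hnot (fun t => l < t) (fun s t hs hst => lt_trans hs hst) (lt_irrefl l)
      have h2 := Filt.step (K := stdIdeal e o) (p := T) l (e l)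
        (h1.mono_pred fun t ht => hT l t hl ht) hl (d.idem_mul l)
        fun a ha => by rw [ha]
      have h3 : traceIdeal e T l = stdIdeal e o l ⊔ Submodule.span A {e l} := by
        rw [d.traceIdeal_eq_proj hl, right_eq_sup]
        intro z hz
        exact d.mem_proj.2 (traceIdeal_mul_e hz)
      rw [h3]
      exact h2
    · exact hnot T hT hl

/-- `A` is the direct sum of the `A e_l`, each of which is its own trace when `T` is everything. -/
theorem filt_top (d : DirectedStructure k e) (h : ∀ l, LeftFreeAt e l) (o : LinearOrder Λ) :
    Filt e (stdIdeal e o) (fun _ => True) ⊤ := by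
  obtain ⟨N, hN, hz⟩ := Filt.exists_sum (fun l => traceIdeal e (fun _ => True) l) e
    (fun l => d.filt_traceIdeal h o l (fun _ => True) fun _ _ _ _ => trivial)
    (fun a ha h0 l => by
      have h1 : (∑ i, a i * e i) * e l = 0 * e l := congrArg (· * e l) h0
      rw [zero_mul, Finset.sum_mul, Finset.sum_eq_single l] at h1
      · rwa [mul_assoc, d.idem_mul, traceIdeal_mul_e (ha l)] at h1
      · intro b _ hb
        rw [mul_assoc, d.ortho hb, mul_zero]
      · exact fun h => absurd (Finset.mem_univ l) h)
  have : N = ⊤ := by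
    refine top_le_iff.1 fun z _ => (hz z).2 ⟨fun l => z * e l, fun l => ?_, ?_⟩
    · rw [d.traceIdeal_eq_proj trivial]
      exact mul_e_mem_proj z l
    · simp only [mul_assoc, d.idem_mul]
      exact (d.mul_sum z).symm
  rwa [this] at hN

/-- The kernel of `P_l → Δ_l`. -/
def stdKernel (_ : DirectedStructure k e) (o : LinearOrder Λ) (l : Λ) : Submodule A (Proj e l) :=
  (stdIdeal e o l).comap (Proj e l).subtype

theorem idealOf_stdKernel (o : LinearOrder Λ) : idealOf (d.stdKernel o) = stdIdeal e o := by
  funext l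
  unfold idealOf stdKernel
  rw [Submodule.map_comap_subtype, inf_eq_right]
  exact fun z hz => d.mem_proj.2 (traceIdeal_mul_e hz)

variable [FiniteDimensional k A]

/-- Vanishing of `[P_l / U : S_m]` means that `U` contains `e m • P_l`; together over all `m > l`
these generate the trace. -/
theorem hasMultiplicity_zero_iff_stdKernel_le (o : LinearOrder Λ) (l : Λ)
    (U : Submodule A (Proj e l)) :
    (∀ m, ¬ m ≤ l → HasMultiplicity (A := A) (Simp e m) (Proj e l ⧸ U) 0) ↔
      d.stdKernel o l ≤ U := by
  constructor
  · intro h x hx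
    have h1 : stdIdeal e o l ≤ U.map (Proj e l).subtype := by
      refine Submodule.span_le.2 ?_
      rintro z ⟨t, ht, h1, h2⟩
      have := (d.hasMultiplicity_quotient_zero_iff l t U).1 (h t (not_le_of_gt ht))
        ⟨z, d.mem_proj.2 h2⟩
      exact ⟨_, this, h1⟩
    obtain ⟨y, hy, hyx⟩ := h1 hx
    rwa [← Subtype.ext hyx]
  · intro h m hm
    rw [d.hasMultiplicity_quotient_zero_iff]
    intro x
    refine h ?_
    change e m * (x : A) ∈ stdIdeal e o l
    exact mem_traceIdeal (lt_of_not_ge hm) (by rw [← mul_assoc, d.idem_mul])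
      (by rw [mul_assoc, d.mem_proj.1 x.2])

theorem isStandardKernel_iff (o : LinearOrder Λ) (l : Λ) (U : Submodule A (Proj e l)) :
    IsStandardKernel e o l U ↔ U = d.stdKernel o l := by
  unfold IsStandardKernel
  have : {U : Submodule A (Proj e l) | ∀ m, ¬ m ≤ l →
      HasMultiplicity (A := A) (Simp e m) (Proj e l ⧸ U) 0} = Set.Ici (d.stdKernel o l) := by
    ext U
    exact d.hasMultiplicity_zero_iff_stdKernel_le o l U
  rw [this]
  exact ⟨fun h => h.unique isLeast_Ici, fun h => h ▸ isLeast_Ici⟩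

theorem isStandardlyStratified_of_leftFreeAt (d : DirectedStructure k e) (h : ∀ l, LeftFreeAt e l) (o : LinearOrder Λ) :
    IsStandardlyStratified e o := by
  refine ⟨d.stdKernel o, fun l => ?_, fun l => ?_⟩
  · exact (d.hasMultiplicity_zero_iff_stdKernel_le o l _).2 le_rfl
  · rw [d.hasFiltration_submodule_iff]
    change Filt e _ _ (idealOf (d.stdKernel o) l)
    rw [d.idealOf_stdKernel]
    exact d.filt_traceIdeal h o l _ fun s t hs hst => lt_trans hs hst

end DirectedStructure

/-! ### Decomposition of projective modules -/

/-- A generating family of homogeneous elements of least size has all its relations in the Jacobson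
radical. By projectivity the module of relations is a finitely generated direct summand of a free
module; it then lies in its own product with the radical, and Nakayama's lemma makes it zero. -/
theorem exists_basis_of_projective {R : Type*} [Ring R] {Λ : Type*} [Fintype Λ] {ε : Λ → R}
    (hε : CompleteOrthogonalIdempotents ε)
    (hloc : ∀ (l : Λ) (a : R), a * ε l = a → (∃ b, b * a = ε l) ∨ a ∈ Ring.jacobson R)
    (M : Type*) [AddCommGroup M] [Module R M] [Module.Finite R M] [Module.Projective R M] :
    ∃ (n : ℕ) (m : Fin n → Λ) (x : Fin n → M), (∀ i, ε (m i) • x i = x i) ∧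
      (∀ a : Fin n → R, (∀ i, a i * ε (m i) = a i) → ∑ i, a i • x i = 0 → ∀ i, a i = 0) ∧
      ∀ z : M, ∃ c : Fin n → R, (∀ i, c i * ε (m i) = c i) ∧ z = ∑ i, c i • x i := by
  classical
  have hex : ∃ (n : ℕ) (m : Fin n → Λ) (x : Fin n → M), (∀ i, ε (m i) • x i = x i) ∧
      ∀ z : M, ∃ c : Fin n → R, z = ∑ i, c i • x i := by
    obtain ⟨n, s, hs⟩ := Module.Finite.exists_fin (R := R) (M := M)
    let φ := Fintype.equivFin (Fin n × Λ)
    refine ⟨_, fun i => (φ.symm i).2, fun i => ε (φ.symm i).2 • s (φ.symm i).1, fun i => ?_,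
      fun z => ?_⟩
    · rw [← mul_smul, (hε.idem _).eq]
    · have hz : z ∈ Submodule.span R (Set.range s) := by rw [hs]; exact Submodule.mem_top
      obtain ⟨c, rfl⟩ := (Submodule.mem_span_range_iff_exists_fun R).1 hz
      refine ⟨fun i => c (φ.symm i).1, ?_⟩
      rw [φ.symm.sum_comp (fun j => c j.1 • ε j.2 • s j.1), Fintype.sum_prod_type]
      refine Finset.sum_congr rfl fun i _ => ?_
      dsimp only
      rw [← Finset.smul_sum, ← Finset.sum_smul, hε.complete, one_smul]
  -- The number of generators is taken least.
  obtain ⟨m, x, hx, hgen⟩ := Nat.find_spec hex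
  have hmin := fun n => Nat.find_min hex (m := n)
  generalize Nat.find hex = n at m x hx hgen hmin
  have hgen' : ∀ z : M, ∃ c : Fin n → R, (∀ i, c i * ε (m i) = c i) ∧ z = ∑ i, c i • x i := by
    intro z
    obtain ⟨c, rfl⟩ := hgen z
    refine ⟨fun i => c i * ε (m i), fun i => by rw [mul_assoc, (hε.idem _).eq], ?_⟩
    simp only [mul_smul, hx]
  -- A coefficient outside the radical can be multiplied on the left to become `ε (m j)`. The
  -- relation then expresses `x j` through the other generators, against minimality.
  have hjac : ∀ a : Fin n → R, (∀ i, a i * ε (m i) = a i) → ∑ i, a i • x i = 0 →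
      ∀ i, a i ∈ Ring.jacobson R := by
    intro a ha h0 j
    refine (hloc (m j) (a j) (ha j)).resolve_left ?_
    rintro ⟨b, hb⟩
    obtain ⟨n, rfl⟩ : ∃ n', n = n' + 1 := ⟨n - 1, by have := j.2; omega⟩
    refine hmin n (Nat.lt_succ_self n) ⟨fun i => m (j.succAbove i), fun i => x (j.succAbove i),
      fun i => hx _, fun z => ?_⟩
    rw [Fin.sum_univ_succAbove _ j] at h0
    have hxj : x j = ∑ i, (-(b * a (j.succAbove i))) • x (j.succAbove i) := by
      have h1 := congrArg (b • ·) h0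
      simp only [smul_add, smul_zero, ← mul_smul, hb, hx, Finset.smul_sum] at h1
      simp only [neg_smul, Finset.sum_neg_distrib]
      exact eq_neg_of_add_eq_zero_left h1
    obtain ⟨c, hc⟩ := hgen z
    rw [Fin.sum_univ_succAbove _ j, hxj, Finset.smul_sum, ← Finset.sum_add_distrib] at hc
    refine ⟨fun i => c j * -(b * a (j.succAbove i)) + c (j.succAbove i), ?_⟩
    rw [hc]
    refine Finset.sum_congr rfl fun i _ => ?_
    rw [add_smul, mul_smul]
  refine ⟨n, m, x, hx, ?_, hgen'⟩
  let π : (Fin n → R) →ₗ[R] M := Fintype.linearCombination R x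
  have hπ : ∀ a, π a = ∑ i, a i • x i := fun a => Fintype.linearCombination_apply R x a
  have hsurj : Function.Surjective π := fun z => by
    obtain ⟨c, hc⟩ := hgen z
    exact ⟨c, by rw [hπ, hc]⟩
  obtain ⟨s, hs⟩ := Module.projective_lifting_property π LinearMap.id hsurj
  -- The projection of the free module to the sum of the left ideals `R ε (m i)`.
  let τ : (Fin n → R) →ₗ[R] (Fin n → R) :=
    LinearMap.pi fun i => (LinearMap.toSpanSingleton R R (ε (m i))).comp (LinearMap.proj i)
  have hτ : ∀ a i, τ a i = a i * ε (m i) := fun a i => rfl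
  have hπτ : ∀ a, π (τ a) = π a := fun a => by
    simp only [hπ, hτ, mul_smul, hx]
  -- The projection onto the module of relations, from the section `s` of `π`.
  let θ : (Fin n → R) →ₗ[R] (Fin n → R) := τ.comp (LinearMap.id - s.comp π)
  have hθτ : ∀ a i, θ a i * ε (m i) = θ a i := fun a i => by
    change τ _ i * _ = τ _ i
    rw [hτ, mul_assoc, (hε.idem _).eq]
  have hθπ : ∀ a, π (θ a) = 0 := fun a => by
    change π (τ (a - s (π a))) = 0
    rw [hπτ, map_sub, show π (s (π a)) = π a from LinearMap.congr_fun hs (π a), sub_self]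
  have hfix : ∀ a, (∀ i, a i * ε (m i) = a i) → π a = 0 → θ a = a := fun a ha h0 => by
    change τ (a - s (π a)) = a
    rw [h0, map_zero, sub_zero]
    exact funext ha
  have hbot : LinearMap.range θ = ⊥ := by
    refine Submodule.FG.eq_bot_of_le_jacobson_smul ?_ ?_
    · rw [LinearMap.range_eq_map]
      exact Module.Finite.fg_top.map θ
    · rintro _ ⟨a, rfl⟩
      -- Since `θ` fixes relations, a relation is a combination of the relations `θ (Pi.single i 1)`
      -- with its own coordinates, which are radical, as coefficients.
      have h1 : θ a = ∑ i, θ a i • θ (Pi.single i 1) := by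
        conv_lhs => rw [← hfix (θ a) (hθτ a) (hθπ a), pi_eq_sum_univ' (θ a)]
        rw [map_sum]
        refine Finset.sum_congr rfl fun i _ => ?_
        rw [map_smul]
      rw [h1]
      refine Submodule.sum_mem _ fun i _ => Submodule.smul_mem_smul ?_ ⟨_, rfl⟩
      exact hjac (θ a) (hθτ a) (by rw [← hπ]; exact hθπ a) i
  intro a ha h0 i
  have h1 : a ∈ LinearMap.range θ := ⟨a, hfix a ha (by rw [hπ, h0])⟩
  rw [hbot, Submodule.mem_bot] at h1
  rw [h1]
  rfl

/-- A direct summand of a left ideal with a free family of generators is projective. -/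
theorem projective_of_free_family {R : Type*} [Ring R] {M : Submodule R R} {ι : Type*} [Fintype ι]
    (ε y : ι → R) (r : R)
    (hind : ∀ a : ι → R, (∀ i, a i * ε i = a i) → ∑ i, a i * y i = 0 → ∀ i, a i = 0)
    (hM : ∀ z ∈ M, ∃ c : ι → R, (∀ i, c i * ε i = c i) ∧ z = ∑ i, c i * y i)
    (hyM : ∀ i, y i * r ∈ M) (hr : ∀ z ∈ M, z * r = z) :
    Module.Projective R M ∧ Module.Finite R M := by
  have huniq : ∀ a b : ι → R, (∀ i, a i * ε i = a i) → (∀ i, b i * ε i = b i) →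
      ∑ i, a i * y i = ∑ i, b i * y i → a = b := by
    intro a b ha hb hab
    funext i
    refine sub_eq_zero.1 (hind (fun i => a i - b i) (fun i => by rw [sub_mul, ha, hb]) ?_ i)
    simp only [sub_mul, Finset.sum_sub_distrib, hab, sub_self]
  have hM' : ∀ z : M, ∃ c : ι → R, (∀ i, c i * ε i = c i) ∧ (z : R) = ∑ i, c i * y i :=
    fun z => hM z z.2
  choose c hc1 hc2 using hM'
  have hadd : ∀ z z', c (z + z') = c z + c z' := fun z z' => by
    refine huniq _ _ (hc1 _) (fun i => by rw [Pi.add_apply, add_mul, hc1, hc1]) ?_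
    rw [← hc2 (z + z')]
    simp only [Pi.add_apply, add_mul, Finset.sum_add_distrib]
    rw [← hc2 z, ← hc2 z']
    rfl
  have hsmul : ∀ (a : R) z, c (a • z) = a • c z := fun a z => by
    refine huniq _ _ (hc1 _) (fun i => by rw [Pi.smul_apply, smul_eq_mul, mul_assoc, hc1]) ?_
    rw [← hc2 (a • z)]
    simp only [Pi.smul_apply, smul_eq_mul, mul_assoc]
    rw [← Finset.mul_sum, ← hc2 z]
    rfl
  let f : M →ₗ[R] (ι → R) := { toFun := c, map_add' := hadd, map_smul' := hsmul }
  -- The elements `y i` need not lie in `M`, but `y i * r` does; as `r` acts on `M` as the identity,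
  -- `g` still retracts the coordinate map `f`.
  let g : (ι → R) →ₗ[R] M := Fintype.linearCombination R fun i => ⟨y i * r, hyM i⟩
  have hgf : g.comp f = LinearMap.id := by
    refine LinearMap.ext fun z => Subtype.ext ?_
    change ((g (c z) : M) : R) = z
    rw [Fintype.linearCombination_apply, Submodule.coe_sum]
    simp only [Submodule.coe_smul, smul_eq_mul, ← mul_assoc]
    rw [← Finset.sum_mul, ← hc2 z]
    exact hr z z.2
  exact ⟨Module.Projective.of_split f g hgf, Module.Finite.of_surjective g fun z =>
    ⟨f z, LinearMap.congr_fun hgf z⟩⟩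

/-- The case of the single idempotent `1`: in a local ring each element is a unit or lies in the
Jacobson radical. -/
theorem exists_basis_of_isLocalRing (k : Type*) [Field k] {R : Type*} [Ring R] [Algebra k R]
    [FiniteDimensional k R] [IsLocalRing R] (M : Type*) [AddCommGroup M] [Module R M]
    [Module.Finite R M] [Module.Projective R M] : ∃ (n : ℕ), Nonempty (Module.Basis (Fin n) R M) := by
  have hε : CompleteOrthogonalIdempotents (fun _ : Unit => (1 : R)) :=
    { idem := fun _ => IsIdempotentElem.one
      ortho := fun i j h => absurd (Subsingleton.elim i j) h
      complete := by simp }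
  obtain ⟨n, m, x, -, hind, hgen⟩ := exists_basis_of_projective hε (fun _ a _ => by
    by_cases ha : IsUnit a
    · obtain ⟨u, rfl⟩ := ha
      exact Or.inl ⟨↑u⁻¹, u.inv_mul⟩
    · right
      rw [← Ideal.jacobson_bot, Ideal.mem_jacobson_iff]
      intro y
      have h1 : ¬ IsUnit (-(y * a)) := by
        rw [IsUnit.neg_iff]
        rintro ⟨u, hu⟩
        have h2 : (↑u⁻¹ * y) * a = 1 := by rw [mul_assoc, ← hu, Units.inv_mul]
        exact ha ⟨⟨a, _, mul_eq_one_comm_of_finiteDimensional k h2, h2⟩, rfl⟩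
      have h2 : IsUnit (1 + y * a) :=
        (IsLocalRing.isUnit_or_isUnit_of_add_one (a := -(y * a)) (b := 1 + y * a)
          (by abel)).resolve_left h1
      obtain ⟨u, hu⟩ := h2
      refine ⟨↑u⁻¹, ?_⟩
      have h3 : (↑u⁻¹ : R) * (1 + y * a) = 1 := by rw [← hu, Units.inv_mul]
      rw [mul_add, mul_one] at h3
      rw [mul_assoc, add_comm, h3, sub_self]
      exact Submodule.zero_mem _) M
  refine ⟨n, ⟨Module.Basis.mk (v := x) ?_ ?_⟩⟩
  · rw [Fintype.linearIndependent_iff]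
    exact fun g hg => hind g (fun i => mul_one _) hg
  · intro z _
    obtain ⟨c, -, rfl⟩ := hgen z
    exact Submodule.sum_mem _ fun i _ =>
      Submodule.smul_mem _ _ (Submodule.subset_span ⟨i, rfl⟩)

instance {R : Type*} [Ring R] [IsLocalRing R] : IsLocalRing Rᵐᵒᵖ where
  isUnit_or_isUnit_of_add_one {a b} h := by
    have h1 : a.unop + b.unop = 1 := congrArg MulOpposite.unop h
    rcases IsLocalRing.isUnit_or_isUnit_of_add_one h1 with h2 | h2
    · exact Or.inl h2.op
    · exact Or.inr h2.op

namespace DirectedStructure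

variable {k : Type uk} [Field k] {A : Type u} [Ring A] [Algebra k A] {Λ : Type w} [Fintype Λ]
  {e : Λ → A} (d : DirectedStructure k e)

/-! ### Linear orders adapted to a vertex -/

/-- The test orders of the converse directions: one vertex at the bottom, and `lt` respected among
the others. It is used for the directed order and for its reverse. -/
theorem exists_linearOrder (lt : Λ → Λ → Prop) (htrans : ∀ {a b c}, lt a b → lt b c → lt a c)
    (hirrefl : ∀ a, ¬ lt a a) (l : Λ) :
    ∃ _ : LinearOrder Λ, (∀ t, t ≠ l → l < t) ∧ ∀ a b, a ≠ l → b ≠ l → lt a b → a < b := by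
  classical
  -- The relations `lt a l` are discarded, which is what allows `l` to be placed below everything.
  let r : Λ → Λ → Prop := fun a b => a = b ∨ a = l ∨ (b ≠ l ∧ lt a b)
  have hr : IsPartialOrder Λ r :=
    { refl := fun a => Or.inl rfl
      trans := by
        rintro a b c (rfl | rfl | ⟨h1, h2⟩) (rfl | rfl | ⟨h3, h4⟩)
        · exact Or.inl rfl
        · exact Or.inr (Or.inl rfl)
        · exact Or.inr (Or.inr ⟨h3, h4⟩)
        · exact Or.inr (Or.inl rfl)
        · exact Or.inr (Or.inl rfl)
        · exact Or.inr (Or.inl rfl)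
        · exact Or.inr (Or.inr ⟨h1, h2⟩)
        · exact absurd rfl h1
        · exact Or.inr (Or.inr ⟨h3, htrans h2 h4⟩)
      antisymm := by
        rintro a b (rfl | rfl | ⟨h1, h2⟩) (h | h | ⟨h3, h4⟩)
        · rfl
        · rfl
        · rfl
        · exact h.symm
        · exact h.symm
        · exact absurd rfl h3
        · exact h.symm
        · exact absurd h h1
        · exact absurd (htrans h2 h4) (hirrefl a) }
  obtain ⟨s, hs, hrs⟩ := extend_partialOrder r
  obtain ⟨o, ho⟩ : ∃ _ : LinearOrder Λ, ∀ a b, s a b → a ≤ b := ⟨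
    { le := s
      le_refl := fun a => hs.refl a
      le_trans := fun a b c => hs.trans a b c
      le_antisymm := fun a b => hs.antisymm a b
      le_total := fun a b => hs.total a b
      toDecidableLE := fun _ _ => Classical.dec _ }, fun _ _ h => h⟩
  refine ⟨o, fun t ht => ?_, fun a b ha hb hab => ?_⟩
  · exact lt_of_le_of_ne (ho _ _ (hrs l t (Or.inr (Or.inl rfl)))) ht.symm
  · refine lt_of_le_of_ne (ho _ _ (hrs a b (Or.inr (Or.inr ⟨hb, hab⟩)))) ?_
    rintro rfl
    exact hirrefl a hab

/-! ### From standard filtrations to freeness -/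

/-- Steps at `μ ≠ l` are copies of `A e_μ`, so their generators are free over what precedes. Steps
at `l` contribute nothing to `e t * F` with `t ≠ l`, because `K l` contains all of `e t * A * e l`.
Hence the generators of the former steps suffice. -/
theorem exists_free_family (d : DirectedStructure k e) (l : Λ) {K : Λ → Submodule A A}
    {p : Λ → Prop} (hKl : ∀ t z, t ≠ l → e t * z = z → z * e l = z → z ∈ K l)
    (hK : ∀ m, m ≠ l → K m = ⊥) {F : Submodule A A} (hF : Filt e K p F) :
    ∃ (ι : Type) (_ : Fintype ι) (m : ι → Λ) (y : ι → A), (∀ i, m i ≠ l) ∧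
      (∀ i, e (m i) * y i = y i) ∧ (∀ i, y i ∈ F) ∧
      (∀ a : ι → A, (∀ i, a i * e (m i) = a i) → ∑ i, a i * y i = 0 → ∀ i, a i = 0) ∧
      ∀ t f, t ≠ l → f ∈ F → e t * f = f →
        ∃ c : ι → A, (∀ i, c i * e (m i) = c i) ∧ f = ∑ i, c i * y i := by
  induction hF with
  | bot =>
    refine ⟨Empty, inferInstance, fun i => i.elim, fun i => i.elim, fun i => i.elim,
      fun i => i.elim, fun i => i.elim, fun _ _ _ i => i.elim, fun t f _ hf _ => ?_⟩
    exact ⟨fun i => i.elim, fun i => i.elim, by simpa using hf⟩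
  | @step F μ z hF hμ hz hKz ih =>
    obtain ⟨ι, _, m, y, hm, hy1, hy2, hind, hgen⟩ := ih
    by_cases hl : μ = l
    · subst hl
      refine ⟨ι, inferInstance, m, y, hm, hy1, fun i => Submodule.mem_sup_left (hy2 i), hind,
        fun t f ht hf hef => ?_⟩
      refine hgen t f ht ?_ hef
      obtain ⟨g, hg, s, hs, rfl⟩ := Submodule.mem_sup.1 hf
      obtain ⟨b, rfl⟩ := Submodule.mem_span_singleton.1 hs
      -- The contribution of the generator at `l` has coefficient `e t * b * e l`, which lies in `K
      -- l`, so it already belongs to the previous term.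
      rw [← hef, mul_add, smul_eq_mul, ← hz, ← mul_assoc, ← mul_assoc]
      refine F.add_mem (F.smul_mem _ hg) ?_
      refine (hKz _ ?_).2 (hKl t _ ht ?_ ?_)
      · rw [mul_assoc, d.idem_mul]
      · simp only [← mul_assoc, d.idem_mul]
      · rw [mul_assoc, d.idem_mul]
    · refine ⟨Option ι, inferInstance, fun i => i.elim μ m, fun i => i.elim z y, ?_, ?_, ?_, ?_, ?_⟩
      · rintro (_ | i)
        · exact hl
        · exact hm i
      · rintro (_ | i)
        · exact hz
        · exact hy1 i
      · rintro (_ | i)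
        · exact Submodule.mem_sup_right (Submodule.mem_span_singleton_self _)
        · exact Submodule.mem_sup_left (hy2 i)
      · intro a ha h0
        rw [Fintype.sum_option] at h0
        have h1 : a none = 0 := by
          have h2 : a none * z ∈ F := by
            have : a none * z = -∑ i, a (some i) * y i := eq_neg_of_add_eq_zero_left h0
            rw [this]
            exact F.neg_mem (Submodule.sum_mem _ fun i _ => F.smul_mem _ (hy2 i))
          have h3 := (hKz _ (ha none)).1 h2
          rwa [hK μ hl, Submodule.mem_bot] at h3
        have h2 := hind (fun i => a (some i)) (fun i => ha (some i)) (by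
          rw [h1] at h0
          simpa using h0)
        rintro (_ | i)
        · exact h1
        · exact h2 i
      · intro t f ht hf hef
        obtain ⟨g, hg, s, hs, rfl⟩ := Submodule.mem_sup.1 hf
        obtain ⟨b, rfl⟩ := Submodule.mem_span_singleton.1 hs
        obtain ⟨c, hc1, hc2⟩ := hgen t (e t * g) ht (F.smul_mem _ hg)
          (by rw [← mul_assoc, d.idem_mul])
        refine ⟨fun i => i.elim (e t * b * e μ) c, ?_, ?_⟩
        · rintro (_ | i)
          · exact (mul_assoc _ _ _).trans (congrArg (e t * b * ·) (d.idem_mul μ))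
          · exact hc1 i
        · rw [Fintype.sum_option, ← hef, mul_add, hc2, add_comm]
          simp only [Option.elim_none, Option.elim_some]
          rw [mul_assoc (e t * b), hz, smul_eq_mul, mul_assoc]

/-- In the order with `l` lowest and the directed order reversed elsewhere, `K m = 0` for `m ≠ l`
and `K l` contains all `e t * A * e l` with `t ≠ l`. The filtration of `K l` thus falls under
`exists_free_family`. -/
theorem leftFreeAt_of_isStandardlyStratified [FiniteDimensional k A]
    (d : DirectedStructure k e) (h : ∀ o : LinearOrder Λ, IsStandardlyStratified e o) (l : Λ) :
    LeftFreeAt e l := by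
  obtain ⟨o, ho1, ho2⟩ := exists_linearOrder (fun a b => d.lt b a) (fun h h' => d.trans h' h)
    d.irrefl l
  obtain ⟨K, hK1, hK2⟩ := h o
  have hle : ∀ m, idealOf K m ≤ Proj e m := fun m => Submodule.map_subtype_le _ _
  have hbot : ∀ m, m ≠ l → idealOf K m = ⊥ := by
    intro m hm
    have h1 := (d.hasFiltration_submodule_iff K _ (K m)).1 (hK2 m)
    -- Each generator lies in `e μ * A * e m` with `μ` above `m` in the reversed order, so it is
    -- zero.
    have h2 : ∀ G : Submodule A A, Filt e (idealOf K) (fun t => m < t) G → G ≤ Proj e m → G = ⊥ := by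
      intro G hG
      induction hG with
      | bot => exact fun _ => rfl
      | @step F μ y _ hμ hy _ ih =>
        intro hle
        rw [ih (le_sup_left.trans hle), bot_sup_eq, Submodule.span_singleton_eq_bot]
        have hy' : y * e m = y :=
          d.mem_proj.1 (hle (Submodule.mem_sup_right (Submodule.mem_span_singleton_self y)))
        have hml : l < m := ho1 m hm
        refine d.eq_zero (ne_of_lt hμ) (fun hlt => ?_) hy hy'
        exact lt_asymm hμ (ho2 μ m (ne_of_gt (lt_trans hml hμ)) hm hlt)
    exact h2 _ h1 (hle m)
  have hKl : ∀ t z, t ≠ l → e t * z = z → z * e l = z → z ∈ idealOf K l := by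
    intro t z ht h1 h2
    have h3 := (d.hasMultiplicity_quotient_zero_iff l t (K l)).1 (hK1 l t (not_le_of_gt (ho1 t ht)))
      ⟨z, d.mem_proj.2 h2⟩
    exact ⟨_, h3, h1⟩
  obtain ⟨ι, _, m, y, hm, hy1, hy2, hind, hgen⟩ := d.exists_free_family l hKl hbot
    ((d.hasFiltration_submodule_iff K _ (K l)).1 (hK2 l))
  exact ⟨ι, inferInstance, m, y, hm, hy1, fun i => d.mem_proj.1 (hle l (hy2 i)), hind,
    fun t a ht h1 h2 => hgen t a ht (hKl t a ht h1 h2) h1⟩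

/-- A nonzero component at `l` would come from a path from `l` to some `t ≠ l` and back. -/
theorem e_mul_traceIdeal (d : DirectedStructure k e) {T : Λ → Prop} {l : Λ} (hl : ¬ T l) {z : A}
    (hz : z ∈ traceIdeal e T l) : e l * z = 0 := by
  have : ∀ a : A, e l * (a * z) = 0 := by
    refine Submodule.span_induction (p := fun z _ => ∀ a : A, e l * (a * z) = 0)
      ?_ ?_ ?_ ?_ hz
    · rintro z ⟨t, ht, h1, h2⟩ a
      have htl : t ≠ l := fun h => hl (h ▸ ht)
      by_cases hlt : d.lt l t
      · have h3 : e l * a * e t = 0 := d.eq_zero htl (fun h => d.irrefl _ (d.trans hlt h))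
          (by rw [← mul_assoc, ← mul_assoc, d.idem_mul]) (by rw [mul_assoc, d.idem_mul])
        rw [← h1, ← mul_assoc, ← mul_assoc, h3, zero_mul]
      · rw [d.eq_zero htl.symm hlt h1 h2, mul_zero, mul_zero]
    · intro a; rw [mul_zero, mul_zero]
    · intro z z' _ _ h h' a
      rw [mul_add, mul_add, h, h', add_zero]
    · intro b z _ h a
      rw [smul_eq_mul, ← mul_assoc a, h]
  have h1 := this 1
  rwa [one_mul] at h1

/-- The trace here is `J e_l`. The free family lives in `A` and its members need not be fixed by `e
l` on the right, so it only exhibits `J e_l` as a direct summand of a free module. -/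
theorem projective_traceIdeal (d : DirectedStructure k e) {l : Λ} {ι : Type} [Fintype ι]
    {m : ι → Λ} {y : ι → A} (hm : ∀ i, m i ≠ l) (hy1 : ∀ i, e (m i) * y i = y i)
    (hind : ∀ a : ι → A, (∀ i, a i * e (m i) = a i) → ∑ i, a i * y i = 0 → ∀ i, a i = 0)
    (hgen : ∀ t f, t ≠ l → e t * f = f →
      ∃ c : ι → A, (∀ i, c i * e (m i) = c i) ∧ f = ∑ i, c i * y i) :
    Module.Projective A (traceIdeal e (fun t => t ≠ l) l) ∧
      Module.Finite A (traceIdeal e (fun t => t ≠ l) l) := by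
  refine projective_of_free_family (fun i => e (m i)) y (e l) hind (fun z hz => ?_) (fun i => ?_)
    fun z hz => traceIdeal_mul_e hz
  · refine Submodule.span_induction (p := fun z _ => ∃ c : ι → A,
      (∀ i, c i * e (m i) = c i) ∧ z = ∑ i, c i * y i) ?_ ?_ ?_ ?_ hz
    · rintro z ⟨t, ht, h1, h2⟩
      exact hgen t z ht h1
    · exact ⟨0, fun i => zero_mul _, by simp⟩
    · rintro z z' _ _ ⟨c, hc, rfl⟩ ⟨c', hc', rfl⟩
      refine ⟨c + c', fun i => by simp [add_mul, hc, hc'], ?_⟩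
      simp [add_mul, Finset.sum_add_distrib]
    · rintro a z _ ⟨c, hc, rfl⟩
      refine ⟨fun i => a * c i, fun i => by rw [mul_assoc, hc], ?_⟩
      rw [smul_eq_mul, Finset.mul_sum]
      exact Finset.sum_congr rfl fun i _ => (mul_assoc _ _ _).symm
  · exact mem_traceIdeal (T := fun t => t ≠ l) (t := m i) (hm i) (by rw [← mul_assoc, hy1]) (by rw [mul_assoc, d.idem_mul])

/-- Over `A`, a projective module decomposes into modules `A e_m`; the vertex `l` itself cannot
occur because the trace has no component there. -/
theorem leftFreeAt_of_projective [FiniteDimensional k A] (d : DirectedStructure k e) (l : Λ)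
    [Module.Projective A (traceIdeal e (fun t => t ≠ l) l)]
    [Module.Finite A (traceIdeal e (fun t => t ≠ l) l)] : LeftFreeAt e l := by
  obtain ⟨n, m, x, hx1, hxind, hxgen⟩ := exists_basis_of_projective d.idem (fun t a ha => by
    by_cases hχ : d.χ t a = 0
    · right
      refine d.mem_jacobson_of_mem_rad (d.mem_rad.2 fun s => ?_)
      by_cases hs : s = t
      · rw [hs, hχ]
      · rw [← ha, map_mul, d.χ_of_ne hs, mul_zero]
    · obtain ⟨b, hb⟩ := d.exists_mul_eq_e ha hχ
      exact Or.inl ⟨b * e t, by rw [mul_assoc, hb]⟩) (traceIdeal e (fun t => t ≠ l) l)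
  have hxe : ∀ i, (x i : A) * e l = x i := fun i => traceIdeal_mul_e (x i).2
  have hx1' : ∀ i, e (m i) * (x i : A) = x i := fun i => congrArg Subtype.val (hx1 i)
  have hsum : ∀ a : Fin n → A, ((∑ i, a i • x i : traceIdeal e (fun t => t ≠ l) l) : A) =
      ∑ i, a i * (x i : A) := fun a => by
    rw [Submodule.coe_sum]; rfl
  refine ⟨Fin n, inferInstance, m, fun i => x i, fun i hi => ?_, hx1', hxe, fun a ha h0 => ?_,
    fun t a ht h1 h2 => ?_⟩
  -- A generator at the vertex `l` would be zero, contrary to independence.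
  · classical
    have hx0 : x i = 0 := Subtype.ext (by
      rw [← hx1', hi, d.e_mul_traceIdeal (fun h => h rfl) (x i).2]; rfl)
    have := hxind (fun j => if j = i then e (m i) else 0) (fun j => by
      split_ifs with hj
      · rw [hj, d.idem_mul]
      · rw [zero_mul]) (by simp [hx0]) i
    rw [if_pos rfl] at this
    exact d.e_ne_zero _ this
  · exact hxind a ha (Subtype.ext (by rw [hsum, h0]; rfl))
  · obtain ⟨c, hc1, hc2⟩ := hxgen ⟨a, mem_traceIdeal (T := fun t => t ≠ l) ht h1 h2⟩
    exact ⟨c, hc1, by rw [← hsum, ← hc2]⟩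

/-- The order is that of `leftFreeAt_of_isStandardlyStratified`, but the given filtration is one of
`A` and not of the kernel of `P_l → Δ_l`. This is why the argument goes through projectivity of `J
e_l`. -/
theorem leftFreeAt_of_isProperlyStratified [FiniteDimensional k A]
    (d : DirectedStructure k e) (h : ∀ o : LinearOrder Λ, IsProperlyStratified e o) (l : Λ) :
    LeftFreeAt e l := by
  obtain ⟨o, ho1, ho2⟩ := exists_linearOrder (fun a b => d.lt b a) (fun h h' => d.trans h' h)
    d.irrefl l
  obtain ⟨U, V, hU, -, hF, -⟩ := h o
  obtain rfl : U = d.stdKernel o := funext fun m => (d.isStandardKernel_iff o m _).1 (hU m)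
  rw [d.hasFiltration_self_iff, d.idealOf_stdKernel] at hF
  have hbot : ∀ m, m ≠ l → stdIdeal e o m = ⊥ := by
    intro m hm
    refine Submodule.span_eq_bot.2 ?_
    rintro z ⟨t, ht, h1, h2⟩
    refine d.eq_zero (ne_of_lt ht) (fun hlt => ?_) h1 h2
    exact lt_asymm ht (ho2 t m (ne_of_gt (lt_trans (ho1 m hm) ht)) hm hlt)
  obtain ⟨ι, _, m, y, hm, hy1, -, hind, hgen⟩ := d.exists_free_family l (K := stdIdeal e o)
    (fun t z ht h1 h2 => mem_traceIdeal (ho1 t ht) h1 h2) hbot hF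
  obtain ⟨_, _⟩ := d.projective_traceIdeal hm hy1 hind
    (fun t f ht h1 => hgen t f ht Submodule.mem_top h1)
  exact d.leftFreeAt_of_projective l

end DirectedStructure

/-! ### Proper standard filtrations and freeness on the right -/

/-- `LeftFreeAt` asks for an index type in the lowest universe; a finite index type elsewhere is
replaced by `Fin`. -/
theorem leftFreeAt_of_fintype {A : Type u} [Ring A] {Λ : Type w} {e : Λ → A} {l : Λ}
    {ι : Type*} [Fintype ι] (m : ι → Λ) (x : ι → A) (h1 : ∀ i, m i ≠ l)
    (h2 : ∀ i, e (m i) * x i = x i) (h3 : ∀ i, x i * e l = x i)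
    (h4 : ∀ a : ι → A, (∀ i, a i * e (m i) = a i) → ∑ i, a i * x i = 0 → ∀ i, a i = 0)
    (h5 : ∀ t a, t ≠ l → e t * a = a → a * e l = a →
      ∃ c : ι → A, (∀ i, c i * e (m i) = c i) ∧ a = ∑ i, c i * x i) : LeftFreeAt e l := by
  let φ := Fintype.equivFin ι
  refine ⟨Fin (Fintype.card ι), inferInstance, fun i => m (φ.symm i), fun i => x (φ.symm i),
    fun i => h1 _, fun i => h2 _, fun i => h3 _, fun a ha h0 i => ?_, fun t a ht ha ha' => ?_⟩
  · have := h4 (fun j => a (φ j)) (fun j => by simpa using ha (φ j)) (by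
      rw [← φ.symm.sum_comp]
      simpa using h0) (φ.symm i)
    simpa using this
  · obtain ⟨c, hc, hac⟩ := h5 t a ht ha ha'
    refine ⟨fun i => c (φ.symm i), fun i => hc _, ?_⟩
    rw [hac, ← φ.symm.sum_comp]

theorem rightFreeAt_of_fintype {A : Type u} [Ring A] {Λ : Type w} {e : Λ → A} {p : Λ}
    {ι : Type*} [Fintype ι] (q : ι → Λ) (y : ι → A) (h1 : ∀ i, q i ≠ p)
    (h2 : ∀ i, e p * y i = y i) (h3 : ∀ i, y i * e (q i) = y i)
    (h4 : ∀ a : ι → A, (∀ i, e (q i) * a i = a i) → ∑ i, y i * a i = 0 → ∀ i, a i = 0)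
    (h5 : ∀ t a, t ≠ p → e p * a = a → a * e t = a →
      ∃ c : ι → A, (∀ i, e (q i) * c i = c i) ∧ a = ∑ i, y i * c i) : RightFreeAt e p := by
  let φ := Fintype.equivFin ι
  refine ⟨Fin (Fintype.card ι), inferInstance, fun i => q (φ.symm i), fun i => y (φ.symm i),
    fun i => h1 _, fun i => h2 _, fun i => h3 _, fun a ha h0 i => ?_, fun t a ht ha ha' => ?_⟩
  · have := h4 (fun j => a (φ j)) (fun j => by simpa using ha (φ j)) (by
      rw [← φ.symm.sum_comp]
      simpa using h0) (φ.symm i)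
    simpa using this
  · obtain ⟨c, hc, hac⟩ := h5 t a ht ha ha'
    refine ⟨fun i => c (φ.symm i), fun i => hc _, ?_⟩
    rw [hac, ← φ.symm.sum_comp]

namespace DirectedStructure

variable {k : Type uk} [Field k] {A : Type u} [Ring A] [Algebra k A] {Λ : Type w} [Fintype Λ]
  {e : Λ → A} (d : DirectedStructure k e)

/-! ### Kernels of the projections onto proper standard modules. -/

/-- The left ideal generated by the radical of `e_l A e_l`. -/
def radIdeal (l : Λ) : Submodule A A :=
  Submodule.span A {z | e l * z = z ∧ z * e l = z ∧ d.χ l z = 0}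

/-- The kernel of the map from `P_l` to the proper standard module as a left ideal. -/
def propIdeal (o : LinearOrder Λ) (l : Λ) : Submodule A A := stdIdeal e o l ⊔ d.radIdeal l

theorem radIdeal_mul_e {l : Λ} {z : A} (hz : z ∈ d.radIdeal l) : z * e l = z := by
  refine Submodule.span_induction (p := fun z _ => z * e l = z) ?_ ?_ ?_ ?_ hz
  · rintro z ⟨h1, h2, -⟩
    exact h2
  · rw [zero_mul]
  · intro z z' _ _ h h'
    rw [add_mul, h, h']
  · intro a z _ h
    rw [smul_eq_mul, mul_assoc, h]

theorem propIdeal_mul_e {o : LinearOrder Λ} {l : Λ} {z : A} (hz : z ∈ d.propIdeal o l) :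
    z * e l = z := by
  obtain ⟨a, ha, b, hb, rfl⟩ := Submodule.mem_sup.1 hz
  rw [add_mul, traceIdeal_mul_e ha, d.radIdeal_mul_e hb]

theorem χ_propIdeal {o : LinearOrder Λ} {l : Λ} {z : A} (hz : z ∈ d.propIdeal o l) :
    d.χ l z = 0 := by
  have h : d.propIdeal o l ≤ RingHom.ker (d.χ l).toRingHom := by
    refine sup_le (Submodule.span_le.2 ?_) (Submodule.span_le.2 ?_)
    · rintro z ⟨t, ht, h1, h2⟩
      exact d.χ_of_corner (ne_of_lt ht) h1 h2
    · rintro z ⟨-, -, h⟩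
      exact h
  exact h hz

/-- The kernel of the map from `P_l` to the proper standard module. -/
def propKernel (o : LinearOrder Λ) (l : Λ) : Submodule A (Proj e l) :=
  (d.propIdeal o l).comap (Proj e l).subtype

theorem idealOf_propKernel (o : LinearOrder Λ) : idealOf (d.propKernel o) = d.propIdeal o := by
  funext l
  unfold idealOf propKernel
  rw [Submodule.map_comap_subtype, inf_eq_right]
  exact fun z hz => d.mem_proj.2 (d.propIdeal_mul_e hz)

theorem propKernel_ne_top (o : LinearOrder Λ) (l : Λ) : d.propKernel o l ≠ ⊤ := fun h => by
  have h1 : (⟨e l, e_mem_proj l⟩ : Proj e l) ∈ d.propKernel o l := by rw [h]; trivial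
  have h2 := d.χ_propIdeal (o := o) (l := l) (z := e l) h1
  rw [d.χ_self] at h2
  exact one_ne_zero h2

section

variable [FiniteDimensional k A]

/-- Multiplicity one at `l` adds to the standard condition that `U` is proper and contains the
radical of the corner at `l`. Since `propKernel` is itself proper, it is the least such `U`. -/
theorem mem_properStandard_iff (o : LinearOrder Λ) (l : Λ) (U : Submodule A (Proj e l)) :
    (HasMultiplicity (A := A) (Simp e l) (Proj e l ⧸ U) 1 ∧
      ∀ m, ¬ m ≤ l → HasMultiplicity (A := A) (Simp e m) (Proj e l ⧸ U) 0) ↔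
      U ≠ ⊤ ∧ d.propKernel o l ≤ U := by
  rw [d.hasMultiplicity_quotient_one_iff, d.hasMultiplicity_zero_iff_stdKernel_le, and_assoc]
  refine and_congr_right fun _ => ⟨?_, ?_⟩
  · rintro ⟨h1, h2⟩ x hx
    have hle : d.propIdeal o l ≤ U.map (Proj e l).subtype := by
      refine sup_le ?_ (Submodule.span_le.2 ?_)
      · have := Submodule.map_mono (f := (Proj e l).subtype) h2
        rwa [show (d.stdKernel o l).map (Proj e l).subtype = stdIdeal e o l from
          congrFun (d.idealOf_stdKernel o) l] at this
      · rintro z ⟨hz1, hz2, hz3⟩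
        exact ⟨_, h1 ⟨z, d.mem_proj.2 hz2⟩ hz3, hz1⟩
    obtain ⟨y, hy, hyx⟩ := hle hx
    rwa [← Subtype.ext hyx]
  · intro h
    refine ⟨fun x hx => h ?_, fun x hx => h (Submodule.mem_sup_left hx)⟩
    refine Submodule.mem_sup_right (Submodule.subset_span ⟨?_, ?_, ?_⟩)
    · change e l * (e l * (x : A)) = e l * x
      rw [← mul_assoc, d.idem_mul]
    · change e l * (x : A) * e l = e l * x
      rw [mul_assoc, d.mem_proj.1 x.2]
    · change d.χ l (e l * x) = 0
      rw [map_mul, hx, mul_zero]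

theorem isProperStandardKernel_iff (o : LinearOrder Λ) (l : Λ) (U : Submodule A (Proj e l)) :
    IsProperStandardKernel e o l U ↔ U = d.propKernel o l := by
  have key : IsProperStandardKernel e o l (d.propKernel o l) := by
    refine ⟨(d.mem_properStandard_iff o l _).2 ⟨d.propKernel_ne_top o l, le_rfl⟩, ?_⟩
    exact fun W hW => ((d.mem_properStandard_iff o l W).1 hW).2
  exact ⟨fun h => h.unique key, fun h => h ▸ key⟩

end

/-- Representatives of a basis of `e_p A e_m` modulo a left ideal. -/
theorem exists_corner_basis [FiniteDimensional k A] (d : DirectedStructure k e) (p m : Λ)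
    (W : Submodule A A) :
    ∃ (n : ℕ) (b : Fin n → A), (∀ j, e p * b j = b j) ∧ (∀ j, b j * e m = b j) ∧
      (∀ c : Fin n → k, ∑ j, c j • b j ∈ W → ∀ j, c j = 0) ∧
      ∀ z, e p * z = z → z * e m = z → ∃ c : Fin n → k, z - ∑ j, c j • b j ∈ W := by
  -- The part of a complement of `corner ⊓ W` that lies in the corner maps isomorphically to the
  -- corner modulo `W`.
  obtain ⟨D, hD⟩ := Submodule.exists_isCompl (corner k e m p ⊓ W.restrictScalars k)
  let b := Module.finBasis k (D ⊓ corner k e m p : Submodule k A)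
  have hb : ∀ j, (b j : A) ∈ corner k e m p := fun j => (b j).2.2
  refine ⟨_, fun j => b j, fun j => ((mem_corner_iff d.idem.idem).1 (hb j)).1,
    fun j => ((mem_corner_iff d.idem.idem).1 (hb j)).2, fun c hc => ?_, fun z h1 h2 => ?_⟩
  · have h0 : (∑ j, c j • b j : (D ⊓ corner k e m p : Submodule k A)) = 0 := by
      apply Subtype.ext
      have h1 : ((∑ j, c j • b j : (D ⊓ corner k e m p : Submodule k A)) : A) =
          ∑ j, c j • (b j : A) := by
        rw [Submodule.coe_sum]; rfl
      have h2 := (∑ j, c j • b j : (D ⊓ corner k e m p : Submodule k A)).2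
      exact (Submodule.disjoint_def.1 hD.disjoint) _ ⟨h2.2, by rw [h1]; exact hc⟩ h2.1
    exact Fintype.linearIndependent_iff.1 b.linearIndependent c h0
  · have hz : z ∈ corner k e m p := (mem_corner_iff d.idem.idem).2 ⟨h1, h2⟩
    obtain ⟨w, hw, v, hv, hwv⟩ := Submodule.mem_sup.1
      (show z ∈ (corner k e m p ⊓ W.restrictScalars k) ⊔ D by
        rw [hD.sup_eq_top]; exact Submodule.mem_top)
    have hv' : v ∈ D ⊓ corner k e m p := by
      refine ⟨hv, ?_⟩
      rw [← eq_sub_iff_add_eq'] at hwv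
      rw [hwv]
      exact Submodule.sub_mem _ hz hw.1
    refine ⟨fun j => b.repr ⟨v, hv'⟩ j, ?_⟩
    have h3 : ∑ j, b.repr ⟨v, hv'⟩ j • (b j : A) = v := by
      have := congrArg Subtype.val (b.sum_repr ⟨v, hv'⟩)
      rw [Submodule.coe_sum] at this
      exact this
    rw [h3, ← hwv, add_sub_cancel_right]
    exact hw.2

/-- In the order with `p` lowest and the directed order kept elsewhere, `Δ̄_m` for `m ≠ p` consists
of its top `S_m` and copies of `S_p`. Independence is read off along the filtration, since for `m ≠
p` the space `e_m Δ̄_μ` is at most a line, and zero unless `m = μ`. Generation follows from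
Nakayama's lemma on the right. -/
theorem rightFreeAt_of_isProperlyStratified [FiniteDimensional k A]
    (d : DirectedStructure k e) (h : ∀ o : LinearOrder Λ, IsProperlyStratified e o) (p : Λ) :
    RightFreeAt e p := by
  classical
  obtain ⟨o, ho1, ho2⟩ := exists_linearOrder d.lt d.trans d.irrefl p
  obtain ⟨U, V, -, hV, -, hF⟩ := h o
  obtain rfl : V = d.propKernel o := funext fun m => (d.isProperStandardKernel_iff o m _).1 (hV m)
  rw [d.hasFiltration_self_iff, d.idealOf_propKernel] at hF
  choose n b hb1 hb2 hb3 hb4 using fun m => d.exists_corner_basis p m (d.propIdeal o m)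
  -- The generators are lifts of bases of the spaces `e p • Δ̄_m` over all `m ≠ p`.
  let σ := Σ m : {m : Λ // m ≠ p}, Fin (n m)
  let y : σ → A := fun s => b s.1 s.2
  refine rightFreeAt_of_fintype (ι := σ) (fun s => s.1) y (fun s => s.1.2) (fun s => hb1 _ _)
    (fun s => hb2 _ _) ?_ ?_
  · have key : ∀ F : Submodule A A, Filt e (d.propIdeal o) (fun _ => True) F → ∀ a : σ → A,
        (∀ s, e s.1 * a s = a s) → (∀ s, a s ∈ F) → ∑ s, y s * a s = 0 → ∀ s, a s = 0 := by
      intro F hF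
      induction hF with
      | bot => exact fun a _ ha _ s => by simpa using ha s
      | @step F μ z hF _ hz hKz ih =>
        intro a ha1 ha2 ha3
        -- Modulo `F` the coefficient `a s` is a scalar multiple of the generator `z` of this step,
        -- and only for the indices over `μ`.
        have hc : ∀ s : σ, ∃ c : k, a s - c • z ∈ F ∧ ((s.1 : Λ) ≠ μ → c = 0) := by
          intro s
          obtain ⟨f, hf, t, ht, hft⟩ := Submodule.mem_sup.1 (ha2 s)
          obtain ⟨r, rfl⟩ := Submodule.mem_span_singleton.1 ht
          have has : a s = e s.1 * f + (e s.1 * r * e μ) * z := by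
            rw [mul_assoc _ (e μ), hz, mul_assoc, ← mul_add]
            rw [← ha1, ← hft, smul_eq_mul]
          have hβ1 : e s.1 * (e s.1 * r * e μ) = e s.1 * r * e μ := by
            simp only [← mul_assoc, d.idem_mul]
          have hβ2 : (e s.1 * r * e μ) * e μ = e s.1 * r * e μ := by
            rw [mul_assoc, d.idem_mul]
          by_cases hs : (s.1 : Λ) = μ
          · refine ⟨d.χ μ r, ?_, fun h => absurd hs h⟩
            rw [has, add_sub_assoc]
            refine F.add_mem (F.smul_mem _ hf) ?_
            have h1 : (e s.1 * r * e μ) * z - d.χ μ r • z =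
                (e s.1 * r * e μ - d.χ μ r • e μ) * z := by
              rw [sub_mul, smul_mul_assoc, hz]
            rw [h1]
            refine (hKz _ ?_).2 (Submodule.mem_sup_right (Submodule.subset_span ⟨?_, ?_, ?_⟩))
            · rw [sub_mul, hβ2, smul_mul_assoc, d.idem_mul]
            · rw [mul_sub, mul_smul_comm, d.idem_mul, hs, mul_assoc, ← mul_assoc, d.idem_mul]
            · rw [sub_mul, hβ2, smul_mul_assoc, d.idem_mul]
            · rw [map_sub, map_mul, map_mul, map_smul, hs, d.χ_self, one_mul, mul_one, smul_eq_mul,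
                mul_one, sub_self]
          · refine ⟨0, ?_, fun _ => rfl⟩
            rw [zero_smul, sub_zero, has]
            refine F.add_mem (F.smul_mem _ hf) ((hKz _ hβ2).2 ?_)
            rcases lt_trichotomy μ (s.1 : Λ) with h1 | h1 | h1
            · exact Submodule.mem_sup_left (mem_traceIdeal h1 hβ1 hβ2)
            · exact absurd h1.symm hs
            -- Here both vertices differ from `p`, so the linear order follows the directed one and
            -- there is no nonzero morphism from `μ` to the vertex of `s`.
            · have hps : p < s.1 := ho1 _ s.1.2
              have : e s.1 * r * e μ = 0 := d.eq_zero (Ne.symm hs)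
                (fun hlt => lt_asymm h1 (ho2 μ s.1 (ne_of_gt (lt_trans hps h1)) s.1.2 hlt))
                hβ1 hβ2
              rw [this]
              exact Submodule.zero_mem _
        choose c hc1 hc2 using hc
        -- The relation reduced modulo `F` says that this scalar combination kills the generator
        -- `z`, hence vanishes in `Δ̄_μ`; there the `y s` over `μ` are linearly independent.
        have hsum : ∑ s, c s • y s ∈ d.propIdeal o μ := by
          refine (hKz _ ?_).1 ?_
          · rw [Finset.sum_mul]
            refine Finset.sum_congr rfl fun s _ => ?_
            by_cases hs : (s.1 : Λ) = μ
            · rw [smul_mul_assoc, ← hs, hb2]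
            · rw [hc2 s hs, zero_smul, zero_mul]
          · have h1 : (∑ s, c s • y s) * z = -∑ s, y s * (a s - c s • z) := by
              simp only [mul_sub, Finset.sum_sub_distrib, ha3, zero_sub, neg_neg, Finset.sum_mul,
                smul_mul_assoc, mul_smul_comm]
            rw [h1]
            exact F.neg_mem (Submodule.sum_mem _ fun s _ => F.smul_mem _ (hc1 s))
        have hc0 : ∀ s, c s = 0 := by
          intro s
          by_cases hs : (s.1 : Λ) = μ
          · obtain ⟨⟨m, hm⟩, j⟩ := s
            obtain rfl : m = μ := hs
            refine hb3 m (fun j => c ⟨⟨m, hm⟩, j⟩) ?_ j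
            rw [Fintype.sum_sigma, Finset.sum_eq_single ⟨m, hm⟩] at hsum
            · exact hsum
            · intro m' _ hm'
              refine Finset.sum_eq_zero fun j _ => ?_
              rw [hc2 ⟨m', j⟩ (fun h => hm' (Subtype.ext h)), zero_smul]
            · exact fun h => absurd (Finset.mem_univ _) h
          · exact hc2 s hs
        refine ih a ha1 (fun s => ?_) ha3
        have := hc1 s
        rwa [hc0, zero_smul, sub_zero] at this
    exact fun a ha h0 => key ⊤ hF a ha (fun _ => Submodule.mem_top) h0
  · let Y : Submodule k A :=
      { carrier := {z | ∃ c : σ → A, (∀ s, e s.1 * c s = c s) ∧ z = ∑ s, y s * c s}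
        add_mem' := by
          rintro z z' ⟨c, hc, rfl⟩ ⟨c', hc', rfl⟩
          refine ⟨fun s => c s + c' s, fun s => by rw [mul_add, hc, hc'], ?_⟩
          simp only [mul_add, Finset.sum_add_distrib]
        zero_mem' := ⟨fun _ => 0, fun _ => mul_zero _, by simp⟩
        smul_mem' := by
          rintro r z ⟨c, hc, rfl⟩
          refine ⟨fun s => r • c s, fun s => by rw [mul_smul_comm, hc], ?_⟩
          simp only [mul_smul_comm, Finset.smul_sum] }
    have hYmul : ∀ z ∈ Y, ∀ a : A, z * a ∈ Y := by
      rintro z ⟨c, hc, rfl⟩ a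
      refine ⟨fun s => c s * a, fun s => by rw [← mul_assoc, hc], ?_⟩
      simp only [Finset.sum_mul, mul_assoc]
    have hYy : ∀ s, y s ∈ Y := by
      intro s
      refine ⟨fun s' => if s' = s then e s.1 else 0, fun s' => ?_, ?_⟩
      · dsimp only
        split_ifs with h
        · rw [h, d.idem_mul]
        · rw [mul_zero]
      · rw [Finset.sum_eq_single s]
        · simp [y, hb2]
        · intro s' _ h
          simp [h]
        · exact fun h => absurd (Finset.mem_univ _) h
    -- Induction from the top of the linear order. Modulo the span of the `y s` over `m`, an element
    -- of the corner splits into a part through some `t > m`, covered by induction, and a part in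
    -- the corner times the radical.
    have key : ∀ m : Λ, m ≠ p → corner k e m p ≤ Y := by
      intro m
      induction m using (wellFounded_gt (α := Λ)).induction with
      | _ m ih =>
        intro hm
        refine d.le_of_le_sup_mul_rad (fun z hz => ?_)
          (Submodule.mul_le.2 fun z hz a _ => hYmul z hz a)
        obtain ⟨hz1, hz2⟩ := (mem_corner_iff d.idem.idem).1 hz
        obtain ⟨c, hc⟩ := hb4 m z hz1 hz2
        obtain ⟨v, hv, v', hv', hvv⟩ := Submodule.mem_sup.1 hc
        have hzeq : z = (∑ j, c j • b m j + e p * v) + e p * v' := by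
          rw [add_assoc, ← mul_add, hvv, mul_sub, hz1, Finset.mul_sum]
          simp only [mul_smul_comm, hb1]
          abel
        rw [hzeq]
        refine Submodule.add_mem_sup (Submodule.add_mem _ (Submodule.sum_mem _ fun j _ =>
          Submodule.smul_mem _ _ (hYy ⟨⟨m, hm⟩, j⟩)) ?_) ?_
        · have h1 : ∀ a : A, e p * (a * v) ∈ Y := by
            refine Submodule.span_induction (p := fun v _ => ∀ a : A, e p * (a * v) ∈ Y)
              ?_ ?_ ?_ ?_ hv
            · rintro g ⟨t, ht, h1, h2⟩ a
              have : e p * (a * g) = (e p * a * e t) * g := by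
                rw [mul_assoc, h1, mul_assoc]
              rw [this]
              refine hYmul _ (ih t ht (ne_of_gt (lt_trans (ho1 m hm) ht)) ?_) g
              exact mem_corner.2 ⟨a, (mul_assoc _ _ _).symm⟩
            · intro a; rw [mul_zero, mul_zero]; exact Y.zero_mem
            · intro x x' _ _ hx hx' a
              rw [mul_add, mul_add]; exact Y.add_mem (hx a) (hx' a)
            · intro r x _ hx a
              rw [smul_eq_mul, ← mul_assoc a]; exact hx _
          simpa using h1 1
        · have h1 : ∀ a : A, e p * (a * v') ∈ corner k e m p * d.rad := by
            refine Submodule.span_induction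
              (p := fun v _ => ∀ a : A, e p * (a * v) ∈ corner k e m p * d.rad) ?_ ?_ ?_ ?_ hv'
            · rintro g ⟨h1, h2, h3⟩ a
              have : e p * (a * g) = (e p * a * e m) * g := by
                rw [mul_assoc, h1, mul_assoc]
              rw [this]
              refine Submodule.mul_mem_mul (mem_corner.2 ⟨a, (mul_assoc _ _ _).symm⟩)
                (d.mem_rad.2 fun q => ?_)
              by_cases hq : q = m
              · rw [hq, h3]
              · rw [← h1, map_mul, d.χ_of_ne hq, zero_mul]
            · intro a; rw [mul_zero, mul_zero]; exact Submodule.zero_mem _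
            · intro x x' _ _ hx hx' a
              rw [mul_add, mul_add]; exact Submodule.add_mem _ (hx a) (hx' a)
            · intro r x _ hx a
              rw [smul_eq_mul, ← mul_assoc a]; exact hx _
          simpa using h1 1
    exact fun t a ht h1 h2 => key t ht ((mem_corner_iff d.idem.idem).2 ⟨h1, h2⟩)

end DirectedStructure

/-! ### Proper stratification from freeness on both sides -/

namespace DirectedStructure

variable {k : Type uk} [Field k] {A : Type u} [Ring A] [Algebra k A] {Λ : Type w} [Fintype Λ]
  {e : Λ → A} (d : DirectedStructure k e)

/-- If `A` is free on the right, then `e_p (A / A e_T A) e_l` is a free right module over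
`e_l A e_l`. -/
theorem exists_corner_basis_mod_traceIdeal (d : DirectedStructure k e)
    (h : ∀ p, RightFreeAt e p) {T : Λ → Prop} {l : Λ} (hl : ¬ T l) (p : Λ) :
    ∃ (ι : Type) (_ : Fintype ι) (b : ι → A), (∀ j, e p * b j = b j) ∧
      (∀ r : ι → A, (∀ j, e l * r j = r j) → (∀ j, r j * e l = r j) →
        ∑ j, b j * r j ∈ traceIdeal e T l → ∀ j, r j = 0) ∧
      ∀ a, e p * a = a → a * e l = a → ∃ r : ι → A, (∀ j, e l * r j = r j) ∧
        (∀ j, r j * e l = r j) ∧ a - ∑ j, b j * r j ∈ traceIdeal e T l := by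
  induction p using d.wf_lt.induction with
  | _ p ih =>
    -- If `p` is in `T`, the quotient is zero and the basis empty; if `p = l`, the basis is `e l`.
    -- Otherwise the basis at `p` is assembled from the products of the generators `y i` of `e p *
    -- J` with the bases at the smaller vertices `q i`.
    by_cases hT : T p
    · refine ⟨Empty, inferInstance, fun j => j.elim, fun j => j.elim, fun _ _ _ _ j => j.elim,
        fun a h1 h2 => ⟨fun j => j.elim, fun j => j.elim, fun j => j.elim, ?_⟩⟩
      rw [Finset.univ_eq_empty, Finset.sum_empty, sub_zero]
      exact mem_traceIdeal hT h1 h2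
    by_cases hpl : p = l
    · subst hpl
      refine ⟨Unit, inferInstance, fun _ => e p, fun _ => d.idem_mul p, fun r h1 h2 h3 j => ?_,
        fun a h1 h2 => ⟨fun _ => a, fun _ => h1, fun _ => h2, ?_⟩⟩
      · rw [Fintype.sum_unique, h1] at h3
        have := d.e_mul_traceIdeal hl h3
        rwa [h1] at this
      · rw [Fintype.sum_unique, h1, sub_self]
        exact Submodule.zero_mem _
    obtain ⟨ι, _, q, y, hq, hy1, hy2, hy3, hy4⟩ := h p
    have hlt : ∀ i, d.lt (q i) p := by
      classical
      intro i
      by_contra hn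
      have h0 : y i = 0 := d.eq_zero (hq i) hn (hy1 i) (hy2 i)
      have := hy3 (Pi.single i (e (q i))) (fun j => by
        by_cases hj : j = i
        · subst hj; rw [Pi.single_eq_same, d.idem_mul]
        · rw [Pi.single_eq_of_ne hj, mul_zero]) (Finset.sum_eq_zero fun j _ => by
        by_cases hj : j = i
        · subst hj; rw [h0, zero_mul]
        · rw [Pi.single_eq_of_ne hj, mul_zero]) i
      rw [Pi.single_eq_same] at this
      exact d.e_ne_zero _ this
    choose κ hκ b hb1 hb2 hb3 using fun i => ih (q i) (hlt i)
    -- The expansion in the `y i` respects the trace: an element through `t ∈ T` has `t ≠ p`, so its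
    -- part `e p * a * e t` can already be expanded.
    have htr : ∀ z ∈ traceIdeal e T l, ∀ a : A, ∃ c : ι → A, (∀ i, e (q i) * c i = c i) ∧
        (∀ i, c i ∈ traceIdeal e T l) ∧ e p * (a * z) = ∑ i, y i * c i := by
      intro z hz
      refine Submodule.span_induction (p := fun z _ => ∀ a : A, ∃ c : ι → A,
        (∀ i, e (q i) * c i = c i) ∧ (∀ i, c i ∈ traceIdeal e T l) ∧
          e p * (a * z) = ∑ i, y i * c i) ?_ ?_ ?_ ?_ hz
      · rintro z ⟨t, ht, h1, h2⟩ a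
        obtain ⟨c, hc, hac⟩ := hy4 t (e p * (a * e t)) (fun htp => hT (htp ▸ ht))
          (by rw [← mul_assoc, d.idem_mul]) (by rw [mul_assoc, mul_assoc, d.idem_mul])
        refine ⟨fun i => c i * z, fun i => by rw [← mul_assoc, hc], fun i =>
          Submodule.smul_mem _ _ (mem_traceIdeal ht h1 h2), ?_⟩
        simp only [← mul_assoc, ← Finset.sum_mul]
        rw [← hac]
        simp only [mul_assoc, h1]
      · exact fun a => ⟨fun _ => 0, fun _ => mul_zero _, fun _ => Submodule.zero_mem _, by simp⟩
      · intro z z' _ _ h1 h2 a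
        obtain ⟨c, hc1, hc2, hc3⟩ := h1 a
        obtain ⟨c', hc1', hc2', hc3'⟩ := h2 a
        refine ⟨fun i => c i + c' i, fun i => by rw [mul_add, hc1, hc1'],
          fun i => Submodule.add_mem _ (hc2 i) (hc2' i), ?_⟩
        simp only [mul_add, Finset.sum_add_distrib, hc3, hc3']
      · intro r z _ h1 a
        obtain ⟨c, hc1, hc2, hc3⟩ := h1 (a * r)
        exact ⟨c, hc1, hc2, by rw [← hc3, smul_eq_mul, mul_assoc a]⟩
    let σ := Σ i, κ i
    refine ⟨σ, inferInstance, fun s => y s.1 * b s.1 s.2, fun s => by rw [← mul_assoc, hy1],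
      fun r h1 h2 h3 => ?_, fun a h1 h2 => ?_⟩
    · rw [Fintype.sum_sigma] at h3
      simp only [mul_assoc, ← Finset.mul_sum] at h3
      obtain ⟨c, hc1, hc2, hc3⟩ := htr _ h3 1
      -- Two expansions of one element in the free family `y` are compared, which places each inner
      -- sum in the trace.
      have h4 := hy3 (fun i => ∑ j, b i j * r ⟨i, j⟩ - c i) (fun i => by
        rw [mul_sub, hc1, Finset.mul_sum]
        simp only [← mul_assoc, hb1]) (by
        simp only [mul_sub, Finset.sum_sub_distrib, ← hc3, one_mul]
        simp only [Finset.mul_sum, ← mul_assoc, hy1, sub_self])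
      rintro ⟨i, j⟩
      refine hb2 i (fun j => r ⟨i, j⟩) (fun j => h1 _) (fun j => h2 _) ?_ j
      rw [sub_eq_zero.1 (h4 i)]
      exact hc2 i
    · obtain ⟨c, hc, hac⟩ := hy4 l a (Ne.symm hpl) h1 h2
      choose r hr1 hr2 hr3 using fun i => hb3 i (c i * e l) (by rw [← mul_assoc, hc])
        (by rw [mul_assoc, d.idem_mul])
      refine ⟨fun s => r s.1 s.2, fun s => hr1 _ _, fun s => hr2 _ _, ?_⟩
      have : a - ∑ s : σ, y s.1 * b s.1 s.2 * r s.1 s.2 =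
          ∑ i, y i * (c i * e l - ∑ j, b i j * r i j) := by
        rw [Fintype.sum_sigma, ← h2, hac]
        simp only [mul_sub, Finset.sum_sub_distrib, Finset.mul_sum, Finset.sum_mul, mul_assoc]
      rw [this]
      exact Submodule.sum_mem _ fun i _ => Submodule.smul_mem _ _ (hr3 i)

theorem mem_rad_of_corner {l : Λ} {r : A} (h1 : e l * r = r) (h3 : d.χ l r = 0) : r ∈ d.rad := by
  refine d.mem_rad.2 fun q => ?_
  by_cases hq : q = l
  · rw [hq, h3]
  · rw [← h1, map_mul, d.χ_of_ne hq, zero_mul]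

variable [FiniteDimensional k A]

/-- A proper submodule of `e_l A e_l` is contained in a submodule that is larger by a simple
factor. -/
theorem exists_socle_element {l : Λ} {L : Submodule k A} (hL : ¬ corner k e l l ≤ L) :
    ∃ z, e l * z = z ∧ z * e l = z ∧ z ∉ L ∧
      ∀ r, e l * r = r → r * e l = r → d.χ l r = 0 → r * z ∈ L := by
  by_contra! hcon
  obtain ⟨z, hz, hzL⟩ := Set.not_subset.1 hL
  obtain ⟨hz1, hz2⟩ := (mem_corner_iff d.idem.idem).1 hz
  -- If no element had the property, multiplication by radical elements could be repeated forever
  -- without entering `L`, against nilpotence.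
  have key : ∀ n : ℕ, ∃ w ∈ d.rad ^ n, e l * (w * z) = w * z ∧ w * z ∉ L := by
    intro n
    induction n with
    | zero =>
      refine ⟨1, ?_, by rw [one_mul, hz1], by rwa [one_mul]⟩
      rw [pow_zero]
      exact Submodule.one_le.1 le_rfl
    | succ n ih =>
      obtain ⟨w, hw, h1, h2⟩ := ih
      obtain ⟨r, hr1, hr2, hr3, hr4⟩ := hcon (w * z) h1 (by rw [mul_assoc, hz2]) h2
      refine ⟨r * w, ?_, by rw [← mul_assoc, ← mul_assoc, hr1], by rwa [mul_assoc]⟩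
      rw [pow_succ']
      exact Submodule.mul_mem_mul (d.mem_rad_of_corner hr1 hr3) hw
  obtain ⟨n, hn⟩ := d.exists_rad_pow_eq_bot
  obtain ⟨w, hw, -, h⟩ := key n
  rw [hn, Submodule.mem_bot] at hw
  rw [hw, zero_mul] at h
  exact h (Submodule.zero_mem _)

/-- A step of a filtration by standard modules refines to a filtration by proper standard
modules. -/
theorem filt_propIdeal_sup (h : ∀ p, RightFreeAt e p) (o : LinearOrder Λ) {F : Submodule A A}
    (hF : Filt e (d.propIdeal o) (fun _ => True) F) {μ : Λ} {y : A} (hy : e μ * y = y)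
    (hK : ∀ a, a * e μ = a → (a * y ∈ F ↔ a ∈ stdIdeal e o μ)) :
    Filt e (d.propIdeal o) (fun _ => True) (F ⊔ Submodule.span A {y}) := by
  -- `L` is a left ideal of the local algebra `e μ * A * e μ`, and `F ⊔ A L y` is the part already
  -- filtered. Enlarging `L` by one dimension adds one proper standard module. The codimension in
  -- `A` serves only as the decreasing measure.
  have key : ∀ (n : ℕ) (L : Submodule k A),
      Module.finrank k A - Module.finrank k L = n → L ≤ corner k e μ μ →
      (∀ r, e μ * r = r → r * e μ = r → ∀ z ∈ L, r * z ∈ L) →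
      Filt e (d.propIdeal o) (fun _ => True) (F ⊔ Submodule.span A ((· * y) '' L)) →
      Filt e (d.propIdeal o) (fun _ => True) (F ⊔ Submodule.span A {y}) := by
    intro n
    induction n using Nat.strong_induction_on with
    | _ n ih =>
      intro L hn hL1 hL2 hLF
      by_cases hle : corner k e μ μ ≤ L
      · convert hLF using 2
        apply le_antisymm
        · rw [Submodule.span_le, Set.singleton_subset_iff]
          exact Submodule.subset_span
            ⟨e μ, hle ((mem_corner_iff d.idem.idem).2 ⟨d.idem_mul μ, d.idem_mul μ⟩), hy⟩
        · rw [Submodule.span_le]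
          rintro _ ⟨z, -, rfl⟩
          exact Submodule.smul_mem _ z (Submodule.mem_span_singleton_self y)
      obtain ⟨z, hz1, hz2, hzL, hz3⟩ := d.exists_socle_element hle
      -- Modulo `L`, the corner acts on `z` through the character.
      have hdec : ∀ r, e μ * r = r → r * e μ = r → r * z - d.χ μ r • z ∈ L := by
        intro r h1 h2
        have := hz3 (r - d.χ μ r • e μ) (by rw [mul_sub, mul_smul_comm, h1, d.idem_mul])
          (by rw [sub_mul, smul_mul_assoc, h2, d.idem_mul])
          (by rw [map_sub, map_smul, d.χ_self, smul_eq_mul, mul_one, sub_self])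
        rwa [sub_mul, smul_mul_assoc, hz1] at this
      have hlt : L < L ⊔ k ∙ z := by
        refine lt_of_le_of_ne le_sup_left fun heq => hzL ?_
        rw [heq]
        exact Submodule.mem_sup_right (Submodule.mem_span_singleton_self z)
      have hfr := Submodule.finrank_lt_finrank_of_lt hlt
      have hfr' := Submodule.finrank_le (L ⊔ k ∙ z)
      refine ih _ ?_ (L ⊔ k ∙ z) rfl ?_ ?_ ?_
      · omega
      · refine sup_le hL1 ?_
        rw [Submodule.span_le, Set.singleton_subset_iff]
        exact (mem_corner_iff d.idem.idem).2 ⟨hz1, hz2⟩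
      · intro r h1 h2 w hw
        obtain ⟨v, hv, v', hv', rfl⟩ := Submodule.mem_sup.1 hw
        obtain ⟨c, rfl⟩ := Submodule.mem_span_singleton.1 hv'
        rw [mul_add, mul_smul_comm]
        refine Submodule.add_mem _ (Submodule.mem_sup_left (hL2 r h1 h2 v hv))
          (Submodule.smul_mem _ _ ?_)
        rw [← sub_add_cancel (r * z) (d.χ μ r • z)]
        exact Submodule.add_mem _ (Submodule.mem_sup_left (hdec r h1 h2))
          (Submodule.mem_sup_right (Submodule.smul_mem _ _ (Submodule.mem_span_singleton_self z)))
      · have hsup : F ⊔ Submodule.span A ((· * y) '' ((L ⊔ k ∙ z : Submodule k A) : Set A)) =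
            (F ⊔ Submodule.span A ((· * y) '' L)) ⊔ Submodule.span A {z * y} := by
          rw [sup_assoc]
          congr 1
          apply le_antisymm
          · rw [Submodule.span_le]
            rintro _ ⟨w, hw, rfl⟩
            obtain ⟨v, hv, v', hv', rfl⟩ := Submodule.mem_sup.1 hw
            obtain ⟨c, rfl⟩ := Submodule.mem_span_singleton.1 hv'
            change (v + c • z) * y ∈ _
            rw [add_mul, smul_mul_assoc, Algebra.smul_def]
            exact Submodule.add_mem _
              (Submodule.mem_sup_left (Submodule.subset_span ⟨v, hv, rfl⟩))
              (Submodule.mem_sup_right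
                (Submodule.smul_mem _ _ (Submodule.mem_span_singleton_self _)))
          · refine sup_le (Submodule.span_mono (Set.image_mono fun v hv =>
              Submodule.mem_sup_left hv)) ?_
            rw [Submodule.span_le, Set.singleton_subset_iff]
            exact Submodule.subset_span
              ⟨z, Submodule.mem_sup_right (Submodule.mem_span_singleton_self z), rfl⟩
        rw [hsup]
        -- The new factor must have exactly the annihilator `propIdeal`. The forward direction needs
        -- that `Δ_μ` is free on the right; the backward one uses only the choice of `z`.
        refine .step μ (z * y) hLF trivial (by rw [← mul_assoc, hz1]) fun a ha => ⟨fun haz => ?_, fun haK => ?_⟩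
        · obtain ⟨f, hf, g, hg, hfg⟩ := Submodule.mem_sup.1 haz
          have hgen : ∀ p, ∃ (ι : Type) (_ : Fintype ι) (b : ι → A), (∀ j, e p * b j = b j) ∧
              (∀ r : ι → A, (∀ j, e μ * r j = r j) → (∀ j, r j * e μ = r j) →
                ∑ j, b j * r j ∈ stdIdeal e o μ → ∀ j, r j = 0) ∧
              ∀ a, e p * a = a → a * e μ = a → ∃ r : ι → A, (∀ j, e μ * r j = r j) ∧
                (∀ j, r j * e μ = r j) ∧ a - ∑ j, b j * r j ∈ stdIdeal e o μ := fun p =>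
            d.exists_corner_basis_mod_traceIdeal h (T := fun t => μ < t) (lt_irrefl μ) p
          have hw : ∃ w ∈ Submodule.span A (L : Set A), g = w * y := by
            refine Submodule.span_induction
              (p := fun g _ => ∃ w ∈ Submodule.span A (L : Set A), g = w * y) ?_ ?_ ?_ ?_ hg
            · rintro _ ⟨w, hw, rfl⟩
              exact ⟨w, Submodule.subset_span hw, rfl⟩
            · exact ⟨0, Submodule.zero_mem _, (zero_mul y).symm⟩
            · rintro _ _ _ _ ⟨w, hw, rfl⟩ ⟨w', hw', rfl⟩
              exact ⟨w + w', Submodule.add_mem _ hw hw', (add_mul w w' y).symm⟩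
            · rintro r _ _ ⟨w, hw, rfl⟩
              exact ⟨r * w, Submodule.smul_mem _ r hw, (mul_assoc r w y).symm⟩
          obtain ⟨w, hwL, rfl⟩ := hw
          have hLe : ∀ v ∈ L, e μ * v = v ∧ v * e μ = v := fun v hv =>
            (mem_corner_iff d.idem.idem).1 (hL1 hv)
          have hwe : w * e μ = w := by
            refine Submodule.span_induction (p := fun w _ => w * e μ = w) ?_ ?_ ?_ ?_ hwL
            · exact fun v hv => (hLe v hv).2
            · exact zero_mul _
            · intro v v' _ _ h1 h2; rw [add_mul, h1, h2]
            · intro r v _ h1; rw [smul_eq_mul, mul_assoc, h1]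
          -- Modulo the standard kernel, `a * z` agrees with an element `w` of `A L`.
          have hdiff : a * z - w ∈ stdIdeal e o μ := by
            refine (hK _ ?_).1 ?_
            · rw [sub_mul, mul_assoc, hz2, hwe]
            · rw [sub_mul, mul_assoc, ← hfg, add_sub_cancel_right]
              exact hf
          rw [← d.sum_mul a]
          refine Submodule.sum_mem _ fun p _ => ?_
          obtain ⟨ι, _, b, hb1, hb2, hb3⟩ := hgen p
          have hwp : ∀ c : A, ∃ v : ι → A, (∀ j, v j ∈ L) ∧
              e p * (c * w) - ∑ j, b j * v j ∈ stdIdeal e o μ := by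
            refine Submodule.span_induction (p := fun w _ => ∀ c : A, ∃ v : ι → A, (∀ j, v j ∈ L) ∧
              e p * (c * w) - ∑ j, b j * v j ∈ stdIdeal e o μ) ?_ ?_ ?_ ?_ hwL
            · intro v hv c
              obtain ⟨r, hr1, hr2, hr3⟩ := hb3 (e p * (c * e μ)) (by rw [← mul_assoc, d.idem_mul])
                (by rw [mul_assoc, mul_assoc, d.idem_mul])
              refine ⟨fun j => r j * v, fun j => hL2 _ (hr1 j) (hr2 j) v hv, ?_⟩
              have := traceIdeal_mul_mem hr3 (hLe v hv).2
              rw [sub_mul, Finset.sum_mul] at this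
              simpa only [mul_assoc, (hLe v hv).1] using this
            · exact fun c => ⟨fun _ => 0, fun _ => L.zero_mem, by simp⟩
            · intro w w' _ _ h1 h2 c
              obtain ⟨v, hv, hv'⟩ := h1 c
              obtain ⟨u, hu, hu'⟩ := h2 c
              refine ⟨fun j => v j + u j, fun j => L.add_mem (hv j) (hu j), ?_⟩
              have := Submodule.add_mem _ hv' hu'
              simp only [mul_add, Finset.sum_add_distrib]
              rwa [add_sub_add_comm]
            · intro r w _ h1 c
              obtain ⟨v, hv, hv'⟩ := h1 (c * r)
              exact ⟨v, hv, by rwa [smul_eq_mul, ← mul_assoc c]⟩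
          obtain ⟨v, hv1, hv2⟩ := hwp 1
          obtain ⟨r, hr1, hr2, hr3⟩ := hb3 (e p * a) (by rw [← mul_assoc, d.idem_mul])
            (by rw [mul_assoc, ha])
          -- Uniqueness of coordinates in the right basis `b` of `e p • Δ_μ`: those of `a * z` are
          -- `r j * z`, and those of `w` lie in `L`.
          have hrz : ∀ j, r j * z - v j = 0 := by
            refine hb2 _ (fun j => ?_) (fun j => ?_) ?_
            · rw [mul_sub, ← mul_assoc, hr1, (hLe _ (hv1 j)).1]
            · rw [sub_mul, mul_assoc, hz2, (hLe _ (hv1 j)).2]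
            · have h1 := traceIdeal_mul_mem hr3 hz2
              have h2 := Submodule.smul_mem _ (e p) hdiff
              have : ∑ j, b j * (r j * z - v j) = (e p • (a * z - w) - (e p * a - ∑ j, b j * r j) * z)
                  + (e p * (1 * w) - ∑ j, b j * v j) := by
                simp only [mul_sub, sub_mul, Finset.sum_sub_distrib, smul_eq_mul, one_mul,
                  Finset.sum_mul, mul_assoc]
                abel
              rw [this]
              exact Submodule.add_mem _ (Submodule.sub_mem _ h2 h1) hv2
          -- Now `r j * z` lies in `L` and is congruent to `χ μ (r j) • z` modulo `L`, while `z` is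
          -- not in `L`.
          have hχ : ∀ j, d.χ μ (r j) = 0 := by
            intro j
            by_contra hne
            have h1 := hdec (r j) (hr1 j) (hr2 j)
            rw [sub_eq_zero.1 (hrz j)] at h1
            have h2 := L.sub_mem (hv1 j) h1
            rw [sub_sub_cancel] at h2
            exact hzL ((L.smul_mem_iff hne).1 h2)
          rw [← sub_add_cancel (e p * a) (∑ j, b j * r j)]
          refine Submodule.add_mem _ (Submodule.mem_sup_left hr3)
            (Submodule.mem_sup_right (Submodule.sum_mem _ fun j _ => Submodule.smul_mem _ _
              (Submodule.subset_span ⟨hr1 j, hr2 j, hχ j⟩)))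
        · rw [← mul_assoc]
          obtain ⟨s, hs, t, ht, rfl⟩ := Submodule.mem_sup.1 haK
          rw [add_mul, add_mul]
          refine Submodule.add_mem _ (Submodule.mem_sup_left ((hK _ ?_).2 ?_)) (Submodule.mem_sup_right ?_)
          · rw [mul_assoc, hz2]
          · exact traceIdeal_mul_mem hs hz2
          · refine Submodule.span_induction
              (p := fun t _ => t * z * y ∈ Submodule.span A ((· * y) '' (L : Set A))) ?_ ?_ ?_ ?_ ht
            · rintro r ⟨h1, h2, h3⟩
              exact Submodule.subset_span ⟨r * z, hz3 r h1 h2 h3, rfl⟩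
            · rw [zero_mul, zero_mul]; exact Submodule.zero_mem _
            · intro t t' _ _ h1 h2
              rw [add_mul, add_mul]; exact Submodule.add_mem _ h1 h2
            · intro r t _ h1
              rw [smul_eq_mul, mul_assoc, mul_assoc, ← mul_assoc t]
              exact Submodule.smul_mem _ r h1
  refine key _ ⊥ rfl bot_le (fun r _ _ z hz => ?_) ?_
  · rw [(Submodule.mem_bot k).1 hz, mul_zero]
    exact Submodule.zero_mem _
  · simpa using hF

theorem isProperlyStratified_of_free (d : DirectedStructure k e) (hl : ∀ l, LeftFreeAt e l) (hr : ∀ p, RightFreeAt e p)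
    (o : LinearOrder Λ) : IsProperlyStratified e o := by
  refine ⟨d.stdKernel o, d.propKernel o, fun l => (d.isStandardKernel_iff o l _).2 rfl,
    fun l => (d.isProperStandardKernel_iff o l _).2 rfl, ?_, ?_⟩
  · rw [d.hasFiltration_self_iff, d.idealOf_stdKernel]
    exact d.filt_top hl o
  · rw [d.hasFiltration_self_iff, d.idealOf_propKernel]
    have key : ∀ G, Filt e (stdIdeal e o) (fun _ => True) G →
        Filt e (d.propIdeal o) (fun _ => True) G := by
      intro G hG
      induction hG with
      | bot => exact .bot
      | step μ y _ _ hy hK ih => exact d.filt_propIdeal_sup hr o ih hy hK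
    exact key ⊤ (d.filt_top hl o)

end DirectedStructure

/-! ### Corners of the associated graded algebra -/

section Graded

variable {k : Type uk} [Field k] {A : Type u} [Ring A] [Algebra k A] {Λ : Type w} [Fintype Λ]
  {e : Λ → A}

theorem e_mul_offDiag_mul_e (he : CompleteOrthogonalIdempotents e) {x : A}
    (hx : x ∈ offDiag k e) (l : Λ) : e l * x * e l = 0 := by
  have key : offDiag k e ≤
      LinearMap.ker ((LinearMap.mulLeft k (e l)).comp (LinearMap.mulRight k (e l))) := by
    refine iSup_le fun p => iSup_le fun m => iSup_le fun hpm => fun x hx => ?_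
    obtain ⟨b, rfl⟩ := mem_corner.1 hx
    change e l * (e m * (b * e p) * e l) = 0
    by_cases h : l = m
    · rw [mul_assoc (e m), mul_assoc b, he.ortho (fun h' => hpm (h'.trans h)), mul_zero, mul_zero,
        mul_zero]
    · rw [mul_assoc (e m), ← mul_assoc (e l), he.ortho h, zero_mul]
  rw [mul_assoc]
  exact key hx

theorem mem_offDiag_of_ne {l p : Λ} (h : l ≠ p) (he : CompleteOrthogonalIdempotents e) {x : A}
    (h1 : e p * x = x) (h2 : x * e l = x) : x ∈ offDiag k e :=
  corner_le_offDiag h ((mem_corner_iff he.idem).2 ⟨h1, h2⟩)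

theorem offDiagPow_one : offDiagPow k e 1 = offDiag k e := pow_one _

theorem offDiagPow_succ_le (he : CompleteOrthogonalIdempotents e) (hd : IsDirectedFamily k e)
    (n : ℕ) : offDiagPow k e (n + 1) ≤ offDiagPow k e n :=
  (offDiagFiltration he hd).step_succ_le n

theorem offDiagPow_antitone (he : CompleteOrthogonalIdempotents e) (hd : IsDirectedFamily k e) :
    Antitone (offDiagPow k e) :=
  antitone_nat_of_succ_le (offDiagPow_succ_le he hd)

theorem eq_zero_of_mem_offDiagPow_succ (he : CompleteOrthogonalIdempotents e)
    (hd : IsDirectedFamily k e) {l : Λ} {n : ℕ} {x : A} (hx : x ∈ offDiagPow k e (n + 1))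
    (h1 : e l * x = x) (h2 : x * e l = x) : x = 0 := by
  have h : x ∈ offDiagPow k e 1 := offDiagPow_antitone he hd (Nat.le_add_left 1 n) hx
  rw [offDiagPow_one] at h
  have := e_mul_offDiag_mul_e he h l
  rwa [h1, h2] at this

/-- The characters vanish on the off-diagonal corners, so `J` lies in the nilpotent radical. -/
theorem DirectedStructure.exists_offDiagPow_eq_bot [FiniteDimensional k A]
    (d : DirectedStructure k e) : ∃ n, offDiagPow k e (n + 1) = ⊥ := by
  have h1 : offDiag k e ≤ d.rad := by
    refine iSup_le fun p => iSup_le fun m => iSup_le fun hpm => fun x hx => ?_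
    obtain ⟨h1, h2⟩ := (mem_corner_iff d.idem.idem).1 hx
    exact d.mem_rad.2 fun q => d.χ_of_corner hpm h1 h2
  obtain ⟨n, hn⟩ := d.exists_rad_pow_eq_bot
  refine ⟨n, le_bot_iff.1 ?_⟩
  calc offDiag k e ^ (n + 1) ≤ d.rad ^ (n + 1) := pow_le_pow_left' h1 _
    _ = ⊥ := by rw [pow_succ, hn, Submodule.bot_mul]

variable (he : CompleteOrthogonalIdempotents e) (hd : IsDirectedFamily k e)

/-- The class of an element of `J^n` as a homogeneous element of the graded algebra. -/
def grOf (n : ℕ) (x : offDiagPow k e n) : (offDiagFiltration he hd).Gr :=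
  DirectSum.of (offDiagFiltration he hd).Piece n ((offDiagFiltration he hd).cls x)

theorem grOf_add (n : ℕ) (x y : offDiagPow k e n) :
    grOf he hd n (x + y) = grOf he hd n x + grOf he hd n y :=
  map_add (DirectSum.of (offDiagFiltration he hd).Piece n)
    ((offDiagFiltration he hd).cls x) ((offDiagFiltration he hd).cls y)

theorem grOf_smul (n : ℕ) (r : k) (x : offDiagPow k e n) :
    grOf he hd n (r • x) = r • grOf he hd n x :=
  map_smul (DirectSum.lof k ℕ (offDiagFiltration he hd).Piece n) r
    ((offDiagFiltration he hd).cls x)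

theorem exists_of_eq_grOf {n : ℕ} (x : (offDiagFiltration he hd).Piece n) :
    ∃ y : offDiagPow k e n, DirectSum.of (offDiagFiltration he hd).Piece n x = grOf he hd n y := by
  obtain ⟨y, rfl⟩ := (offDiagFiltration he hd).cls_surjective x
  exact ⟨y, rfl⟩

theorem grOf_eq_grOf_iff (n : ℕ) (x y : offDiagPow k e n) :
    grOf he hd n x = grOf he hd n y ↔ (x : A) - y ∈ offDiagPow k e (n + 1) :=
  (DirectSum.of_injective n).eq_iff.trans ((offDiagFiltration he hd).cls_eq_cls x y)

theorem grOf_eq_zero_iff (n : ℕ) (x : offDiagPow k e n) :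
    grOf he hd n x = 0 ↔ (x : A) ∈ offDiagPow k e (n + 1) := by
  have h := grOf_eq_grOf_iff he hd n x 0
  have h0 : grOf he hd n 0 = 0 := map_zero (DirectSum.of (offDiagFiltration he hd).Piece n)
  rwa [h0, Submodule.coe_zero, sub_zero] at h

theorem grOf_congr {m n : ℕ} (h : m = n) (x : offDiagPow k e m) (y : offDiagPow k e n)
    (hxy : (x : A) = y) : grOf he hd m x = grOf he hd n y := by
  subst h
  rw [Subtype.ext hxy]

theorem grOf_sum {ι : Type*} (s : Finset ι) (n : ℕ) (x : ι → offDiagPow k e n) :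
    grOf he hd n (∑ i ∈ s, x i) = ∑ i ∈ s, grOf he hd n (x i) :=
  map_sum (AddMonoidHom.mk' (grOf he hd n) (grOf_add he hd n)) x s

theorem grOf_mul_grOf {i j : ℕ} (x : offDiagPow k e i) (y : offDiagPow k e j) :
    grOf he hd i x * grOf he hd j y =
      grOf he hd (i + j) ⟨x.1 * y.1, (offDiagFiltration he hd).mul_mem x.2 y.2⟩ :=
  DirectSum.of_mul_of _ _

theorem grIdem_eq (l : Λ) : grIdem he hd l = grOf he hd 0 ⟨e l, Submodule.mem_top⟩ := rfl

theorem grIdem_mul_grOf (l : Λ) (n : ℕ) (x : offDiagPow k e n) :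
    grIdem he hd l * grOf he hd n x = grOf he hd n ⟨e l * x, offDiagPow_mul_mem he hd _ n x.2⟩ := by
  rw [grIdem_eq, grOf_mul_grOf]
  exact grOf_congr he hd (zero_add n) _ _ rfl

theorem grOf_mul_grIdem (l : Λ) (n : ℕ) (x : offDiagPow k e n) :
    grOf he hd n x * grIdem he hd l = grOf he hd n ⟨x * e l, mem_offDiagPow_mul he hd _ n x.2⟩ := by
  rw [grIdem_eq, grOf_mul_grOf]
  rfl

theorem grOf_mem_corner {l p : Λ} {n : ℕ} {x : offDiagPow k e n} (h1 : e p * x.1 = x.1)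
    (h2 : x.1 * e l = x.1) : grOf he hd n x ∈ corner k (grIdem he hd) l p := by
  refine (mem_corner_iff (grIdem_idem he hd)).2 ⟨?_, ?_⟩
  · rw [grIdem_mul_grOf]
    exact grOf_congr he hd rfl _ _ h1
  · rw [grOf_mul_grIdem]
    exact grOf_congr he hd rfl _ _ h2

/-- The part of degree at least `n` of the graded algebra. -/
def grGe (n : ℕ) : Submodule k (offDiagFiltration he hd).Gr :=
  ⨆ (j : ℕ) (_ : n ≤ j), LinearMap.range (DirectSum.lof k ℕ (offDiagFiltration he hd).Piece j)

theorem grGe_le_iff {n : ℕ} {S : Submodule k (offDiagFiltration he hd).Gr} :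
    grGe he hd n ≤ S ↔ ∀ j, n ≤ j → ∀ x : offDiagPow k e j, grOf he hd j x ∈ S := by
  unfold grGe
  simp only [iSup_le_iff]
  refine forall_congr' fun j => forall_congr' fun _ => ⟨fun h x => h ⟨_, rfl⟩, ?_⟩
  rintro h _ ⟨x, rfl⟩
  obtain ⟨x, rfl⟩ := (offDiagFiltration he hd).cls_surjective x
  exact h x

theorem grOf_mem_grGe {n j : ℕ} (h : n ≤ j) (x : offDiagPow k e j) :
    grOf he hd j x ∈ grGe he hd n :=
  (grGe_le_iff he hd).1 le_rfl j h x

theorem mem_grGe_zero (z : (offDiagFiltration he hd).Gr) : z ∈ grGe he hd 0 := by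
  induction z using DirectSum.induction_on with
  | zero => exact Submodule.zero_mem _
  | of i x =>
    obtain ⟨x, hx⟩ := exists_of_eq_grOf he hd x
    rw [hx]
    exact grOf_mem_grGe he hd (Nat.zero_le i) x
  | add x y hx hy => exact Submodule.add_mem _ hx hy

theorem grGe_mul_mem {i j : ℕ} {s t : (offDiagFiltration he hd).Gr} (hs : s ∈ grGe he hd i)
    (ht : t ∈ grGe he hd j) : s * t ∈ grGe he hd (i + j) := by
  have h1 : ∀ (m : ℕ), i ≤ m → ∀ x : offDiagPow k e m,
      grGe he hd j ≤ (grGe he hd (i + j)).comap (LinearMap.mulLeft k (grOf he hd m x)) := by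
    intro m hm x
    refine (grGe_le_iff he hd).2 fun n hn y => ?_
    change grOf he hd m x * grOf he hd n y ∈ grGe he hd (i + j)
    rw [grOf_mul_grOf]
    exact grOf_mem_grGe he hd (by omega) _
  have h2 : grGe he hd i ≤ (grGe he hd (i + j)).comap (LinearMap.mulRight k t) :=
    (grGe_le_iff he hd).2 fun m hm x => by
      have := h1 m hm x ht
      exact this
  exact h2 hs

theorem apply_eq_zero_of_mem_grGe {n j : ℕ} (h : j < n) {z : (offDiagFiltration he hd).Gr}
    (hz : z ∈ grGe he hd n) : z j = 0 := by
  have : grGe he hd n ≤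
      LinearMap.ker (DirectSum.component k ℕ (offDiagFiltration he hd).Piece j) := by
    refine (grGe_le_iff he hd).2 fun m hm x => ?_
    exact DirectSum.of_eq_of_ne _ _ _ (by omega)
  exact this hz

theorem mem_of_grOf_mem_grGe {n : ℕ} {x : offDiagPow k e n}
    (h : grOf he hd n x ∈ grGe he hd (n + 1)) : (x : A) ∈ offDiagPow k e (n + 1) := by
  have h1 := apply_eq_zero_of_mem_grGe he hd (Nat.lt_succ_self n) h
  unfold grOf at h1
  rw [DirectSum.of_eq_same] at h1
  rw [← grOf_eq_zero_iff he hd, grOf, h1, map_zero]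

theorem eq_zero_of_forall_mem_grGe {z : (offDiagFiltration he hd).Gr}
    (h : ∀ n, z ∈ grGe he hd n) : z = 0 :=
  DFinsupp.ext fun j => apply_eq_zero_of_mem_grGe he hd (Nat.lt_succ_self j) (h (j + 1))

/-- The term of lowest degree of `z`, lifted to `A`; multiplying the lift by `e p` and `e l` puts it
in the corner without changing its class. -/
theorem exists_grOf_sub_mem {l p : Λ} {n : ℕ} {z : (offDiagFiltration he hd).Gr}
    (hz : z ∈ corner k (grIdem he hd) l p) (hn : z ∈ grGe he hd n) :
    ∃ x : offDiagPow k e n, e p * x.1 = x.1 ∧ x.1 * e l = x.1 ∧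
      z - grOf he hd n x ∈ grGe he hd (n + 1) := by
  have h1 : ∃ x : offDiagPow k e n, z - grOf he hd n x ∈ grGe he hd (n + 1) := by
    let S : Submodule k (offDiagFiltration he hd).Gr :=
      LinearMap.range (DirectSum.lof k ℕ (offDiagFiltration he hd).Piece n) ⊔ grGe he hd (n + 1)
    have hS : grGe he hd n ≤ S := by
      refine (grGe_le_iff he hd).2 fun j hj x => ?_
      rcases hj.eq_or_lt with rfl | hj
      · exact Submodule.mem_sup_left ⟨_, rfl⟩
      · exact Submodule.mem_sup_right (grOf_mem_grGe he hd hj x)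
    obtain ⟨_, ⟨x, rfl⟩, t, ht, rfl⟩ := Submodule.mem_sup.1 (hS hn)
    obtain ⟨x, rfl⟩ := (offDiagFiltration he hd).cls_surjective x
    refine ⟨x, ?_⟩
    convert ht using 1
    exact add_sub_cancel_left _ _
  obtain ⟨x, hx⟩ := h1
  obtain ⟨hz1, hz2⟩ := (mem_corner_iff (grIdem_idem he hd)).1 hz
  refine ⟨⟨e p * x.1 * e l, mem_offDiagPow_mul he hd _ n (offDiagPow_mul_mem he hd _ n x.2)⟩,
    ?_, ?_, ?_⟩
  · simp only [← mul_assoc, (he.idem p).eq]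
  · simp only [mul_assoc, (he.idem l).eq]
  · have h2 := grGe_mul_mem he hd (grGe_mul_mem he hd (mem_grGe_zero he hd (grIdem he hd p)) hx)
      (mem_grGe_zero he hd (grIdem he hd l))
    rw [zero_add, add_zero] at h2
    convert h2 using 1
    rw [mul_sub, sub_mul, hz1, hz2, grIdem_mul_grOf, grOf_mul_grIdem]

theorem corner_grIdem_le {l p : Λ} {S : Submodule k (offDiagFiltration he hd).Gr}
    (h : ∀ (n : ℕ) (x : offDiagPow k e n), e p * x.1 = x.1 → x.1 * e l = x.1 →
      grOf he hd n x ∈ S) : corner k (grIdem he hd) l p ≤ S := by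
  rintro _ ⟨a, rfl⟩
  change grIdem he hd p * (a * grIdem he hd l) ∈ S
  induction a using DirectSum.induction_on with
  | zero => rw [zero_mul, mul_zero]; exact S.zero_mem
  | of i x =>
    obtain ⟨x, hx⟩ := exists_of_eq_grOf he hd x
    rw [hx, grOf_mul_grIdem, grIdem_mul_grOf]
    refine h i _ ?_ ?_
    · simp only [← mul_assoc, (he.idem p).eq]
    · simp only [mul_assoc, (he.idem l).eq]
  | add x y hx hy => rw [add_mul, mul_add]; exact S.add_mem hx hy

theorem grOf_zero_eq_zero {l p : Λ} (h : l ≠ p) {x : offDiagPow k e 0} (h1 : e p * x.1 = x.1)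
    (h2 : x.1 * e l = x.1) : grOf he hd 0 x = 0 := by
  rw [grOf_eq_zero_iff]
  change x.1 ∈ offDiagPow k e 1
  rw [offDiagPow_one]
  exact mem_offDiag_of_ne h he h1 h2

theorem corner_le_grGe_one {l p : Λ} (h : l ≠ p) :
    corner k (grIdem he hd) l p ≤ grGe he hd 1 := by
  refine corner_grIdem_le he hd fun n x h1 h2 => ?_
  cases n with
  | zero =>
    rw [grOf_zero_eq_zero he hd h h1 h2]
    exact Submodule.zero_mem _
  | succ n => exact grOf_mem_grGe he hd (by omega) x

/-- The diagonal corners of the graded algebra are concentrated in degree zero. -/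
theorem exists_eq_grOf_zero {l : Λ} {z : (offDiagFiltration he hd).Gr}
    (hz : z ∈ corner k (grIdem he hd) l l) :
    ∃ x : offDiagPow k e 0, e l * x.1 = x.1 ∧ x.1 * e l = x.1 ∧ z = grOf he hd 0 x := by
  obtain ⟨x, h1, h2, -⟩ := exists_grOf_sub_mem he hd hz (mem_grGe_zero he hd z)
  let S : Submodule k (offDiagFiltration he hd).Gr :=
    { carrier := {z | ∃ x : offDiagPow k e 0, e l * x.1 = x.1 ∧ x.1 * e l = x.1 ∧
        z = grOf he hd 0 x}
      zero_mem' := ⟨0, by simp, by simp,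
        ((grOf_eq_zero_iff he hd 0 0).2 (Submodule.zero_mem _)).symm⟩
      add_mem' := by
        rintro _ _ ⟨x, h1, h2, rfl⟩ ⟨y, h3, h4, rfl⟩
        exact ⟨x + y, by rw [Submodule.coe_add, mul_add, h1, h3],
          by rw [Submodule.coe_add, add_mul, h2, h4], (grOf_add he hd 0 x y).symm⟩
      smul_mem' := by
        rintro r _ ⟨x, h1, h2, rfl⟩
        exact ⟨r • x, by rw [Submodule.coe_smul, mul_smul_comm, h1],
          by rw [Submodule.coe_smul, smul_mul_assoc, h2], (grOf_smul he hd 0 r x).symm⟩ }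
  have hS : corner k (grIdem he hd) l l ≤ S := by
    refine corner_grIdem_le he hd fun n x h1 h2 => ?_
    cases n with
    | zero => exact ⟨x, h1, h2, rfl⟩
    | succ n =>
      rw [(grOf_eq_zero_iff he hd (n + 1) x).2 (by
        rw [eq_zero_of_mem_offDiagPow_succ he hd x.2 h1 h2]; exact Submodule.zero_mem _)]
      exact S.zero_mem
  exact hS hz

/-- A linear splitting of the filtration by the powers of `J`. -/
theorem exists_splitting : ∃ S : (offDiagFiltration he hd).Gr →ₗ[k] A,
    (∀ (n : ℕ) (x : offDiagPow k e n), S (grOf he hd n x) - x ∈ offDiagPow k e (n + 1)) ∧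
    ∀ n, ∀ z ∈ grGe he hd n, S z ∈ offDiagPow k e n := by
  let π : ∀ n, offDiagPow k e n →ₗ[k] (offDiagFiltration he hd).Piece n := fun n =>
    Submodule.mkQ (((offDiagFiltration he hd).step (n + 1)).submoduleOf
      ((offDiagFiltration he hd).step n))
  have hπ : ∀ n x, π n x = (offDiagFiltration he hd).cls x := fun n x => rfl
  choose σ hσ using fun n => (π n).exists_rightInverse_of_surjective
    (LinearMap.range_eq_top.2 fun x => (offDiagFiltration he hd).cls_surjective x)
  have hσ' : ∀ (n : ℕ) (x : offDiagPow k e n),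
      (σ n ((offDiagFiltration he hd).cls x) : A) - x ∈ offDiagPow k e (n + 1) := fun n x => by
    refine ((offDiagFiltration he hd).cls_eq_cls _ _).1 ?_
    rw [← hπ]
    exact LinearMap.congr_fun (hσ n) _
  let S : (offDiagFiltration he hd).Gr →ₗ[k] A :=
    DirectSum.toModule k ℕ A fun n => (offDiagPow k e n).subtype.comp (σ n)
  have hS : ∀ (n : ℕ) (x : offDiagPow k e n),
      S (grOf he hd n x) = σ n ((offDiagFiltration he hd).cls x) := fun n x =>
    DirectSum.toModule_lof k n _
  refine ⟨S, fun n x => by rw [hS]; exact hσ' n x, fun n => ?_⟩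
  have : grGe he hd n ≤ (offDiagPow k e n).comap S := by
    refine (grGe_le_iff he hd).2 fun j hj x => ?_
    change S (grOf he hd j x) ∈ offDiagPow k e n
    rw [hS]
    exact offDiagPow_antitone he hd hj (σ j _).2
  exact this

/-- The corners of `A` and of its associated graded algebra are isomorphic vector spaces. -/
theorem nonempty_corner_equiv [FiniteDimensional k A] (d : DirectedStructure k e) (l p : Λ) :
    Nonempty (corner k (grIdem he hd) l p ≃ₗ[k] corner k e l p) := by
  obtain ⟨S, hS1, hS2⟩ := exists_splitting he hd
  -- The isomorphism is the splitting followed by compression to the corner. It preserves leading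
  -- terms, which gives both injectivity and surjectivity.
  let P : A →ₗ[k] A := (LinearMap.mulLeft k (e p)).comp (LinearMap.mulRight k (e l))
  have hP : ∀ n, ∀ a ∈ offDiagPow k e n, P a ∈ offDiagPow k e n := fun n a ha =>
    offDiagPow_mul_mem he hd _ n (mem_offDiagPow_mul he hd _ n ha)
  have hP1 : ∀ a, e p * a = a → a * e l = a → P a = a := fun a h1 h2 => by
    change e p * (a * e l) = a
    rw [h2, h1]
  let f : corner k (grIdem he hd) l p →ₗ[k] corner k e l p :=
    ((P.comp S).comp (corner k (grIdem he hd) l p).subtype).codRestrict _ fun z => ⟨S z, rfl⟩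
  have hf : ∀ z, (f z : A) = P (S z) := fun z => rfl
  have hkey : ∀ (n : ℕ) (x : offDiagPow k e n), e p * x.1 = x.1 → x.1 * e l = x.1 →
      P (S (grOf he hd n x)) - x ∈ offDiagPow k e (n + 1) := by
    intro n x h1 h2
    have := hP _ _ (hS1 n x)
    rwa [map_sub, hP1 _ h1 h2] at this
  refine ⟨LinearEquiv.ofBijective f ⟨?_, ?_⟩⟩
  · rw [injective_iff_map_eq_zero]
    rintro ⟨z, hz⟩ h0
    have h0' : P (S z) = 0 := congrArg Subtype.val h0
    -- The lowest term of an element of the kernel vanishes, so the element lies in ever higher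
    -- degrees.
    refine Subtype.ext (eq_zero_of_forall_mem_grGe he hd fun n => ?_)
    change z ∈ _
    induction n with
    | zero => exact mem_grGe_zero he hd z
    | succ n ih =>
      obtain ⟨x, h1, h2, h3⟩ := exists_grOf_sub_mem he hd hz ih
      have h4 := hP _ _ (hS2 _ _ h3)
      rw [map_sub, map_sub, h0', zero_sub] at h4
      have h5 := Submodule.add_mem _ h4 (hkey n x h1 h2)
      rw [neg_add_eq_sub, sub_sub_cancel_left, neg_mem_iff] at h5
      rwa [(grOf_eq_zero_iff he hd n x).2 h5, sub_zero] at h3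
  · obtain ⟨N, hN⟩ := d.exists_offDiagPow_eq_bot
    -- Descending induction on `n`, starting at `N + 1` where the power of `J` is zero: subtracting
    -- the image of the leading term moves `a` one power deeper.
    have key : ∀ j n, n + j = N + 1 → ∀ a ∈ offDiagPow k e n, e p * a = a → a * e l = a →
        ∃ z, (f z : A) = a := by
      intro j
      induction j with
      | zero =>
        intro n hn a ha _ _
        rw [show n = N + 1 by omega, hN, Submodule.mem_bot] at ha
        exact ⟨0, by rw [map_zero, ha]; rfl⟩
      | succ j ih =>
        intro n hn a ha h1 h2
        obtain ⟨z, hz⟩ := ih (n + 1) (by omega) (a - P (S (grOf he hd n ⟨a, ha⟩))) (by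
            rw [← neg_sub]
            exact Submodule.neg_mem _ (hkey n ⟨a, ha⟩ h1 h2))
          (by
            change e p * (a - e p * _) = a - e p * _
            rw [mul_sub, h1, ← mul_assoc, (he.idem p).eq])
          (by
            change (a - e p * (_ * e l)) * e l = a - e p * (_ * e l)
            rw [sub_mul, h2, mul_assoc, mul_assoc, (he.idem l).eq])
        refine ⟨z + ⟨grOf he hd n ⟨a, ha⟩, grOf_mem_corner he hd h1 h2⟩, ?_⟩
        rw [map_add, Submodule.coe_add, hz, hf, sub_add_cancel]
    rintro ⟨a, ha⟩
    obtain ⟨h1, h2⟩ := (mem_corner_iff he.idem).1 ha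
    obtain ⟨z, hz⟩ := key (N + 1) 0 (zero_add _) a Submodule.mem_top h1 h2
    exact ⟨z, Subtype.ext hz⟩

end Graded

/-! ### Freeness of `A` and of its associated graded algebra -/

/-! ### Dimension counts for families of generators. -/

section Finrank

variable {k : Type uk} [Field k] {G : Type u} [AddCommGroup G] [Module k G] {ι : Type*} [Fintype ι]
  (U : ι → Submodule k G) (W : Submodule k G) (T : ι → G →ₗ[k] G)

/-- The map `(u_i) ↦ ∑ T_i u_i`. -/
def sumMap (hT : ∀ i, ∀ u ∈ U i, T i u ∈ W) : (∀ i, U i) →ₗ[k] W :=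
  (∑ i, ((T i).comp (U i).subtype).comp (LinearMap.proj i)).codRestrict W fun u => by
    rw [LinearMap.sum_apply]
    exact W.sum_mem fun i _ => hT i _ (u i).2

theorem coe_sumMap (hT : ∀ i, ∀ u ∈ U i, T i u ∈ W) (u : ∀ i, U i) :
    (sumMap U W T hT u : G) = ∑ i, T i (u i) := by
  simp [sumMap, LinearMap.sum_apply]

variable [∀ i, FiniteDimensional k (U i)]

theorem sum_finrank_eq (hT : ∀ i, ∀ u ∈ U i, T i u ∈ W)
    (hgen : ∀ w ∈ W, ∃ u : ι → G, (∀ i, u i ∈ U i) ∧ w = ∑ i, T i (u i))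
    (hind : ∀ u : ι → G, (∀ i, u i ∈ U i) → ∑ i, T i (u i) = 0 → ∀ i, u i = 0) :
    ∑ i, Module.finrank k (U i) = Module.finrank k W := by
  rw [← Module.finrank_pi_fintype]
  refine LinearEquiv.finrank_eq (LinearEquiv.ofBijective (sumMap U W T hT) ⟨?_, ?_⟩)
  · rw [injective_iff_map_eq_zero]
    intro u hu
    have := hind (fun i => u i) (fun i => (u i).2) (by rw [← coe_sumMap U W T hT, hu]; rfl)
    exact funext fun i => Subtype.ext (this i)
  · rintro ⟨w, hw⟩
    obtain ⟨u, hu, rfl⟩ := hgen w hw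
    exact ⟨fun i => ⟨u i, hu i⟩, Subtype.ext (coe_sumMap U W T hT _)⟩

/-- A surjection between spaces of equal finite dimension is injective. Together with
`sum_finrank_eq` this transfers independence between `A` and the graded algebra, where only
generation can be transferred directly. -/
theorem eq_zero_of_sum_finrank_eq [FiniteDimensional k W] (hT : ∀ i, ∀ u ∈ U i, T i u ∈ W)
    (hgen : ∀ w ∈ W, ∃ u : ι → G, (∀ i, u i ∈ U i) ∧ w = ∑ i, T i (u i))
    (hfin : ∑ i, Module.finrank k (U i) = Module.finrank k W) (u : ι → G) (hu : ∀ i, u i ∈ U i)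
    (h0 : ∑ i, T i (u i) = 0) (i : ι) : u i = 0 := by
  rw [← Module.finrank_pi_fintype] at hfin
  have hsurj : Function.Surjective (sumMap U W T hT) := by
    rintro ⟨w, hw⟩
    obtain ⟨u, hu, rfl⟩ := hgen w hw
    exact ⟨fun i => ⟨u i, hu i⟩, Subtype.ext (coe_sumMap U W T hT _)⟩
  have hinj := (LinearMap.injective_iff_surjective_of_finrank_eq_finrank hfin).2 hsurj
  have h1 : (fun i => (⟨u i, hu i⟩ : U i)) = 0 := by
    refine hinj ?_
    rw [map_zero]
    exact Subtype.ext ((coe_sumMap U W T hT _).trans h0)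
  exact congrArg Subtype.val (congrFun h1 i)

end Finrank

namespace DirectedStructure

variable {k : Type uk} [Field k] {A : Type u} [Ring A] [Algebra k A] {Λ : Type w} [Fintype Λ]
  {e : Λ → A} [FiniteDimensional k A]

theorem corner_mul_mem {G : Type u} [Ring G] [Algebra k G] {ε : Λ → G}
    (hε : ∀ l, IsIdempotentElem (ε l)) {l m p : Λ} {s x : G} (hs : s ∈ corner k ε m p)
    (hx : x ∈ corner k ε l m) : s * x ∈ corner k ε l p := by
  obtain ⟨h1, -⟩ := (mem_corner_iff hε).1 hs
  obtain ⟨-, h2⟩ := (mem_corner_iff hε).1 hx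
  exact (mem_corner_iff hε).2 ⟨by rw [← mul_assoc, h1], by rw [mul_assoc, h2]⟩

theorem corner_eq_bot (d : DirectedStructure k e) {l p : Λ} (h : d.lt l p) :
    corner k e p l = ⊥ := by
  refine (Submodule.eq_bot_iff _).2 fun z hz => ?_
  obtain ⟨h1, h2⟩ := (mem_corner_iff d.idem.idem).1 hz
  exact d.eq_zero (fun h' => d.irrefl _ (h' ▸ h)) (fun h' => d.irrefl _ (d.trans h h')) h1 h2

variable (he : CompleteOrthogonalIdempotents e) (hd : IsDirectedFamily k e)

theorem finrank_corner_grIdem (d : DirectedStructure k e) (l p : Λ) :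
    Module.finrank k (corner k (grIdem he hd) l p) = Module.finrank k (corner k e l p) :=
  (nonempty_corner_equiv he hd d l p).some.finrank_eq

theorem finiteDimensional_corner_grIdem (d : DirectedStructure k e) (l p : Λ) :
    FiniteDimensional k (corner k (grIdem he hd) l p) :=
  (nonempty_corner_equiv he hd d l p).some.symm.finiteDimensional

theorem corner_grIdem_eq_bot (d : DirectedStructure k e) {l p : Λ} (h : d.lt l p) : corner k (grIdem he hd) p l = ⊥ := by
  have := finiteDimensional_corner_grIdem he hd d p l
  have h1 := finrank_corner_grIdem he hd d p l
  rw [d.corner_eq_bot h, finrank_bot] at h1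
  exact Submodule.finrank_eq_zero.1 h1

theorem lt_of_corner_grIdem (d : DirectedStructure k e) {l p : Λ} (hne : l ≠ p) {z : (offDiagFiltration he hd).Gr}
    (hz : z ∈ corner k (grIdem he hd) l p) (h0 : z ≠ 0) : d.lt l p := by
  by_contra h
  have hb : corner k e l p = ⊥ := (Submodule.eq_bot_iff _).2 fun z hz => by
    obtain ⟨h1, h2⟩ := (mem_corner_iff d.idem.idem).1 hz
    exact d.eq_zero hne h h1 h2
  have := finiteDimensional_corner_grIdem he hd d l p
  have h1 := finrank_corner_grIdem he hd d l p
  rw [hb, finrank_bot] at h1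
  rw [Submodule.finrank_eq_zero.1 h1] at hz
  exact h0 ((Submodule.mem_bot k).1 hz)

theorem grIdem_ne_zero (d : DirectedStructure k e) (l : Λ) : grIdem he hd l ≠ 0 := fun h => by
  rw [grIdem_eq, grOf_eq_zero_iff] at h
  exact d.e_ne_zero l (eq_zero_of_mem_offDiagPow_succ he hd h (d.idem_mul l) (d.idem_mul l))

/-! #### The left side -/

theorem offDiagPow_succ_le_mul (n : ℕ) :
    offDiagPow k e (n + 1) ≤ offDiagPow k e n * offDiag k e := by
  cases n with
  | zero =>
    intro x hx
    rw [zero_add, offDiagPow_one] at hx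
    rw [← one_mul x]
    exact Submodule.mul_mem_mul Submodule.mem_top hx
  | succ n =>
    change offDiag k e ^ (n + 1 + 1) ≤ offDiag k e ^ (n + 1) * offDiag k e
    rw [pow_succ]

theorem exists_sum_of_mem_offDiag (he : CompleteOrthogonalIdempotents e) {ι : Type*} [Fintype ι]
    {l : Λ} {m : ι → Λ} {x : ι → A}
    (hgen : ∀ t a, t ≠ l → e t * a = a → a * e l = a →
      ∃ c : ι → A, (∀ i, c i * e (m i) = c i) ∧ a = ∑ i, c i * x i) {b : A}
    (hb : b ∈ offDiag k e) :
    ∃ c : ι → A, (∀ i, c i * e (m i) = c i) ∧ b * e l = ∑ i, c i * x i := by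
  have h : ∀ t, ∃ c : ι → A, (∀ i, c i * e (m i) = c i) ∧ e t * b * e l = ∑ i, c i * x i := by
    intro t
    by_cases ht : t = l
    · refine ⟨fun _ => 0, fun _ => zero_mul _, ?_⟩
      rw [ht, e_mul_offDiag_mul_e he hb]
      simp
    · exact hgen t _ ht (by simp only [← mul_assoc, (he.idem t).eq])
        (by simp only [mul_assoc, (he.idem l).eq])
  choose c hc1 hc2 using h
  refine ⟨fun i => ∑ t, c t i, fun i => by simp only [Finset.sum_mul, hc1], ?_⟩
  simp only [Finset.sum_mul]
  rw [Finset.sum_comm]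
  simp only [← hc2]
  rw [← Finset.sum_mul, ← Finset.sum_mul, he.complete, one_mul]

/-- If `A` is free on the left at `l`, then so is the associated graded algebra, with a basis in
degree one. -/
theorem exists_gr_left_basis (d : DirectedStructure k e) {l : Λ} (h : LeftFreeAt e l) :
    ∃ (ι : Type) (_ : Fintype ι) (m : ι → Λ) (x : ι → offDiagPow k e 1), (∀ i, d.lt l (m i)) ∧
      (∀ i, e (m i) * (x i).1 = x i) ∧ (∀ i, (x i).1 * e l = x i) ∧
      (∀ p, p ≠ l → ∀ z ∈ corner k (grIdem he hd) l p, ∃ s : ι → (offDiagFiltration he hd).Gr,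
        (∀ i, s i ∈ corner k (grIdem he hd) (m i) p) ∧ z = ∑ i, s i * grOf he hd 1 (x i)) ∧
      ∀ p, ∀ s : ι → (offDiagFiltration he hd).Gr,
        (∀ i, s i ∈ corner k (grIdem he hd) (m i) p) → ∑ i, s i * grOf he hd 1 (x i) = 0 →
        ∀ i, s i = 0 := by
  classical
  obtain ⟨ι, _, m, x, hm, hx1, hx2, hind, hgen⟩ := h
  have hlt : ∀ i, d.lt l (m i) := by
    intro i
    by_contra hn
    have h0 : x i = 0 := d.eq_zero (hm i).symm hn (hx1 i) (hx2 i)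
    have := hind (Pi.single i (e (m i))) (fun j => by
      by_cases hj : j = i
      · subst hj; rw [Pi.single_eq_same, d.idem_mul]
      · rw [Pi.single_eq_of_ne hj, zero_mul]) (Finset.sum_eq_zero fun j _ => by
      by_cases hj : j = i
      · subst hj; rw [h0, mul_zero]
      · rw [Pi.single_eq_of_ne hj, zero_mul]) i
    rw [Pi.single_eq_same] at this
    exact d.e_ne_zero _ this
  have hxJ : ∀ i, x i ∈ offDiagPow k e 1 := fun i => by
    rw [offDiagPow_one]
    exact mem_offDiag_of_ne (hm i).symm he (hx1 i) (hx2 i)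
  have hXc : ∀ i, grOf he hd 1 ⟨x i, hxJ i⟩ ∈ corner k (grIdem he hd) l (m i) := fun i =>
    grOf_mem_corner he hd (hx1 i) (hx2 i)
  -- An element of `J ^ (n + 1)` is a sum of products from `J ^ n` and `J`; expanding the last
  -- factor in the `x i` leaves coefficients in `J ^ n`, so the expansion is homogeneous.
  have hG : ∀ p, p ≠ l → ∀ z ∈ corner k (grIdem he hd) l p,
      ∃ s : ι → (offDiagFiltration he hd).Gr, (∀ i, s i ∈ corner k (grIdem he hd) (m i) p) ∧
        z = ∑ i, s i * grOf he hd 1 ⟨x i, hxJ i⟩ := by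
    intro p hp
    let S : Submodule k (offDiagFiltration he hd).Gr :=
      { carrier := {z | ∃ s : ι → (offDiagFiltration he hd).Gr,
          (∀ i, s i ∈ corner k (grIdem he hd) (m i) p) ∧
            z = ∑ i, s i * grOf he hd 1 ⟨x i, hxJ i⟩}
        zero_mem' := ⟨fun _ => 0, fun _ => Submodule.zero_mem _, by simp⟩
        add_mem' := by
          rintro _ _ ⟨s, hs, rfl⟩ ⟨t, ht, rfl⟩
          exact ⟨fun i => s i + t i, fun i => Submodule.add_mem _ (hs i) (ht i), by
            simp only [add_mul, Finset.sum_add_distrib]⟩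
        smul_mem' := by
          rintro r _ ⟨s, hs, rfl⟩
          exact ⟨fun i => r • s i, fun i => Submodule.smul_mem _ r (hs i), by
            simp only [smul_mul_assoc, Finset.smul_sum]⟩ }
    suffices hS : corner k (grIdem he hd) l p ≤ S from hS
    refine corner_grIdem_le he hd fun n z h1 h2 => ?_
    cases n with
    | zero =>
      rw [grOf_zero_eq_zero he hd hp.symm h1 h2]
      exact S.zero_mem
    | succ n =>
      have hdec : ∀ y ∈ offDiagPow k e n * offDiag k e, ∃ c : ι → A,
          (∀ i, c i ∈ offDiagPow k e n) ∧ (∀ i, c i * e (m i) = c i) ∧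
            y * e l = ∑ i, c i * x i := by
        intro y hy
        refine Submodule.mul_induction_on hy (fun a ha b hb => ?_) ?_
        · obtain ⟨c, hc1, hc2⟩ := exists_sum_of_mem_offDiag he hgen hb
          refine ⟨fun i => a * c i, fun i => mem_offDiagPow_mul he hd _ n ha,
            fun i => by rw [mul_assoc, hc1], ?_⟩
          simp only [mul_assoc, hc2, Finset.mul_sum]
        · rintro y y' ⟨c, hc1, hc2, hc3⟩ ⟨c', hc1', hc2', hc3'⟩
          exact ⟨fun i => c i + c' i, fun i => Submodule.add_mem _ (hc1 i) (hc1' i),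
            fun i => by rw [add_mul, hc2, hc2'], by
              simp only [add_mul, hc3, hc3', Finset.sum_add_distrib]⟩
      obtain ⟨c, hc1, hc2, hc3⟩ := hdec z.1 (offDiagPow_succ_le_mul n z.2)
      rw [h2] at hc3
      refine ⟨fun i => grOf he hd n ⟨e p * c i, offDiagPow_mul_mem he hd _ n (hc1 i)⟩,
        fun i => grOf_mem_corner he hd (by simp only [← mul_assoc, d.idem_mul])
          (by simp only [mul_assoc, hc2]), ?_⟩
      simp only [grOf_mul_grOf]
      rw [← grOf_sum]
      refine grOf_congr he hd rfl _ _ ?_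
      rw [Submodule.coe_sum]
      simp only [mul_assoc]
      rw [← Finset.mul_sum, ← hc3, h1]
  refine ⟨ι, inferInstance, m, fun i => ⟨x i, hxJ i⟩, hlt, hx1, hx2, hG, fun p s hs h0 => ?_⟩
  by_cases hp : p = l
  · intro i
    have := hs i
    rw [hp, corner_grIdem_eq_bot he hd d (hlt i)] at this
    exact (Submodule.mem_bot k).1 this
  · have hfd : ∀ l p, FiniteDimensional k (corner k (grIdem he hd) l p) :=
      finiteDimensional_corner_grIdem he hd d
    -- The dimensions add up in `A` because the `x i` are free there, hence also in the graded
    -- algebra, where the family is known to generate.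
    refine eq_zero_of_sum_finrank_eq (fun i => corner k (grIdem he hd) (m i) p)
      (corner k (grIdem he hd) l p) (fun i => LinearMap.mulRight k (grOf he hd 1 ⟨x i, hxJ i⟩))
      (fun i u hu => corner_mul_mem (grIdem_idem he hd) hu (hXc i)) (hG p hp) ?_ s hs h0
    simp only [finrank_corner_grIdem he hd d]
    refine sum_finrank_eq (fun i => corner k e (m i) p) (corner k e l p)
      (fun i => LinearMap.mulRight k (x i)) (fun i u hu => corner_mul_mem he.idem hu
        ((mem_corner_iff he.idem).2 ⟨hx1 i, hx2 i⟩)) (fun w hw => ?_) (fun u hu hu0 => ?_)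
    · obtain ⟨h1, h2⟩ := (mem_corner_iff he.idem).1 hw
      obtain ⟨c, hc, hwc⟩ := hgen p w hp h1 h2
      refine ⟨fun i => e p * c i, fun i => (mem_corner_iff he.idem).2
        ⟨by rw [← mul_assoc, d.idem_mul], by rw [mul_assoc, hc]⟩, ?_⟩
      simp only [LinearMap.mulRight_apply, mul_assoc]
      rw [← Finset.mul_sum, ← hwc, h1]
    · exact hind u (fun i => ((mem_corner_iff he.idem).1 (hu i)).2) hu0

/-- If the associated graded algebra is free on the left at `l`, then so is `A`. -/
theorem leftFreeAt_of_gr_basis (d : DirectedStructure k e) {l : Λ} {ι : Type*} [Fintype ι]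
    (m : ι → Λ) (X : ι → (offDiagFiltration he hd).Gr) (hm : ∀ i, m i ≠ l)
    (hX : ∀ i, X i ∈ corner k (grIdem he hd) l (m i))
    (hgen : ∀ p, p ≠ l → ∀ z ∈ corner k (grIdem he hd) l p,
      ∃ s : ι → (offDiagFiltration he hd).Gr,
        (∀ i, s i ∈ corner k (grIdem he hd) (m i) p) ∧ z = ∑ i, s i * X i)
    (hind : ∀ p, ∀ s : ι → (offDiagFiltration he hd).Gr,
      (∀ i, s i ∈ corner k (grIdem he hd) (m i) p) → ∑ i, s i * X i = 0 → ∀ i, s i = 0) :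
    LeftFreeAt e l := by
  classical
  -- The generators `X i` need not be homogeneous. They have no part of degree zero, and `x i` lifts
  -- the part of degree one.
  choose x hx1 hx2 hx3 using fun i =>
    exists_grOf_sub_mem he hd (hX i) (corner_le_grGe_one he hd (hm i).symm (hX i))
  have hlt : ∀ i, d.lt l (m i) := by
    intro i
    refine lt_of_corner_grIdem he hd d (hm i).symm (hX i) fun h0 => ?_
    have := hind (m i) (fun j => if j = i then grIdem he hd (m i) else 0) (fun j => by
      split_ifs with hj
      · subst hj
        exact (mem_corner_iff (grIdem_idem he hd)).2
          ⟨grIdem_idem he hd _, grIdem_idem he hd _⟩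
      · exact Submodule.zero_mem _) (Finset.sum_eq_zero fun j _ => by
      split_ifs with hj
      · subst hj; rw [h0, mul_zero]
      · rw [zero_mul]) i
    rw [if_pos rfl] at this
    exact grIdem_ne_zero he hd d _ this
  let Y : Submodule k A :=
    { carrier := {z | ∃ c : ι → A, (∀ i, c i * e (m i) = c i) ∧ z = ∑ i, c i * x i}
      zero_mem' := ⟨fun _ => 0, fun _ => zero_mul _, by simp⟩
      add_mem' := by
        rintro _ _ ⟨s, hs, rfl⟩ ⟨t, ht, rfl⟩
        exact ⟨fun i => s i + t i, fun i => by rw [add_mul, hs, ht], by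
          simp only [add_mul, Finset.sum_add_distrib]⟩
      smul_mem' := by
        rintro r _ ⟨s, hs, rfl⟩
        exact ⟨fun i => r • s i, fun i => by rw [smul_mul_assoc, hs], by
          simp only [smul_mul_assoc, Finset.smul_sum]⟩ }
  have hYmul : ∀ a, ∀ y ∈ Y, a * y ∈ Y := by
    rintro a _ ⟨c, hc, rfl⟩
    exact ⟨fun i => a * c i, fun i => by rw [mul_assoc, hc], by
      simp only [Finset.mul_sum, mul_assoc]⟩
  have hYe : ∀ y ∈ Y, y * e l = y := by
    rintro _ ⟨c, hc, rfl⟩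
    simp only [Finset.sum_mul, mul_assoc, hx2]
  -- In degree one only the degree zero parts of the coefficients and the degree one parts of the `X
  -- i` matter, so the `x i` generate modulo `J ^ 2`.
  have hbase : ∀ p, p ≠ l → ∀ a, e p * a = a → a * e l = a → a ∈ Y ⊔ offDiag k e ^ 2 := by
    intro p hp a h1 h2
    have haJ : a ∈ offDiagPow k e 1 := by
      rw [offDiagPow_one]; exact mem_offDiag_of_ne hp.symm he h1 h2
    obtain ⟨s, hs1, hs2⟩ := hgen p hp (grOf he hd 1 ⟨a, haJ⟩) (grOf_mem_corner he hd h1 h2)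
    choose c hc1 hc2 hc3 using fun i => exists_grOf_sub_mem he hd (hs1 i) (mem_grGe_zero he hd _)
    have h3 : ∀ i, s i * X i - grOf he hd 1 ⟨(c i).1 * (x i).1,
        offDiagPow_mul_mem he hd _ 1 (x i).2⟩ ∈ grGe he hd 2 := by
      intro i
      have h4 := grGe_mul_mem he hd (hc3 i) (corner_le_grGe_one he hd (hm i).symm (hX i))
      have h5 := grGe_mul_mem he hd (mem_grGe_zero he hd (grOf he hd 0 (c i))) (hx3 i)
      have h6 := Submodule.add_mem _ h4 h5
      rw [sub_mul, mul_sub, grOf_mul_grOf, sub_add_sub_cancel] at h6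
      exact h6
    have h4 := Submodule.sum_mem _ fun i (_ : i ∈ Finset.univ) => h3 i
    rw [Finset.sum_sub_distrib, ← hs2, ← grOf_sum] at h4
    have h5 : a - ∑ i, (c i).1 * (x i).1 ∈ offDiagPow k e 2 := by
      have h6 := mem_of_grOf_mem_grGe he hd (n := 1) (x := ⟨a, haJ⟩ - ∑ i, ⟨(c i).1 * (x i).1,
        offDiagPow_mul_mem he hd _ 1 (x i).2⟩) (by
          rw [sub_eq_add_neg, ← neg_one_smul k, grOf_add, grOf_smul, neg_one_smul,
            ← sub_eq_add_neg]
          exact h4)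
      rwa [Submodule.coe_sub, Submodule.coe_sum] at h6
    rw [← sub_add_cancel a (∑ i, (c i).1 * (x i).1)]
    exact Submodule.add_mem _ (Submodule.mem_sup_right h5)
      (Submodule.mem_sup_left ⟨fun i => (c i).1, hc2, rfl⟩)
  have hsplit : ∀ Z : Submodule k A,
      (∀ p, p ≠ l → ∀ a, e p * a = a → a * e l = a → a ∈ Z) →
      ∀ b ∈ offDiag k e, b * e l ∈ Z := by
    intro Z hZ b hb
    rw [← d.sum_mul (b * e l)]
    refine Submodule.sum_mem _ fun t _ => ?_
    by_cases ht : t = l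
    · rw [ht, ← mul_assoc, e_mul_offDiag_mul_e he hb]
      exact Z.zero_mem
    · exact hZ t ht _ (by rw [← mul_assoc, d.idem_mul]) (by rw [mul_assoc, mul_assoc, d.idem_mul])
  -- The error in `J ^ 2` is a sum of products whose last factor can be expanded again; since `J` is
  -- nilpotent, the error finally disappears.
  have hind' : ∀ n, ∀ b ∈ offDiag k e, b * e l ∈ Y ⊔ offDiag k e ^ (n + 2) := by
    intro n
    induction n with
    | zero => exact hsplit _ hbase
    | succ n ih =>
      intro b hb
      obtain ⟨y, hy, w, hw, hyw⟩ := Submodule.mem_sup.1 (hsplit _ hbase b hb)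
      have h1 : b * e l = y + w * e l := by
        rw [← hYe y hy, ← add_mul, hyw, mul_assoc, d.idem_mul]
      rw [h1]
      refine Submodule.add_mem _ (Submodule.mem_sup_left hy) ?_
      rw [pow_two] at hw
      refine Submodule.mul_induction_on hw (fun a ha c hc => ?_) fun u v hu hv => ?_
      · obtain ⟨y', hy', w', hw', h2⟩ := Submodule.mem_sup.1 (ih c hc)
        rw [mul_assoc, ← h2, mul_add]
        refine Submodule.add_mem _ (Submodule.mem_sup_left (hYmul a y' hy'))
          (Submodule.mem_sup_right ?_)
        rw [show n + 1 + 2 = n + 2 + 1 by omega, pow_succ']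
        exact Submodule.mul_mem_mul ha hw'
      · rw [add_mul]
        exact Submodule.add_mem _ hu hv
  obtain ⟨N, hN⟩ := d.exists_offDiagPow_eq_bot
  have hN' : offDiag k e ^ (N + 2) = ⊥ := by
    change offDiag k e ^ (N + 1) = ⊥ at hN
    rw [show N + 2 = N + 1 + 1 by omega, pow_succ, hN, Submodule.bot_mul]
  have hgenA : ∀ t a, t ≠ l → e t * a = a → a * e l = a →
      ∃ c : ι → A, (∀ i, c i * e (m i) = c i) ∧ a = ∑ i, c i * (x i).1 := by
    intro t a ht h1 h2
    have := hind' N a (mem_offDiag_of_ne ht.symm he h1 h2)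
    rwa [hN', sup_bot_eq, h2] at this
  refine leftFreeAt_of_fintype m (fun i => (x i).1) hm hx1 hx2 (fun a ha h0 i => ?_) hgenA
  have hcorner : ∀ p, ∀ i, e p * a i = 0 := by
    intro p
    have hac : ∀ i, e p * a i ∈ corner k e (m i) p := fun i => (mem_corner_iff he.idem).2
      ⟨by rw [← mul_assoc, d.idem_mul], by rw [mul_assoc, ha]⟩
    by_cases hp : p = l
    · intro i
      have := hac i
      rw [hp, d.corner_eq_bot (hlt i)] at this
      rw [hp]
      exact (Submodule.mem_bot k).1 this
    · have hfd : ∀ l p, FiniteDimensional k (corner k (grIdem he hd) l p) :=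
        finiteDimensional_corner_grIdem he hd d
      -- The same count in the other direction: the `X i` are free in the graded algebra, so the
      -- dimensions agree, and the `x i` generate.
      refine eq_zero_of_sum_finrank_eq (fun i => corner k e (m i) p)
        (corner k e l p) (fun i => LinearMap.mulRight k (x i).1)
        (fun i u hu => corner_mul_mem he.idem hu
          ((mem_corner_iff he.idem).2 ⟨hx1 i, hx2 i⟩)) (fun w hw => ?_) ?_ _ hac ?_
      · obtain ⟨h1, h2⟩ := (mem_corner_iff he.idem).1 hw
        obtain ⟨c, hc, hwc⟩ := hgenA p w hp h1 h2
        refine ⟨fun i => e p * c i, fun i => (mem_corner_iff he.idem).2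
          ⟨by rw [← mul_assoc, d.idem_mul], by rw [mul_assoc, hc]⟩, ?_⟩
        simp only [LinearMap.mulRight_apply, mul_assoc]
        rw [← Finset.mul_sum, ← hwc, h1]
      · simp only [← finrank_corner_grIdem he hd d]
        exact sum_finrank_eq (fun i => corner k (grIdem he hd) (m i) p)
          (corner k (grIdem he hd) l p) (fun i => LinearMap.mulRight k (X i))
          (fun i u hu => corner_mul_mem (grIdem_idem he hd) hu (hX i)) (hgen p hp) (hind p)
      · simp only [LinearMap.mulRight_apply, mul_assoc]
        rw [← Finset.mul_sum, h0, mul_zero]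
  rw [← d.sum_mul (a i)]
  exact Finset.sum_eq_zero fun p _ => hcorner p i

end DirectedStructure

/-! #### The right side -/

namespace DirectedStructure

variable {k : Type uk} [Field k] {A : Type u} [Ring A] [Algebra k A] {Λ : Type w} [Fintype Λ]
  {e : Λ → A} [FiniteDimensional k A]

theorem offDiagPow_succ_le_mul' (n : ℕ) :
    offDiagPow k e (n + 1) ≤ offDiag k e * offDiagPow k e n := by
  cases n with
  | zero =>
    intro x hx
    rw [zero_add, offDiagPow_one] at hx
    rw [← mul_one x]
    exact Submodule.mul_mem_mul hx Submodule.mem_top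
  | succ n =>
    change offDiag k e ^ (n + 1 + 1) ≤ offDiag k e * offDiag k e ^ (n + 1)
    rw [pow_succ']

theorem exists_sum_of_mem_offDiag' (he : CompleteOrthogonalIdempotents e) {ι : Type*} [Fintype ι]
    {p : Λ} {q : ι → Λ} {y : ι → A}
    (hgen : ∀ t a, t ≠ p → e p * a = a → a * e t = a →
      ∃ c : ι → A, (∀ i, e (q i) * c i = c i) ∧ a = ∑ i, y i * c i) {b : A}
    (hb : b ∈ offDiag k e) :
    ∃ c : ι → A, (∀ i, e (q i) * c i = c i) ∧ e p * b = ∑ i, y i * c i := by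
  have h : ∀ t, ∃ c : ι → A, (∀ i, e (q i) * c i = c i) ∧ e p * b * e t = ∑ i, y i * c i := by
    intro t
    by_cases ht : t = p
    · refine ⟨fun _ => 0, fun _ => mul_zero _, ?_⟩
      rw [ht, e_mul_offDiag_mul_e he hb]
      simp
    · exact hgen t _ ht (by simp only [← mul_assoc, (he.idem p).eq])
        (by simp only [mul_assoc, (he.idem t).eq])
  choose c hc1 hc2 using h
  refine ⟨fun i => ∑ t, c t i, fun i => by simp only [Finset.mul_sum, hc1], ?_⟩
  simp only [Finset.mul_sum]
  rw [Finset.sum_comm]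
  simp only [← hc2]
  rw [← Finset.mul_sum, he.complete, mul_one]

variable (he : CompleteOrthogonalIdempotents e) (hd : IsDirectedFamily k e)

/-- If `A` is free on the right at `p`, then so is the associated graded algebra, with a basis in
degree one. -/
theorem exists_gr_right_basis (d : DirectedStructure k e) {p : Λ} (h : RightFreeAt e p) :
    ∃ (ι : Type) (_ : Fintype ι) (q : ι → Λ) (y : ι → offDiagPow k e 1), (∀ i, d.lt (q i) p) ∧
      (∀ i, e p * (y i).1 = y i) ∧ (∀ i, (y i).1 * e (q i) = y i) ∧
      (∀ l, l ≠ p → ∀ z ∈ corner k (grIdem he hd) l p, ∃ s : ι → (offDiagFiltration he hd).Gr,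
        (∀ i, s i ∈ corner k (grIdem he hd) l (q i)) ∧ z = ∑ i, grOf he hd 1 (y i) * s i) ∧
      ∀ l, ∀ s : ι → (offDiagFiltration he hd).Gr,
        (∀ i, s i ∈ corner k (grIdem he hd) l (q i)) → ∑ i, grOf he hd 1 (y i) * s i = 0 →
        ∀ i, s i = 0 := by
  classical
  obtain ⟨ι, _, q, y, hq, hy1, hy2, hind, hgen⟩ := h
  have hlt : ∀ i, d.lt (q i) p := by
    intro i
    by_contra hn
    have h0 : y i = 0 := d.eq_zero (hq i) hn (hy1 i) (hy2 i)
    have := hind (Pi.single i (e (q i))) (fun j => by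
      by_cases hj : j = i
      · subst hj; rw [Pi.single_eq_same, d.idem_mul]
      · rw [Pi.single_eq_of_ne hj, mul_zero]) (Finset.sum_eq_zero fun j _ => by
      by_cases hj : j = i
      · subst hj; rw [h0, zero_mul]
      · rw [Pi.single_eq_of_ne hj, mul_zero]) i
    rw [Pi.single_eq_same] at this
    exact d.e_ne_zero _ this
  have hyJ : ∀ i, y i ∈ offDiagPow k e 1 := fun i => by
    rw [offDiagPow_one]
    exact mem_offDiag_of_ne (hq i) he (hy1 i) (hy2 i)
  have hYc : ∀ i, grOf he hd 1 ⟨y i, hyJ i⟩ ∈ corner k (grIdem he hd) (q i) p := fun i =>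
    grOf_mem_corner he hd (hy1 i) (hy2 i)
  have hG : ∀ l, l ≠ p → ∀ z ∈ corner k (grIdem he hd) l p,
      ∃ s : ι → (offDiagFiltration he hd).Gr, (∀ i, s i ∈ corner k (grIdem he hd) l (q i)) ∧
        z = ∑ i, grOf he hd 1 ⟨y i, hyJ i⟩ * s i := by
    intro l hl
    let S : Submodule k (offDiagFiltration he hd).Gr :=
      { carrier := {z | ∃ s : ι → (offDiagFiltration he hd).Gr,
          (∀ i, s i ∈ corner k (grIdem he hd) l (q i)) ∧
            z = ∑ i, grOf he hd 1 ⟨y i, hyJ i⟩ * s i}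
        zero_mem' := ⟨fun _ => 0, fun _ => Submodule.zero_mem _, by simp⟩
        add_mem' := by
          rintro _ _ ⟨s, hs, rfl⟩ ⟨t, ht, rfl⟩
          exact ⟨fun i => s i + t i, fun i => Submodule.add_mem _ (hs i) (ht i), by
            simp only [mul_add, Finset.sum_add_distrib]⟩
        smul_mem' := by
          rintro r _ ⟨s, hs, rfl⟩
          exact ⟨fun i => r • s i, fun i => Submodule.smul_mem _ r (hs i), by
            simp only [mul_smul_comm, Finset.smul_sum]⟩ }
    suffices hS : corner k (grIdem he hd) l p ≤ S from hS
    refine corner_grIdem_le he hd fun n z h1 h2 => ?_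
    cases n with
    | zero =>
      rw [grOf_zero_eq_zero he hd hl h1 h2]
      exact S.zero_mem
    | succ n =>
      have hdec : ∀ x ∈ offDiag k e * offDiagPow k e n, ∃ c : ι → A,
          (∀ i, c i ∈ offDiagPow k e n) ∧ (∀ i, e (q i) * c i = c i) ∧
            e p * x = ∑ i, y i * c i := by
        intro x hx
        refine Submodule.mul_induction_on hx (fun b hb a ha => ?_) ?_
        · obtain ⟨c, hc1, hc2⟩ := exists_sum_of_mem_offDiag' he hgen hb
          refine ⟨fun i => c i * a, fun i => offDiagPow_mul_mem he hd _ n ha,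
            fun i => by rw [← mul_assoc, hc1], ?_⟩
          simp only [← mul_assoc, hc2, Finset.sum_mul]
        · rintro x x' ⟨c, hc1, hc2, hc3⟩ ⟨c', hc1', hc2', hc3'⟩
          exact ⟨fun i => c i + c' i, fun i => Submodule.add_mem _ (hc1 i) (hc1' i),
            fun i => by rw [mul_add, hc2, hc2'], by
              simp only [mul_add, hc3, hc3', Finset.sum_add_distrib]⟩
      obtain ⟨c, hc1, hc2, hc3⟩ := hdec z.1 (offDiagPow_succ_le_mul' n z.2)
      rw [h1] at hc3
      refine ⟨fun i => grOf he hd n ⟨c i * e l, mem_offDiagPow_mul he hd _ n (hc1 i)⟩,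
        fun i => grOf_mem_corner he hd (by simp only [← mul_assoc, hc2])
          (by simp only [mul_assoc, d.idem_mul]), ?_⟩
      simp only [grOf_mul_grOf]
      rw [← grOf_sum]
      -- The factor of degree one now stands on the left, so the products appear in degree `1 + n`.
      refine grOf_congr he hd (add_comm n 1) _ _ ?_
      rw [Submodule.coe_sum]
      simp only [← mul_assoc]
      rw [← Finset.sum_mul, ← hc3, h2]
  refine ⟨ι, inferInstance, q, fun i => ⟨y i, hyJ i⟩, hlt, hy1, hy2, hG, fun l s hs h0 => ?_⟩
  by_cases hl : l = p
  · intro i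
    have := hs i
    rw [hl, corner_grIdem_eq_bot he hd d (hlt i)] at this
    exact (Submodule.mem_bot k).1 this
  · have hfd : ∀ l p, FiniteDimensional k (corner k (grIdem he hd) l p) :=
      finiteDimensional_corner_grIdem he hd d
    refine eq_zero_of_sum_finrank_eq (fun i => corner k (grIdem he hd) l (q i))
      (corner k (grIdem he hd) l p) (fun i => LinearMap.mulLeft k (grOf he hd 1 ⟨y i, hyJ i⟩))
      (fun i u hu => corner_mul_mem (grIdem_idem he hd) (hYc i) hu) (hG l hl) ?_ s hs h0
    simp only [finrank_corner_grIdem he hd d]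
    refine sum_finrank_eq (fun i => corner k e l (q i)) (corner k e l p)
      (fun i => LinearMap.mulLeft k (y i)) (fun i u hu => corner_mul_mem he.idem
        ((mem_corner_iff he.idem).2 ⟨hy1 i, hy2 i⟩) hu) (fun w hw => ?_) (fun u hu hu0 => ?_)
    · obtain ⟨h1, h2⟩ := (mem_corner_iff he.idem).1 hw
      obtain ⟨c, hc, hwc⟩ := hgen l w hl h1 h2
      refine ⟨fun i => c i * e l, fun i => (mem_corner_iff he.idem).2
        ⟨by rw [← mul_assoc, hc], by rw [mul_assoc, d.idem_mul]⟩, ?_⟩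
      simp only [LinearMap.mulLeft_apply, ← mul_assoc]
      rw [← Finset.sum_mul, ← hwc, h2]
    · exact hind u (fun i => ((mem_corner_iff he.idem).1 (hu i)).1) hu0

/-- If the associated graded algebra is free on the right at `p`, then so is `A`. -/
theorem rightFreeAt_of_gr_basis (d : DirectedStructure k e) {p : Λ} {ι : Type*} [Fintype ι]
    (q : ι → Λ) (Y : ι → (offDiagFiltration he hd).Gr) (hq : ∀ i, q i ≠ p)
    (hY : ∀ i, Y i ∈ corner k (grIdem he hd) (q i) p)
    (hgen : ∀ l, l ≠ p → ∀ z ∈ corner k (grIdem he hd) l p,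
      ∃ s : ι → (offDiagFiltration he hd).Gr,
        (∀ i, s i ∈ corner k (grIdem he hd) l (q i)) ∧ z = ∑ i, Y i * s i)
    (hind : ∀ l, ∀ s : ι → (offDiagFiltration he hd).Gr,
      (∀ i, s i ∈ corner k (grIdem he hd) l (q i)) → ∑ i, Y i * s i = 0 → ∀ i, s i = 0) :
    RightFreeAt e p := by
  classical
  -- As on the left, only the part of degree one of the possibly inhomogeneous `Y i` is kept.
  choose y hy1 hy2 hy3 using fun i =>
    exists_grOf_sub_mem he hd (hY i) (corner_le_grGe_one he hd (hq i) (hY i))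
  have hlt : ∀ i, d.lt (q i) p := by
    intro i
    refine lt_of_corner_grIdem he hd d (hq i) (hY i) fun h0 => ?_
    have := hind (q i) (fun j => if j = i then grIdem he hd (q i) else 0) (fun j => by
      split_ifs with hj
      · subst hj
        exact (mem_corner_iff (grIdem_idem he hd)).2
          ⟨grIdem_idem he hd _, grIdem_idem he hd _⟩
      · exact Submodule.zero_mem _) (Finset.sum_eq_zero fun j _ => by
      split_ifs with hj
      · subst hj; rw [h0, zero_mul]
      · rw [mul_zero]) i
    rw [if_pos rfl] at this
    exact grIdem_ne_zero he hd d _ this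
  let Z : Submodule k A :=
    { carrier := {z | ∃ c : ι → A, (∀ i, e (q i) * c i = c i) ∧ z = ∑ i, y i * c i}
      zero_mem' := ⟨fun _ => 0, fun _ => mul_zero _, by simp⟩
      add_mem' := by
        rintro _ _ ⟨s, hs, rfl⟩ ⟨t, ht, rfl⟩
        exact ⟨fun i => s i + t i, fun i => by rw [mul_add, hs, ht], by
          simp only [mul_add, Finset.sum_add_distrib]⟩
      smul_mem' := by
        rintro r _ ⟨s, hs, rfl⟩
        exact ⟨fun i => r • s i, fun i => by rw [mul_smul_comm, hs], by
          simp only [mul_smul_comm, Finset.smul_sum]⟩ }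
  have hZmul : ∀ a, ∀ z ∈ Z, z * a ∈ Z := by
    rintro a _ ⟨c, hc, rfl⟩
    exact ⟨fun i => c i * a, fun i => by rw [← mul_assoc, hc], by
      simp only [Finset.sum_mul, mul_assoc]⟩
  have hZe : ∀ z ∈ Z, e p * z = z := by
    rintro _ ⟨c, hc, rfl⟩
    simp only [Finset.mul_sum, ← mul_assoc, hy1]
  have hbase : ∀ l, l ≠ p → ∀ a, e p * a = a → a * e l = a → a ∈ Z ⊔ offDiag k e ^ 2 := by
    intro l hl a h1 h2
    have haJ : a ∈ offDiagPow k e 1 := by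
      rw [offDiagPow_one]; exact mem_offDiag_of_ne hl he h1 h2
    obtain ⟨s, hs1, hs2⟩ := hgen l hl (grOf he hd 1 ⟨a, haJ⟩) (grOf_mem_corner he hd h1 h2)
    choose c hc1 hc2 hc3 using fun i => exists_grOf_sub_mem he hd (hs1 i) (mem_grGe_zero he hd _)
    have h3 : ∀ i, Y i * s i - grOf he hd 1 ⟨(y i).1 * (c i).1,
        mem_offDiagPow_mul he hd _ 1 (y i).2⟩ ∈ grGe he hd 2 := by
      intro i
      have h4 := grGe_mul_mem he hd (corner_le_grGe_one he hd (hq i) (hY i)) (hc3 i)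
      have h5 := grGe_mul_mem he hd (hy3 i) (mem_grGe_zero he hd (grOf he hd 0 (c i)))
      have h6 := Submodule.add_mem _ h4 h5
      rw [sub_mul, mul_sub, grOf_mul_grOf, sub_add_sub_cancel] at h6
      exact h6
    have h4 := Submodule.sum_mem _ fun i (_ : i ∈ Finset.univ) => h3 i
    rw [Finset.sum_sub_distrib, ← hs2, ← grOf_sum] at h4
    have h5 : a - ∑ i, (y i).1 * (c i).1 ∈ offDiagPow k e 2 := by
      have h6 := mem_of_grOf_mem_grGe he hd (n := 1) (x := ⟨a, haJ⟩ - ∑ i, ⟨(y i).1 * (c i).1,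
        mem_offDiagPow_mul he hd _ 1 (y i).2⟩) (by
          rw [sub_eq_add_neg, ← neg_one_smul k, grOf_add, grOf_smul, neg_one_smul,
            ← sub_eq_add_neg]
          exact h4)
      rwa [Submodule.coe_sub, Submodule.coe_sum] at h6
    rw [← sub_add_cancel a (∑ i, (y i).1 * (c i).1)]
    exact Submodule.add_mem _ (Submodule.mem_sup_right h5)
      (Submodule.mem_sup_left ⟨fun i => (c i).1, hc1, rfl⟩)
  have hsplit : ∀ W : Submodule k A,
      (∀ l, l ≠ p → ∀ a, e p * a = a → a * e l = a → a ∈ W) →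
      ∀ b ∈ offDiag k e, e p * b ∈ W := by
    intro W hW b hb
    rw [← d.mul_sum (e p * b)]
    refine Submodule.sum_mem _ fun t _ => ?_
    by_cases ht : t = p
    · rw [ht, e_mul_offDiag_mul_e he hb]
      exact W.zero_mem
    · exact hW t ht _ (by simp only [← mul_assoc, d.idem_mul]) (by rw [mul_assoc, d.idem_mul])
  have hind' : ∀ n, ∀ b ∈ offDiag k e, e p * b ∈ Z ⊔ offDiag k e ^ (n + 2) := by
    intro n
    induction n with
    | zero => exact hsplit _ hbase
    | succ n ih =>
      intro b hb
      obtain ⟨z, hz, w, hw, hzw⟩ := Submodule.mem_sup.1 (hsplit _ hbase b hb)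
      have h1 : e p * b = z + e p * w := by
        rw [← hZe z hz, ← mul_add, hzw, ← mul_assoc, d.idem_mul]
      rw [h1]
      refine Submodule.add_mem _ (Submodule.mem_sup_left hz) ?_
      rw [pow_two] at hw
      refine Submodule.mul_induction_on hw (fun c hc a ha => ?_) fun u v hu hv => ?_
      · obtain ⟨y', hy', w', hw', h2⟩ := Submodule.mem_sup.1 (ih c hc)
        rw [← mul_assoc, ← h2, add_mul]
        refine Submodule.add_mem _ (Submodule.mem_sup_left (hZmul a y' hy'))
          (Submodule.mem_sup_right ?_)
        rw [show n + 1 + 2 = n + 2 + 1 by omega, pow_succ]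
        exact Submodule.mul_mem_mul hw' ha
      · rw [mul_add]
        exact Submodule.add_mem _ hu hv
  obtain ⟨N, hN⟩ := d.exists_offDiagPow_eq_bot
  have hN' : offDiag k e ^ (N + 2) = ⊥ := by
    change offDiag k e ^ (N + 1) = ⊥ at hN
    rw [show N + 2 = N + 1 + 1 by omega, pow_succ, hN, Submodule.bot_mul]
  have hgenA : ∀ t a, t ≠ p → e p * a = a → a * e t = a →
      ∃ c : ι → A, (∀ i, e (q i) * c i = c i) ∧ a = ∑ i, (y i).1 * c i := by
    intro t a ht h1 h2
    have := hind' N a (mem_offDiag_of_ne ht he h1 h2)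
    rwa [hN', sup_bot_eq, h1] at this
  refine rightFreeAt_of_fintype q (fun i => (y i).1) hq hy1 hy2 (fun a ha h0 i => ?_) hgenA
  have hcorner : ∀ l, ∀ i, a i * e l = 0 := by
    intro l
    have hac : ∀ i, a i * e l ∈ corner k e l (q i) := fun i => (mem_corner_iff he.idem).2
      ⟨by rw [← mul_assoc, ha], by rw [mul_assoc, d.idem_mul]⟩
    by_cases hl : l = p
    · intro i
      have := hac i
      rw [hl, d.corner_eq_bot (hlt i)] at this
      rw [hl]
      exact (Submodule.mem_bot k).1 this
    · have hfd : ∀ l p, FiniteDimensional k (corner k (grIdem he hd) l p) :=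
        finiteDimensional_corner_grIdem he hd d
      refine eq_zero_of_sum_finrank_eq (fun i => corner k e l (q i))
        (corner k e l p) (fun i => LinearMap.mulLeft k (y i).1)
        (fun i u hu => corner_mul_mem he.idem
          ((mem_corner_iff he.idem).2 ⟨hy1 i, hy2 i⟩) hu) (fun w hw => ?_) ?_ _ hac ?_
      · obtain ⟨h1, h2⟩ := (mem_corner_iff he.idem).1 hw
        obtain ⟨c, hc, hwc⟩ := hgenA l w hl h1 h2
        refine ⟨fun i => c i * e l, fun i => (mem_corner_iff he.idem).2
          ⟨by rw [← mul_assoc, hc], by rw [mul_assoc, d.idem_mul]⟩, ?_⟩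
        simp only [LinearMap.mulLeft_apply, ← mul_assoc]
        rw [← Finset.sum_mul, ← hwc, h2]
      · simp only [← finrank_corner_grIdem he hd d]
        exact sum_finrank_eq (fun i => corner k (grIdem he hd) l (q i))
          (corner k (grIdem he hd) l p) (fun i => LinearMap.mulLeft k (Y i))
          (fun i u hu => corner_mul_mem (grIdem_idem he hd) (hY i) hu) (hgen l hl) (hind l)
      · simp only [LinearMap.mulLeft_apply, ← mul_assoc]
        rw [← Finset.sum_mul, h0, zero_mul]
  rw [← d.mul_sum (a i)]
  exact Finset.sum_eq_zero fun l _ => hcorner l i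

end DirectedStructure

/-! ### Maps out of tensor products and free categories -/

section Balanced

variable (k : Type uk) [Field k] (B C : Type u) [Ring B] [Algebra k B] [Ring C] [Algebra k C]
  (M : Type u) [AddCommGroup M] [Module k M] [Module C M] [Module Bᵐᵒᵖ M] [IsScalarTower k C M]
  [IsScalarTower k Bᵐᵒᵖ M] [SMulCommClass C Bᵐᵒᵖ M]
  (N : Type u) [AddCommGroup N] [Module k N] [Module B N] [IsScalarTower k B N]

theorem btmul_op_smul (m : M) (b : B) (n : N) :
    btmul k B C M (MulOpposite.op b • m) n = btmul k B C M m (b • n) :=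
  (Submodule.Quotient.eq _).2 (Submodule.subset_span ⟨m, b, n, rfl⟩)

theorem add_btmul (m m' : M) (n : N) :
    btmul k B C M (m + m') n = btmul k B C M m n + btmul k B C M m' n := by
  simp [btmul, TensorProduct.add_tmul]

variable {M N} {P : Type*} [AddCommGroup P] [Module k P]

/-- A balanced map `M × N → P` induces a map `M ⊗_B N → P`. -/
def btLift (f : M →ₗ[k] N →ₗ[k] P)
    (hf : ∀ m (b : B) n, f (MulOpposite.op b • m) n = f m (b • n)) : BTensor k B C M N →ₗ[k] P :=
  (((balancedRel k B C M N).restrictScalars k).liftQ (TensorProduct.lift f) (by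
    intro t ht
    -- The relations are a span over `C` whereas `f` is only `k`-linear, so vanishing is proved for
    -- all multiples `c • t` at once.
    have key : ∀ c : C, TensorProduct.lift f (c • t) = 0 := by
      refine Submodule.span_induction (p := fun t _ => ∀ c : C, TensorProduct.lift f (c • t) = 0)
        ?_ ?_ ?_ ?_ ht
      · rintro _ ⟨m, b, n, rfl⟩ c
        rw [smul_sub, TensorProduct.smul_tmul', TensorProduct.smul_tmul', smul_comm, map_sub,
          TensorProduct.lift.tmul, TensorProduct.lift.tmul, hf, sub_self]
      · intro c
        rw [smul_zero, map_zero]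
      · intro x y _ _ hx hy c
        rw [smul_add, map_add, hx, hy, add_zero]
      · intro c' x _ hx c
        rw [smul_smul, hx]
    have := key 1
    rwa [one_smul] at this)).comp
  (Submodule.Quotient.restrictScalarsEquiv k (balancedRel k B C M N)).symm.toLinearMap

end Balanced

namespace BimoduleQuiver

variable {k : Type uk} [Field k] {V : Type w} [Quiver.{w} V] (Q : BimoduleQuiver.{uk, u, w} k V)

/-- An element of the bimodule on an arrow as a morphism. -/
def arrowElt {v w : V} (α : v ⟶ w) (m : Q.bim α) : Q.HomSpace v w :=
  Q.inj (Quiver.Path.nil.cons α) (Q.consElt Quiver.Path.nil α m (Q.nilElt v 1))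

/-- An element of the algebra at a vertex as a morphism. -/
def algElt (v : V) (a : Q.alg v) : Q.HomSpace v v := Q.inj Quiver.Path.nil (Q.nilElt v a)

theorem consElt_add {v b c : V} (p : Quiver.Path v b) (α : b ⟶ c) (m m' : Q.bim α)
    (x : Q.PathSpace p) : Q.consElt p α (m + m') x = Q.consElt p α m x + Q.consElt p α m' x :=
  add_btmul k (Q.alg b) (Q.alg c) (Q.bim α) (Q.PathSpace p) m m' x

theorem consElt_smul {v b c : V} (p : Quiver.Path v b) (α : b ⟶ c) (a : Q.alg c) (m : Q.bim α)
    (x : Q.PathSpace p) : Q.consElt p α (a • m) x = a • Q.consElt p α m x := rfl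

theorem consElt_op_smul {v b c : V} (p : Quiver.Path v b) (α : b ⟶ c) (a : Q.alg b) (m : Q.bim α)
    (x : Q.PathSpace p) : Q.consElt p α (MulOpposite.op a • m) x = Q.consElt p α m (a • x) :=
  btmul_op_smul k (Q.alg b) (Q.alg c) (Q.bim α) (Q.PathSpace p) m a x

theorem arrowElt_add {v w : V} (α : v ⟶ w) (m m' : Q.bim α) :
    Q.arrowElt α (m + m') = Q.arrowElt α m + Q.arrowElt α m' := by
  rw [arrowElt, consElt_add, map_add]
  rfl

theorem compBilin_inj_algElt {u v : V} (γ : Quiver.Path u v) (x : Q.PathSpace γ) (a : Q.alg v) :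
    Q.compBilin u v v (Q.inj γ x) (Q.algElt v a) = Q.inj γ (a • x) :=
  Q.compBilin_inj γ Quiver.Path.nil x (Q.nilElt v a)

theorem arrowMap_eq {u v w : V} (α : v ⟶ w) (m : Q.bim α) (f : Q.HomSpace u v) :
    Q.arrowMap α m f = Q.compBilin u v w f (Q.arrowElt α m) := by
  refine Q.homSpace_induction f ?_ (fun γ x => ?_) fun x y hx hy => ?_
  · rw [map_zero, map_zero, LinearMap.zero_apply]
  · rw [arrowMap_inj, arrowElt, compBilin_inj, pathMul_consElt, pathMul_nilElt, one_smul]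
    rfl
  · rw [map_add, map_add, LinearMap.add_apply, hx, hy]

theorem arrowElt_smul {v w : V} (α : v ⟶ w) (a : Q.alg w) (m : Q.bim α) :
    Q.arrowElt α (a • m) = Q.compBilin v w w (Q.arrowElt α m) (Q.algElt w a) := by
  rw [arrowElt, arrowElt, compBilin_inj_algElt, consElt_smul]

theorem arrowElt_op_smul {v w : V} (α : v ⟶ w) (a : Q.alg v) (m : Q.bim α) :
    Q.arrowElt α (MulOpposite.op a • m) = Q.compBilin v v w (Q.algElt v a) (Q.arrowElt α m) := by
  rw [← arrowMap_eq, algElt, arrowMap_inj, arrowElt, consElt_op_smul]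
  congr 2
  exact mul_one a

/-- A balanced map on the module of a path extended by an arrow. -/
def consLift {v b c : V} (γ : Quiver.Path v b) (α : b ⟶ c) {P : Type*} [AddCommGroup P]
    [Module k P] (f : Q.bim α →ₗ[k] Q.PathSpace γ →ₗ[k] P)
    (hf : ∀ m (a : Q.alg b) n, f (MulOpposite.op a • m) n = f m (a • n)) :
    Q.PathSpace (γ.cons α) →ₗ[k] P :=
  btLift k (Q.alg b) (Q.alg c) f hf

/-! #### Functors on a free category -/

/-- The data that determine a linear functor from the free category. -/
structure Rep (D : Type w) [Category.{u} D] [Preadditive D] [Linear k D] where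
  /-- The objects. -/
  obj : V → D
  /-- The action of the algebras. -/
  rho : ∀ v, Q.alg v →ₗ[k] (obj v ⟶ obj v)
  /-- The action of the bimodules. -/
  psi : ∀ {v w : V} (α : v ⟶ w), Q.bim α →ₗ[k] (obj v ⟶ obj w)
  rho_one : ∀ v, rho v 1 = 𝟙 (obj v)
  rho_mul : ∀ v a b, rho v (a * b) = rho v b ≫ rho v a
  psi_smul : ∀ {v w : V} (α : v ⟶ w) a m, psi α (a • m) = psi α m ≫ rho w a
  psi_op_smul : ∀ {v w : V} (α : v ⟶ w) a m, psi α (MulOpposite.op a • m) = rho v a ≫ psi α m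

namespace Rep

variable {Q} {D : Type w} [Category.{u} D] [Preadditive D] [Linear k D] (R : Q.Rep D)

/-- The functor on the module of a path extended by an arrow. -/
def consMap {v b c : V} (γ : Quiver.Path v b) (α : b ⟶ c)
    (φ : {φ : Q.PathSpace γ →ₗ[k] (R.obj v ⟶ R.obj b) // ∀ a x, φ (a • x) = φ x ≫ R.rho b a}) :
    Q.PathSpace (γ.cons α) →ₗ[k] (R.obj v ⟶ R.obj c) :=
  Q.consLift γ α
    (LinearMap.mk₂ k (fun m x => φ.1 x ≫ R.psi α m)
      (fun m m' x => by rw [map_add, Preadditive.comp_add])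
      (fun r m x => by rw [map_smul, Linear.comp_smul])
      (fun m x x' => by rw [map_add, Preadditive.add_comp])
      (fun r m x => by rw [map_smul, Linear.smul_comp]))
    (fun m b n => by
      rw [LinearMap.mk₂_apply, LinearMap.mk₂_apply, R.psi_op_smul, φ.2, Category.assoc])

theorem consMap_consElt {v b c : V} (γ : Quiver.Path v b) (α : b ⟶ c)
    (φ : {φ : Q.PathSpace γ →ₗ[k] (R.obj v ⟶ R.obj b) // ∀ a x, φ (a • x) = φ x ≫ R.rho b a})
    (m : Q.bim α) (x : Q.PathSpace γ) :
    R.consMap γ α φ (Q.consElt γ α m x) = φ.1 x ≫ R.psi α m := rfl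

theorem consMap_smul {v b c : V} (γ : Quiver.Path v b) (α : b ⟶ c)
    (φ : {φ : Q.PathSpace γ →ₗ[k] (R.obj v ⟶ R.obj b) // ∀ a x, φ (a • x) = φ x ≫ R.rho b a})
    (a : Q.alg c) (x : Q.PathSpace (γ.cons α)) :
    R.consMap γ α φ (a • x) = R.consMap γ α φ x ≫ R.rho c a := by
  refine Q.consElt_induction x ?_ (fun m n => ?_) fun s t hs ht => ?_
  · rw [smul_zero, map_zero, Limits.zero_comp]
  · rw [← consElt_smul, consMap_consElt, consMap_consElt, R.psi_smul, Category.assoc]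
  · rw [smul_add, map_add, map_add, hs, ht, Preadditive.add_comp]

/-- The functor on the module of a path, together with its linearity. -/
def pathLiftAux {v : V} : ∀ {w : V} (γ : Quiver.Path v w),
    {φ : Q.PathSpace γ →ₗ[k] (R.obj v ⟶ R.obj w) // ∀ a x, φ (a • x) = φ x ≫ R.rho w a}
  | _, .nil => ⟨R.rho v, fun a x => R.rho_mul v a x⟩
  | _, .cons γ α => ⟨R.consMap γ α (pathLiftAux γ), R.consMap_smul γ α (pathLiftAux γ)⟩

/-- The functor on the module of a path. -/
def pathLift {v w : V} (γ : Quiver.Path v w) : Q.PathSpace γ →ₗ[k] (R.obj v ⟶ R.obj w) :=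
  (R.pathLiftAux γ).1

theorem pathLift_smul {v w : V} (γ : Quiver.Path v w) (a : Q.alg w) (x : Q.PathSpace γ) :
    R.pathLift γ (a • x) = R.pathLift γ x ≫ R.rho w a :=
  (R.pathLiftAux γ).2 a x

theorem pathLift_nilElt (v : V) (a : Q.alg v) :
    R.pathLift Quiver.Path.nil (Q.nilElt v a) = R.rho v a := rfl

theorem pathLift_consElt {v b c : V} (γ : Quiver.Path v b) (α : b ⟶ c) (m : Q.bim α)
    (x : Q.PathSpace γ) :
    R.pathLift (γ.cons α) (Q.consElt γ α m x) = R.pathLift γ x ≫ R.psi α m := rfl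

theorem pathLift_pathMul {u v : V} (γ : Quiver.Path u v) (x : Q.PathSpace γ) {w : V}
    (δ : Quiver.Path v w) (y : Q.PathSpace δ) :
    R.pathLift (γ.comp δ) (Q.pathMul γ x δ y) = R.pathLift γ x ≫ R.pathLift δ y := by
  induction δ with
  | nil =>
    obtain ⟨a, rfl⟩ := Q.nilElt_surjective y
    rw [pathMul_nilElt]
    exact R.pathLift_smul γ a x
  | @cons b c δ α ih =>
    refine Q.consElt_induction y ?_ (fun m n => ?_) fun s t hs ht => ?_
    · rw [map_zero, map_zero, map_zero, Limits.comp_zero]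
    · rw [pathMul_consElt]
      change R.pathLift ((γ.comp δ).cons α) _ = _
      rw [pathLift_consElt, pathLift_consElt, ih, Category.assoc]
    · rw [map_add, map_add, map_add, hs, ht, Preadditive.comp_add]

open scoped Classical in
/-- The functor on morphisms. -/
def homLift (v w : V) : Q.HomSpace v w →ₗ[k] (R.obj v ⟶ R.obj w) :=
  DirectSum.toModule k _ _ fun γ => R.pathLift γ

open scoped Classical in
theorem homLift_inj {v w : V} (γ : Quiver.Path v w) (x : Q.PathSpace γ) :
    R.homLift v w (Q.inj γ x) = R.pathLift γ x := by
  simp only [homLift, inj, DirectSum.toModule_lof]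

theorem homLift_compBilin {u v w : V} (f : Q.HomSpace u v) (g : Q.HomSpace v w) :
    R.homLift u w (Q.compBilin u v w f g) = R.homLift u v f ≫ R.homLift v w g := by
  refine Q.homSpace_induction f (by simp) (fun γ x => ?_) fun x y hx hy => ?_
  · refine Q.homSpace_induction g (by simp) (fun δ y => ?_) fun x y hx hy => ?_
    · rw [compBilin_inj, homLift_inj, homLift_inj, homLift_inj, pathLift_pathMul]
    · rw [map_add, map_add, map_add, hx, hy, Preadditive.comp_add]
  · rw [map_add, LinearMap.add_apply, map_add, map_add, hx, hy, Preadditive.add_comp]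

theorem homLift_algElt {v : V} (a : Q.alg v) : R.homLift v v (Q.algElt v a) = R.rho v a :=
  R.homLift_inj Quiver.Path.nil (Q.nilElt v a)

theorem homLift_arrowElt {v w : V} (α : v ⟶ w) (m : Q.bim α) :
    R.homLift v w (Q.arrowElt α m) = R.psi α m := by
  rw [arrowElt, homLift_inj, pathLift_consElt, pathLift_nilElt, R.rho_one, Category.id_comp]

/-- The functor determined by a representation. -/
def functor : Q.FreeCat ⥤ D where
  obj X := R.obj X.vertex
  map {X Y} f := R.homLift X.vertex Y.vertex f
  map_id X := (R.homLift_algElt 1).trans (R.rho_one X.vertex)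
  map_comp f g := R.homLift_compBilin f g

theorem presents (hobj : Function.Bijective R.obj)
    (hmap : ∀ v w, Function.Bijective (R.homLift v w)) : Q.Presents D := by
  refine ⟨R.functor, ⟨fun {X Y f g} => map_add (R.homLift X.vertex Y.vertex) f g⟩,
    ⟨fun {X Y} f r => map_smul (R.homLift X.vertex Y.vertex) r f⟩,
    ⟨fun {X Y} f => (hmap X.vertex Y.vertex).2 f⟩,
    ⟨fun {X Y} f g h => (hmap X.vertex Y.vertex).1 h⟩, ⟨fun X Y h => ?_, fun Z => ?_⟩⟩
  · obtain ⟨x⟩ := X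
    obtain ⟨y⟩ := Y
    exact congrArg FreeCat.mk (hobj.1 h)
  · obtain ⟨x, hx⟩ := hobj.2 Z
    exact ⟨⟨x⟩, hx⟩

end Rep

/-! #### Decomposition by the first arrow -/

section FirstArrow

variable {v : V} {ι : Type*} [Fintype ι] {m : ι → V} (ξ : ∀ i, Q.HomSpace v (m i))

/-- The map `(f_i) ↦ ∑ f_i ∘ ξ_i`. -/
def firstMap (w : V) : (∀ i, Q.HomSpace (m i) w) →ₗ[k] Q.HomSpace v w :=
  ∑ i, (Q.compBilin v (m i) w (ξ i)).comp (LinearMap.proj i)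

theorem firstMap_apply (w : V) (f : ∀ i, Q.HomSpace (m i) w) :
    Q.firstMap ξ w f = ∑ i, Q.compBilin v (m i) w (ξ i) (f i) := by
  simp [firstMap, LinearMap.sum_apply]

theorem compBilin_firstMap {w w' : V} (f : ∀ i, Q.HomSpace (m i) w) (g : Q.HomSpace w w') :
    Q.compBilin v w w' (Q.firstMap ξ w f) g =
      Q.firstMap ξ w' fun i => Q.compBilin (m i) w w' (f i) g := by
  simp only [firstMap_apply, map_sum, LinearMap.sum_apply, compBilin_assoc]

/-- Associativity lets all arrows but the first be absorbed into the coefficients, which reduces a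
path of positive length to its first arrow. -/
theorem inj_mem_range_firstMap
    (hξ : ∀ (u : V) (α : v ⟶ u) (x : Q.bim α), Q.arrowElt α x ∈ LinearMap.range (Q.firstMap ξ u))
    {w : V} (γ : Quiver.Path v w) (hγ : γ.length ≠ 0) (x : Q.PathSpace γ) :
    Q.inj γ x ∈ LinearMap.range (Q.firstMap ξ w) := by
  induction γ with
  | nil => exact absurd rfl hγ
  | @cons b c γ α ih =>
    refine Q.consElt_induction x ?_ (fun y n => ?_) fun s t hs ht => ?_
    · rw [map_zero]
      exact Submodule.zero_mem _
    · by_cases h : γ.length = 0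
      · cases γ with
        | nil =>
          -- For a single arrow, `y ⊗ a` equals `y a ⊗ 1`, an element of the form `arrowElt`.
          obtain ⟨a, rfl⟩ := Q.nilElt_surjective n
          have := hξ c α (MulOpposite.op a • y)
          rwa [arrowElt, consElt_op_smul, show a • Q.nilElt v 1 = Q.nilElt v a from mul_one a]
            at this
        | cons γ β => simp at h
      · obtain ⟨f, hf⟩ := ih h n
        rw [← arrowMap_inj, arrowMap_eq, ← hf, compBilin_firstMap]
        exact ⟨_, rfl⟩
    · rw [map_add]
      exact Submodule.add_mem _ hs ht

theorem mem_range_firstMap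
    (hξ : ∀ (u : V) (α : v ⟶ u) (x : Q.bim α), Q.arrowElt α x ∈ LinearMap.range (Q.firstMap ξ u))
    {w : V} (hvw : v ≠ w) (f : Q.HomSpace v w) : f ∈ LinearMap.range (Q.firstMap ξ w) := by
  refine Q.homSpace_induction f (Submodule.zero_mem _) (fun γ x => ?_)
    fun x y hx hy => Submodule.add_mem _ hx hy
  exact Q.inj_mem_range_firstMap ξ hξ γ (fun h => hvw (Quiver.Path.eq_of_length_zero γ h)) x

end FirstArrow

/-- If there are no oriented cycles, then the endomorphisms of a vertex are those of its algebra. -/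
theorem exists_eq_algElt (hQ : ∀ (v : V) (p : Quiver.Path v v), p.length = 0) {v : V}
    (f : Q.HomSpace v v) : ∃ a, Q.algElt v a = f := by
  refine Q.homSpace_induction f ⟨0, ?_⟩ (fun γ x => ?_) ?_
  · exact map_zero (Q.inj (Quiver.Path.nil : Quiver.Path v v))
  · obtain rfl := Quiver.Path.eq_nil_of_length_zero γ (hQ v γ)
    obtain ⟨a, rfl⟩ := Q.nilElt_surjective x
    exact ⟨a, rfl⟩
  · rintro _ _ ⟨a, rfl⟩ ⟨b, rfl⟩
    exact ⟨a + b, map_add (Q.inj (Quiver.Path.nil : Quiver.Path v v)) _ _⟩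

end BimoduleQuiver

/-! ### The bimodules in degree one of the graded category -/

theorem sum_subtype_eq_sum {ι M : Type*} [Fintype ι] [AddCommMonoid M] (P : ι → Prop)
    [DecidablePred P] (f : ι → M) (hf : ∀ i, ¬ P i → f i = 0) :
    ∑ i : {i // P i}, f i = ∑ i, f i := by
  rw [← Finset.sum_subtype (Finset.univ.filter P) (by simp) f]
  exact Finset.sum_filter_of_ne fun i _ h => by_contra fun h' => h (hf i h')

section DegOne

variable {k : Type uk} [Field k] {A : Type u} [Ring A] [Algebra k A] {Λ : Type w} [Fintype Λ]
  {e : Λ → A} (he : CompleteOrthogonalIdempotents e) (hd : IsDirectedFamily k e)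

/-- The algebra of endomorphisms of an object of the graded category. -/
abbrev GrEnd (l : Λ) : Type u := End (AssocCat.mk l : GradedCat he hd)

/-- The part of degree one of the space of morphisms from `l` to `m`. -/
def degOne (l m : Λ) : Submodule k (offDiagFiltration he hd).Gr :=
  corner k (grIdem he hd) l m ⊓
    LinearMap.range (DirectSum.lof k ℕ (offDiagFiltration he hd).Piece 1)

variable {he hd}

theorem mem_degOne_iff {l m : Λ} {z : (offDiagFiltration he hd).Gr} :
    z ∈ degOne he hd l m ↔ ∃ x : offDiagPow k e 1, e m * x.1 = x.1 ∧ x.1 * e l = x.1 ∧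
      z = grOf he hd 1 x := by
  constructor
  · rintro ⟨h1, x, rfl⟩
    obtain ⟨h2, h3⟩ := (mem_corner_iff (grIdem_idem he hd)).1 h1
    obtain ⟨x, hx⟩ := exists_of_eq_grOf he hd x
    change DirectSum.lof k ℕ (offDiagFiltration he hd).Piece 1 _ = _ at hx
    rw [hx] at h2 h3 ⊢
    refine ⟨⟨e m * x.1 * e l, mem_offDiagPow_mul he hd _ 1 (offDiagPow_mul_mem he hd _ 1 x.2)⟩,
      ?_, ?_, ?_⟩
    · simp only [← mul_assoc, (he.idem m).eq]
    · simp only [mul_assoc, (he.idem l).eq]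
    · conv_lhs => rw [← h3, ← h2]
      rw [grIdem_mul_grOf, grOf_mul_grIdem]
  · rintro ⟨x, h1, h2, rfl⟩
    exact ⟨grOf_mem_corner he hd h1 h2, _, rfl⟩

theorem corner_mul_degOne_mem {l m : Λ} {a z : (offDiagFiltration he hd).Gr}
    (ha : a ∈ corner k (grIdem he hd) m m) (hz : z ∈ degOne he hd l m) :
    a * z ∈ degOne he hd l m := by
  obtain ⟨c, hc1, hc2, rfl⟩ := exists_eq_grOf_zero he hd ha
  obtain ⟨x, h1, h2, rfl⟩ := mem_degOne_iff.1 hz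
  rw [grOf_mul_grOf]
  exact mem_degOne_iff.2 ⟨⟨c.1 * x.1, offDiagPow_mul_mem he hd _ 1 x.2⟩,
    by simp only [← mul_assoc, hc1], by simp only [mul_assoc, h2],
    grOf_congr he hd (zero_add 1) _ _ rfl⟩

theorem degOne_mul_corner_mem {l m : Λ} {a z : (offDiagFiltration he hd).Gr}
    (ha : a ∈ corner k (grIdem he hd) l l) (hz : z ∈ degOne he hd l m) :
    z * a ∈ degOne he hd l m := by
  obtain ⟨c, hc1, hc2, rfl⟩ := exists_eq_grOf_zero he hd ha
  obtain ⟨x, h1, h2, rfl⟩ := mem_degOne_iff.1 hz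
  rw [grOf_mul_grOf]
  exact mem_degOne_iff.2 ⟨⟨x.1 * c.1, mem_offDiagPow_mul he hd _ 1 x.2⟩,
    by simp only [← mul_assoc, h1], by simp only [mul_assoc, hc2],
    grOf_congr he hd (add_zero 1) _ _ rfl⟩

instance degOneLeft (l m : Λ) : Module (GrEnd he hd m) (degOne he hd l m) where
  smul a z := ⟨a.1 * z.1, corner_mul_degOne_mem a.2 z.2⟩
  one_smul z := Subtype.ext ((mem_corner_iff (grIdem_idem he hd)).1 z.2.1).1
  mul_smul a b z := Subtype.ext (mul_assoc a.1 b.1 z.1)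
  smul_zero a := Subtype.ext (mul_zero a.1)
  smul_add a x y := Subtype.ext (mul_add a.1 x.1 y.1)
  add_smul a b z := Subtype.ext (add_mul a.1 b.1 z.1)
  zero_smul z := Subtype.ext (zero_mul z.1)

instance degOneRight (l m : Λ) : Module (GrEnd he hd l)ᵐᵒᵖ (degOne he hd l m) where
  smul a z := ⟨z.1 * a.unop.1, degOne_mul_corner_mem a.unop.2 z.2⟩
  one_smul z := Subtype.ext ((mem_corner_iff (grIdem_idem he hd)).1 z.2.1).2
  mul_smul a b z := Subtype.ext (mul_assoc z.1 b.unop.1 a.unop.1).symm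
  smul_zero a := Subtype.ext (zero_mul a.unop.1)
  smul_add a x y := Subtype.ext (add_mul x.1 y.1 a.unop.1)
  add_smul a b z := Subtype.ext (mul_add z.1 a.unop.1 b.unop.1)
  zero_smul z := Subtype.ext (mul_zero z.1)

instance (l m : Λ) : IsScalarTower k (GrEnd he hd m) (degOne he hd l m) :=
  ⟨fun r a z => Subtype.ext (smul_mul_assoc r a.1 z.1)⟩

instance (l m : Λ) : IsScalarTower k (GrEnd he hd l)ᵐᵒᵖ (degOne he hd l m) :=
  ⟨fun r a z => Subtype.ext (mul_smul_comm r z.1 a.unop.1)⟩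

instance (l m : Λ) :
    SMulCommClass (GrEnd he hd m) (GrEnd he hd l)ᵐᵒᵖ (degOne he hd l m) :=
  ⟨fun a b z => Subtype.ext (mul_assoc a.1 z.1 b.unop.1).symm⟩

variable (he hd) [FiniteDimensional k A] (d : DirectedStructure k e)

namespace DirectedStructure

theorem finite_grEnd (d : DirectedStructure k e) (l : Λ) : FiniteDimensional k (GrEnd he hd l) :=
  finiteDimensional_corner_grIdem he hd d l l

theorem finite_degOne (d : DirectedStructure k e) (l m : Λ) :
    FiniteDimensional k (degOne he hd l m) :=
  have := finiteDimensional_corner_grIdem he hd d l m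
  Submodule.finiteDimensional_of_le inf_le_left

/-- An endomorphism is the class of some `c` in the corner of `A` at `l`, and `c - χ l c` is
nilpotent there. So every endomorphism is a scalar plus a nilpotent. -/
theorem isLocalRing_grEnd (d : DirectedStructure k e) (l : Λ) :
    IsLocalRing (GrEnd he hd l) := by
  have : Nontrivial (GrEnd he hd l) :=
    ⟨⟨1, 0, fun h => grIdem_ne_zero he hd d l (congrArg Subtype.val h)⟩⟩
  refine IsLocalRing.of_isUnit_or_isUnit_one_sub_self fun f => ?_
  obtain ⟨c, h1, h2, h3⟩ := exists_eq_grOf_zero he hd f.2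
  let r := d.χ l c.1
  have hnil : IsNilpotent (f - r • (1 : GrEnd he hd l)) := by
    let a : A := c.1 - r • e l
    have ha : f.1 - r • grIdem he hd l = grOf he hd 0 ⟨a, Submodule.mem_top⟩ := by
      rw [h3, grIdem_eq, ← grOf_smul, sub_eq_add_neg, ← neg_one_smul k, ← grOf_smul, ← grOf_add]
      refine grOf_congr he hd rfl _ _ ?_
      change c.1 + (-1 : k) • (r • e l) = c.1 - r • e l
      rw [neg_one_smul, sub_eq_add_neg]
    obtain ⟨n, hn⟩ := d.nilp (l := l) (a := a) (by
      rw [map_sub, map_smul, d.χ_self, smul_eq_mul, mul_one, sub_self])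
    have hea : e l * a * e l = a := by
      rw [mul_sub, sub_mul, h1, h2, mul_smul_comm, smul_mul_assoc, d.idem_mul, d.idem_mul]
    rw [hea] at hn
    have hpow : ∀ n : ℕ, ((f - r • (1 : GrEnd he hd l)) ^ (n + 1)).1 =
        grOf he hd 0 ⟨a ^ (n + 1), Submodule.mem_top⟩ := by
      intro n
      induction n with
      | zero =>
        rw [zero_add, pow_one]
        exact ha.trans (grOf_congr he hd rfl _ _ (pow_one a).symm)
      | succ n ih =>
        rw [pow_succ]
        change ((f - r • (1 : GrEnd he hd l)) ^ (n + 1)).1 * (f.1 - r • grIdem he hd l) = _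
        rw [ih, ha, grOf_mul_grOf]
        exact grOf_congr he hd (add_zero 0) _ _ (pow_succ a (n + 1)).symm
    refine ⟨n + 1, Subtype.ext ((hpow n).trans ?_)⟩
    rw [(grOf_eq_zero_iff he hd 0 _).2]
    · rfl
    · change a ^ (n + 1) ∈ _
      rw [pow_succ, hn, zero_mul]
      exact Submodule.zero_mem _
  by_cases hr : r = 0
  · rw [hr, zero_smul, sub_zero] at hnil
    exact Or.inr hnil.isUnit_one_sub
  · left
    have hu : IsUnit (r • (1 : GrEnd he hd l)) := by
      rw [← Algebra.algebraMap_eq_smul_one]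
      exact (IsUnit.mk0 r hr).map (algebraMap k (GrEnd he hd l))
    have := hnil.isUnit_add_left_of_commute hu (by
      rw [← Algebra.algebraMap_eq_smul_one]
      exact (Algebra.commutes r _).symm)
    rwa [add_sub_cancel] at this

/-- In an expansion of an element of degree one only the degree zero parts of the coefficients
count. These lie in the corner from `m i` to `p`, whose degree zero part vanishes unless `m i = p`.
-/
theorem exists_degOne_eq_sum {l p : Λ} {ι : Type*} [Fintype ι] {m : ι → Λ}
    (x : ι → offDiagPow k e 1) (hX : ∀ i : {i // m i = p}, grOf he hd 1 (x i) ∈ degOne he hd l p)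
    (hgen : ∀ z ∈ corner k (grIdem he hd) l p, ∃ s : ι → (offDiagFiltration he hd).Gr,
      (∀ i, s i ∈ corner k (grIdem he hd) (m i) p) ∧ z = ∑ i, s i * grOf he hd 1 (x i))
    [DecidablePred fun i => m i = p] (z : degOne he hd l p) :
    ∃ g : {i // m i = p} → GrEnd he hd p,
      z = ∑ i, g i • (⟨grOf he hd 1 (x i), hX i⟩ : degOne he hd l p) := by
  obtain ⟨z, hz⟩ := z
  obtain ⟨y, hy1, hy2, rfl⟩ := mem_degOne_iff.1 hz
  obtain ⟨s, hs1, hs2⟩ := hgen _ hz.1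
  choose c hc1 hc2 hc3 using fun i => exists_grOf_sub_mem he hd (hs1 i) (mem_grGe_zero he hd _)
  have h3 : y.1 - ∑ i, (c i).1 * (x i).1 ∈ offDiagPow k e 2 := by
    have h4 := Submodule.sum_mem _ fun i (_ : i ∈ Finset.univ) =>
      grGe_mul_mem he hd (hc3 i) (grOf_mem_grGe he hd le_rfl (x i))
    simp only [sub_mul, Finset.sum_sub_distrib, grOf_mul_grOf] at h4
    rw [← hs2, ← grOf_sum] at h4
    have h6 := mem_of_grOf_mem_grGe he hd (n := 1) (x := y - ∑ i, ⟨(c i).1 * (x i).1,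
      offDiagPow_mul_mem he hd _ 1 (x i).2⟩) (by
        rw [sub_eq_add_neg, ← neg_one_smul k, grOf_add, grOf_smul, neg_one_smul,
          ← sub_eq_add_neg]
        exact h4)
    rwa [Submodule.coe_sub, Submodule.coe_sum] at h6
  have h5 : grOf he hd 1 y = ∑ i, grOf he hd 0 (c i) * grOf he hd 1 (x i) := by
    simp only [grOf_mul_grOf]
    rw [← grOf_sum]
    refine (grOf_eq_grOf_iff he hd 1 y _).2 ?_
    rw [Submodule.coe_sum]
    exact h3
  rw [← sum_subtype_eq_sum (fun i => m i = p) _ (fun i hi => by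
    rw [grOf_zero_eq_zero he hd hi (hc1 i) (hc2 i), zero_mul])] at h5
  let g : {i // m i = p} → GrEnd he hd p := fun i => ⟨grOf he hd 0 (c i), by
    have := grOf_mem_corner he hd (hc1 i) (hc2 i)
    rwa [i.2] at this⟩
  have h6 : (⟨grOf he hd 1 y, hz⟩ : degOne he hd l p) = ∑ i : {i // m i = p},
      g i • (⟨grOf he hd 1 (x i), hX i⟩ : degOne he hd l p) := by
    refine Subtype.ext ?_
    rw [Submodule.coe_sum]
    exact h5
  exact ⟨g, h6⟩

/-- The generators `x i` with `m i = p` form a basis over the algebra at `p`; independence is the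
graded one, with zero coefficients at the other indices. -/
theorem projective_degOne_left (d : DirectedStructure k e) {l p : Λ} (hlp : p ≠ l)
    (h : LeftFreeAt e l) : Module.Projective (GrEnd he hd p) (degOne he hd l p) := by
  classical
  obtain ⟨ι, _, m, x, hlt, hx1, hx2, hgen, hind⟩ := exists_gr_left_basis he hd d h
  have hX : ∀ i : {i // m i = p}, grOf he hd 1 (x i) ∈ degOne he hd l p := fun i =>
    mem_degOne_iff.2 ⟨x i, by have := hx1 i.1; rwa [i.2] at this, hx2 _, rfl⟩
  refine Module.Projective.of_basis (Module.Basis.mk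
    (v := fun i : {i // m i = p} => (⟨grOf he hd 1 (x i), hX i⟩ : degOne he hd l p)) ?_ ?_)
  · rw [Fintype.linearIndependent_iff]
    intro g hg i
    have h1 := hind p (fun i => if h : m i = p then (g ⟨i, h⟩).1 else 0) (fun i => by
      split_ifs with h
      · rw [h]; exact (g ⟨i, h⟩).2
      · exact Submodule.zero_mem _) (by
      rw [← sum_subtype_eq_sum (fun i => m i = p) _ (fun i hi => by rw [dif_neg hi, zero_mul])]
      have h2 := congrArg Subtype.val hg
      rw [Submodule.coe_sum] at h2
      refine Eq.trans (Finset.sum_congr rfl fun i _ => ?_) h2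
      rw [dif_pos i.2]
      rfl) i.1
    rw [dif_pos i.2] at h1
    exact Subtype.ext h1
  · rintro z -
    obtain ⟨g, hg⟩ := exists_degOne_eq_sum he hd x hX (hgen p hlp) z
    rw [hg]
    exact Submodule.sum_mem _ fun i _ => Submodule.smul_mem _ _ (Submodule.subset_span ⟨i, rfl⟩)

/-- The mirror image: the generators `y i` with `q i = l` form a basis over the opposite of the
algebra at `l`. -/
theorem projective_degOne_right (d : DirectedStructure k e) {l p : Λ} (hlp : l ≠ p)
    (h : RightFreeAt e p) : Module.Projective (GrEnd he hd l)ᵐᵒᵖ (degOne he hd l p) := by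
  classical
  obtain ⟨ι, _, q, y, hlt, hy1, hy2, hgen, hind⟩ := exists_gr_right_basis he hd d h
  have hX : ∀ i : {i // q i = l}, grOf he hd 1 (y i) ∈ degOne he hd l p := fun i =>
    mem_degOne_iff.2 ⟨y i, hy1 _, by have := hy2 i.1; rwa [i.2] at this, rfl⟩
  refine Module.Projective.of_basis (Module.Basis.mk
    (v := fun i : {i // q i = l} => (⟨grOf he hd 1 (y i), hX i⟩ : degOne he hd l p)) ?_ ?_)
  · rw [Fintype.linearIndependent_iff]
    intro g hg i
    have h1 := hind l (fun i => if h : q i = l then (g ⟨i, h⟩).unop.1 else 0) (fun i => by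
      split_ifs with h
      · rw [h]; exact (g ⟨i, h⟩).unop.2
      · exact Submodule.zero_mem _) (by
      rw [← sum_subtype_eq_sum (fun i => q i = l) _ (fun i hi => by rw [dif_neg hi, mul_zero])]
      have h2 := congrArg Subtype.val hg
      rw [Submodule.coe_sum] at h2
      refine Eq.trans (Finset.sum_congr rfl fun i _ => ?_) h2
      rw [dif_pos i.2]
      rfl) i.1
    rw [dif_pos i.2] at h1
    exact MulOpposite.unop_injective (Subtype.ext h1)
  · rintro ⟨z, hz⟩ -
    obtain ⟨x, hx1, hx2, rfl⟩ := mem_degOne_iff.1 hz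
    obtain ⟨s, hs1, hs2⟩ := hgen l hlp _ hz.1
    choose c hc1 hc2 hc3 using fun i => exists_grOf_sub_mem he hd (hs1 i) (mem_grGe_zero he hd _)
    have h3 : x.1 - ∑ i, (y i).1 * (c i).1 ∈ offDiagPow k e 2 := by
      have h4 := Submodule.sum_mem _ fun i (_ : i ∈ Finset.univ) =>
        grGe_mul_mem he hd (grOf_mem_grGe he hd le_rfl (y i)) (hc3 i)
      simp only [mul_sub, Finset.sum_sub_distrib, grOf_mul_grOf] at h4
      rw [← hs2, ← grOf_sum] at h4
      have h6 := mem_of_grOf_mem_grGe he hd (n := 1) (x := x - ∑ i, ⟨(y i).1 * (c i).1,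
        mem_offDiagPow_mul he hd _ 1 (y i).2⟩) (by
          rw [sub_eq_add_neg, ← neg_one_smul k, grOf_add, grOf_smul, neg_one_smul,
            ← sub_eq_add_neg]
          exact h4)
      rwa [Submodule.coe_sub, Submodule.coe_sum] at h6
    have h5 : grOf he hd 1 x = ∑ i, grOf he hd 1 (y i) * grOf he hd 0 (c i) := by
      simp only [grOf_mul_grOf]
      rw [← grOf_sum]
      refine (grOf_eq_grOf_iff he hd 1 x _).2 ?_
      rw [Submodule.coe_sum]
      exact h3
    rw [← sum_subtype_eq_sum (fun i => q i = l) _ (fun i hi => by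
      rw [grOf_zero_eq_zero he hd (Ne.symm hi) (hc1 i) (hc2 i), mul_zero])] at h5
    let g : {i // q i = l} → GrEnd he hd l := fun i => ⟨grOf he hd 0 (c i), by
      have := grOf_mem_corner he hd (hc1 i) (hc2 i)
      rwa [i.2] at this⟩
    have h6 : (⟨grOf he hd 1 x, hz⟩ : degOne he hd l p) = ∑ i : {i // q i = l},
        MulOpposite.op (g i) • (⟨grOf he hd 1 (y i), hX i⟩ : degOne he hd l p) := by
      refine Subtype.ext ?_
      rw [Submodule.coe_sum]
      exact h5
    rw [h6]
    exact Submodule.sum_mem _ fun i _ => Submodule.smul_mem _ _ (Submodule.subset_span ⟨i, rfl⟩)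

end DirectedStructure

end DegOne

/-! ### The graded category as a free directed category -/

namespace DirectedStructure

variable {k : Type uk} [Field k] {A : Type u} [Ring A] [Algebra k A] {Λ : Type w} [Fintype Λ]
  {e : Λ → A} (d : DirectedStructure k e)

/-- The vertices of the quiver with an arrow `l ⟶ m` for each relation `l < m`. -/
structure Vertex (d : DirectedStructure k e) : Type w where
  /-- The index of the vertex. -/
  idx : Λ

instance : Quiver.{w} d.Vertex := ⟨fun l m => ULift.{w} (PLift (d.lt l.idx m.idx))⟩

theorem lt_of_hom {l m : d.Vertex} (α : l ⟶ m) : d.lt l.idx m.idx := α.down.down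

theorem length_eq_zero_or_lt {l m : d.Vertex} (γ : Quiver.Path l m) :
    γ.length = 0 ∨ d.lt l.idx m.idx := by
  induction γ with
  | nil => exact Or.inl rfl
  | @cons b c γ α ih =>
    right
    rcases ih with h | h
    · rw [Quiver.Path.eq_of_length_zero γ h]
      exact d.lt_of_hom α
    · exact d.trans h (d.lt_of_hom α)

theorem isFiniteAcyclic : IsFiniteAcyclic d.Vertex where
  finite_vertices := Finite.of_injective Vertex.idx fun ⟨_⟩ ⟨_⟩ h => congrArg Vertex.mk h
  finite_arrows l m := inferInstanceAs (Finite (ULift (PLift (d.lt l.idx m.idx))))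
  acyclic l γ := (d.length_eq_zero_or_lt γ).resolve_right (d.irrefl l.idx)

variable (he : CompleteOrthogonalIdempotents e) (hd : IsDirectedFamily k e) [FiniteDimensional k A]

/-- The quiver of bimodules given by the degrees zero and one of the graded category. -/
def grQuiver (d : DirectedStructure k e) : BimoduleQuiver.{uk, u, w} k d.Vertex :=
  letI : ∀ l : Λ, FiniteDimensional k (GrEnd he hd l) := d.finite_grEnd he hd
  letI : ∀ l : Λ, IsLocalRing (GrEnd he hd l) := d.isLocalRing_grEnd he hd
  letI : ∀ l m : Λ, FiniteDimensional k (degOne he hd l m) := d.finite_degOne he hd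
  { alg := fun l => GrEnd he hd l.idx
    bim := fun {l m} _ => degOne he hd l.idx m.idx }

/-- The functor from the free category of `grQuiver` to the graded category. -/
def grRep : (d.grQuiver he hd).Rep (GradedCat he hd) where
  obj l := ⟨l.idx⟩
  rho _ := LinearMap.id
  psi _ := Submodule.inclusion inf_le_left
  rho_one _ := rfl
  rho_mul _ _ _ := rfl
  psi_smul _ _ _ := rfl
  psi_op_smul _ _ _ := rfl

/-- Both sides decompose along the same generators: the graded category by left freeness, the free
category by first arrows. So bijectivity at `v` follows from bijectivity at the larger vertices `m
i`. In the free category only generation is needed, since its injectivity is inherited from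
independence in the graded algebra. -/
theorem presents_grQuiver (d : DirectedStructure k e) (h : ∀ l, LeftFreeAt e l) :
    (d.grQuiver he hd).Presents (GradedCat he hd) := by
  classical
  refine (d.grRep he hd).presents
    ⟨fun ⟨l⟩ ⟨m⟩ h => congrArg Vertex.mk (congrArg AssocCat.idx h), fun X => ⟨⟨X.idx⟩, rfl⟩⟩ ?_
  rintro ⟨v⟩
  induction v using d.wf_gt.induction with
  | _ v ih =>
    rintro ⟨w⟩
    -- On the diagonal both sides reduce to the algebra at the vertex, as there are no oriented
    -- cycles.
    by_cases hvw : v = w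
    · subst hvw
      constructor
      · rw [injective_iff_map_eq_zero]
        intro f hf
        obtain ⟨a, rfl⟩ := (d.grQuiver he hd).exists_eq_algElt d.isFiniteAcyclic.acyclic f
        rw [BimoduleQuiver.Rep.homLift_algElt] at hf
        obtain rfl : a = 0 := hf
        exact map_zero ((d.grQuiver he hd).inj Quiver.Path.nil)
      · intro a
        exact ⟨(d.grQuiver he hd).algElt ⟨v⟩ a, (d.grRep he hd).homLift_algElt a⟩
    obtain ⟨ι, _, m, x, hlt, hx1, hx2, hgen, hind⟩ := exists_gr_left_basis he hd d (h v)
    have hX : ∀ i, grOf he hd 1 (x i) ∈ degOne he hd v (m i) := fun i =>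
      mem_degOne_iff.2 ⟨x i, hx1 i, hx2 i, rfl⟩
    -- The generators of degree one, regarded as elements on single arrows.
    let ξ : ∀ i, (d.grQuiver he hd).HomSpace ⟨v⟩ ⟨m i⟩ := fun i =>
      (d.grQuiver he hd).arrowElt (v := ⟨v⟩) (w := ⟨m i⟩) ⟨⟨hlt i⟩⟩
        (⟨grOf he hd 1 (x i), hX i⟩ : degOne he hd v (m i))
    have hξ : ∀ (u : d.Vertex) (α : ⟨v⟩ ⟶ u) (y : (d.grQuiver he hd).bim α),
        (d.grQuiver he hd).arrowElt α y ∈ LinearMap.range ((d.grQuiver he hd).firstMap ξ u) := by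
      rintro ⟨u⟩ α y
      have hvu : u ≠ v := fun h => d.irrefl v (by have := d.lt_of_hom α; rwa [h] at this)
      have hX' : ∀ i : {i // m i = u}, grOf he hd 1 (x i) ∈ degOne he hd v u := fun i => by
        have := hX i; rwa [i.2] at this
      obtain ⟨g, hg⟩ := exists_degOne_eq_sum he hd x hX' (hgen u hvu) y
      have hsum : (d.grQuiver he hd).arrowElt α y = ∑ i : {i // m i = u},
          (d.grQuiver he hd).arrowElt α
            (g i • (⟨grOf he hd 1 (x i), hX' i⟩ : degOne he hd v u)) := by
        rw [hg]
        exact map_sum (AddMonoidHom.mk' ((d.grQuiver he hd).arrowElt α)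
          ((d.grQuiver he hd).arrowElt_add α)) _ _
      rw [hsum]
      refine Submodule.sum_mem _ ?_
      rintro ⟨i, rfl⟩ -
      -- The coefficient `g i` acts on the left of the bimodule, that is, by composition after `ξ
      -- i`.
      refine ⟨Pi.single i ((d.grQuiver he hd).algElt ⟨m i⟩ (g ⟨i, rfl⟩)), ?_⟩
      rw [BimoduleQuiver.firstMap_apply, Finset.sum_eq_single i]
      · rw [Pi.single_eq_same]
        exact ((d.grQuiver he hd).arrowElt_smul α (g ⟨i, rfl⟩)
          (⟨grOf he hd 1 (x i), hX i⟩ : degOne he hd v (m i))).symm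
      · intro j _ hj
        rw [Pi.single_eq_of_ne hj, map_zero]
      · exact fun h => absurd (Finset.mem_univ i) h
    -- The functor turns the decomposition by first arrows into the decomposition along the `x i`.
    have hlift : ∀ f : ∀ i, (d.grQuiver he hd).HomSpace ⟨m i⟩ ⟨w⟩,
        ((d.grRep he hd).homLift ⟨v⟩ ⟨w⟩ ((d.grQuiver he hd).firstMap ξ ⟨w⟩ f)).1 =
          ∑ i, ((d.grRep he hd).homLift ⟨m i⟩ ⟨w⟩ (f i)).1 * grOf he hd 1 (x i) := by
      intro f
      rw [BimoduleQuiver.firstMap_apply, map_sum]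
      refine (Submodule.coe_sum _ _ _).trans (Finset.sum_congr rfl fun i _ => ?_)
      rw [BimoduleQuiver.Rep.homLift_compBilin]
      exact congrArg (fun t => ((d.grRep he hd).homLift ⟨m i⟩ ⟨w⟩ (f i)).1 * Subtype.val t)
        ((d.grRep he hd).homLift_arrowElt (v := ⟨v⟩) (w := ⟨m i⟩) ⟨⟨hlt i⟩⟩
          (⟨grOf he hd 1 (x i), hX i⟩ : degOne he hd v (m i)))
    constructor
    · rw [injective_iff_map_eq_zero]
      intro f hf
      obtain ⟨f, rfl⟩ := (d.grQuiver he hd).mem_range_firstMap ξ hξ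
        (fun h => hvw (congrArg Vertex.idx h)) f
      have h0 : ∀ i, ((d.grRep he hd).homLift ⟨m i⟩ ⟨w⟩ (f i)).1 = 0 :=
        hind w _ (fun i => ((d.grRep he hd).homLift ⟨m i⟩ ⟨w⟩ (f i)).2)
          ((hlift f).symm.trans (congrArg Subtype.val hf))
      have h1 : f = 0 := funext fun i => (ih (m i) (hlt i) ⟨w⟩).1
        ((Subtype.ext (h0 i)).trans (map_zero _).symm)
      rw [h1, map_zero]
    · intro z
      obtain ⟨s, hs1, hs2⟩ := hgen w (Ne.symm hvw) z.1 z.2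
      choose f hf using fun i => (ih (m i) (hlt i) ⟨w⟩).2 ⟨s i, hs1 i⟩
      refine ⟨(d.grQuiver he hd).firstMap ξ ⟨w⟩ f, Subtype.ext ?_⟩
      rw [hlift, hs2]
      exact Finset.sum_congr rfl fun i _ => by rw [hf]

theorem leftRegular_grQuiver (d : DirectedStructure k e) (h : ∀ l, LeftFreeAt e l) :
    (d.grQuiver he hd).LeftRegular := fun {v w} α =>
  d.projective_degOne_left he hd (fun hwv => d.irrefl v.idx (by
    have := d.lt_of_hom α; rwa [hwv] at this)) (h v.idx)

theorem rightRegular_grQuiver (d : DirectedStructure k e) (h : ∀ l, RightFreeAt e l) :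
    (d.grQuiver he hd).RightRegular := fun {v w} α =>
  d.projective_degOne_right he hd (fun hvw => d.irrefl w.idx (by
    have := d.lt_of_hom α; rwa [hvw] at this)) (h w.idx)

theorem isLeftRegularFreeDirected (d : DirectedStructure k e) (h : ∀ l, LeftFreeAt e l) :
    IsLeftRegularFreeDirected k (GradedCat he hd) :=
  ⟨d.Vertex, inferInstance, d.grQuiver he hd, d.isFiniteAcyclic,
    d.leftRegular_grQuiver he hd h, d.presents_grQuiver he hd h⟩

theorem isRegularFreeDirected (d : DirectedStructure k e) (h : ∀ l, LeftFreeAt e l)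
    (h' : ∀ l, RightFreeAt e l) : IsRegularFreeDirected k (GradedCat he hd) :=
  ⟨d.Vertex, inferInstance, d.grQuiver he hd, d.isFiniteAcyclic,
    ⟨d.leftRegular_grQuiver he hd h, d.rightRegular_grQuiver he hd h'⟩,
    d.presents_grQuiver he hd h⟩

end DirectedStructure

/-! ### Bases of the morphism spaces of a free category -/

namespace BimoduleQuiver

variable {k : Type uk} [Field k] {V : Type w} [Quiver.{w} V] (Q : BimoduleQuiver.{uk, u, w} k V)

theorem algElt_mul {v : V} (a b : Q.alg v) :
    Q.algElt v (a * b) = Q.compBilin v v v (Q.algElt v b) (Q.algElt v a) :=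
  (Q.compBilin_inj_algElt Quiver.Path.nil (Q.nilElt v b) a).symm

/-- `algElt` as a linear map. -/
def algEltₗ (v : V) : Q.alg v →ₗ[k] Q.HomSpace v v where
  toFun := Q.algElt v
  map_add' a b := map_add (Q.inj (Quiver.Path.nil : Quiver.Path v v)) (Q.nilElt v a) (Q.nilElt v b)
  map_smul' r a := map_smul (Q.inj (Quiver.Path.nil : Quiver.Path v v)) r (Q.nilElt v a)

theorem arrowElt_smul_base {v w : V} (α : v ⟶ w) (r : k) (m : Q.bim α) :
    Q.arrowElt α (r • m) = r • Q.arrowElt α m := by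
  rw [← algebraMap_smul (Q.alg w) r m, arrowElt_smul, Algebra.algebraMap_eq_smul_one,
    show Q.algElt w (r • 1) = r • Q.algElt w 1 from map_smul (Q.algEltₗ w) r 1, map_smul]
  exact congrArg (r • ·) (Q.compBilin_one_right _)

/-! #### The left side -/

section Left

variable {v : V} {n : ∀ {u : V}, (v ⟶ u) → ℕ}
  (β : ∀ {u : V} (α : v ⟶ u), Module.Basis (Fin (n α)) (Q.alg u) (Q.bim α))

/-- The index set of the elements of the bases of the bimodules on the arrows that start at `v`. -/
abbrev FirstIdx {v : V} (n : ∀ {u : V}, (v ⟶ u) → ℕ) : Type w :=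
  Σ (u : V) (α : v ⟶ u), Fin (n α)

/-- A basis element of the bimodule on an arrow that starts at `v`, as a morphism. -/
def firstElt (i : FirstIdx n) : Q.HomSpace v i.1 := Q.arrowElt i.2.1 (β i.2.1 i.2.2)

open scoped Classical in
/-- The coordinates of an element of the bimodule on an arrow that starts at `v`. -/
def arrowCoord {c : V} (α : v ⟶ c) : Q.bim α →ₗ[k] ∀ i : FirstIdx n, Q.HomSpace i.1 c :=
  ∑ j, (LinearMap.single k (fun i : FirstIdx n => Q.HomSpace i.1 c) ⟨c, α, j⟩).comp
    ((Q.algEltₗ c).comp (((β α).coord j).restrictScalars k))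

open scoped Classical in
theorem arrowCoord_apply {c : V} (α : v ⟶ c) (m : Q.bim α) :
    Q.arrowCoord β α m = ∑ j, Pi.single (M := fun i : FirstIdx n => Q.HomSpace i.1 c) ⟨c, α, j⟩
      (Q.algElt c ((β α).coord j m)) := by
  simp only [arrowCoord, LinearMap.sum_apply]
  rfl

open scoped Classical in
theorem arrowCoord_smul {c : V} (α : v ⟶ c) (a : Q.alg c) (m : Q.bim α) (i : FirstIdx n) :
    Q.arrowCoord β α (a • m) i = Q.compBilin i.1 c c (Q.arrowCoord β α m i) (Q.algElt c a) := by
  rw [arrowCoord_apply, arrowCoord_apply, Finset.sum_apply, Finset.sum_apply, map_sum,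
    LinearMap.sum_apply]
  refine Finset.sum_congr rfl fun j _ => ?_
  by_cases h : i = ⟨c, α, j⟩
  · subst h
    rw [Pi.single_eq_same, Pi.single_eq_same, map_smul, smul_eq_mul, algElt_mul]
  · rw [Pi.single_eq_of_ne h, Pi.single_eq_of_ne h, map_zero, LinearMap.zero_apply]

open scoped Classical in
theorem arrowCoord_basis {c : V} (α : v ⟶ c) (j : Fin (n α)) :
    Q.arrowCoord β α (β α j) =
      Pi.single (M := fun i : FirstIdx n => Q.HomSpace i.1 c) ⟨c, α, j⟩ (Q.algElt c 1) := by
  rw [arrowCoord_apply, Finset.sum_eq_single j]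
  · simp
  · intro j' _ hj
    rw [Module.Basis.coord_apply, Module.Basis.repr_self, Finsupp.single_eq_of_ne hj,
      show Q.algElt c 0 = 0 from map_zero (Q.algEltₗ c), Pi.single_zero]
  · exact fun h => absurd (Finset.mem_univ j) h

/-- The coordinates of `m ⊗ a` for `a` in the algebra at `v`. -/
def baseCoord {c : V} (α : v ⟶ c) :
    Q.bim α →ₗ[k] Q.alg v →ₗ[k] ∀ i : FirstIdx n, Q.HomSpace i.1 c :=
  LinearMap.mk₂ k (fun m (a : Q.alg v) => Q.arrowCoord β α (MulOpposite.op a • m))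
    (fun m m' a => by rw [smul_add, map_add])
    (fun r m a => by rw [smul_comm, map_smul])
    (fun m a a' => by rw [MulOpposite.op_add, add_smul, map_add])
    (fun r m a => by rw [MulOpposite.op_smul, smul_assoc, map_smul])

/-- The coordinates of `m ⊗ x` for `x` in the algebra at `v`; zero on longer paths. -/
def nilCoord : ∀ {b c : V} (γ : Quiver.Path v b) (α : b ⟶ c),
    Q.bim α →ₗ[k] Q.PathSpace γ →ₗ[k] ∀ i : FirstIdx n, Q.HomSpace i.1 c
  | _, _, .nil, α => Q.baseCoord β α
  | _, _, .cons _ _, _ => 0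

theorem nilCoord_nil {c : V} (α : v ⟶ c) (m : Q.bim α) (a : Q.alg v) :
    Q.nilCoord β Quiver.Path.nil α m (Q.nilElt v a) =
      Q.arrowCoord β α (MulOpposite.op a • m) := rfl

theorem nilCoord_of_length {b c : V} (γ : Quiver.Path v b) (α : b ⟶ c) (h : γ.length ≠ 0) :
    Q.nilCoord β γ α = 0 := by
  cases γ with
  | nil => exact absurd rfl h
  | cons γ δ => rfl

theorem nilCoord_balanced {b c : V} (γ : Quiver.Path v b) (α : b ⟶ c) (m : Q.bim α)
    (a : Q.alg b) (x : Q.PathSpace γ) :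
    Q.nilCoord β γ α (MulOpposite.op a • m) x = Q.nilCoord β γ α m (a • x) := by
  cases γ with
  | nil =>
    obtain ⟨x, rfl⟩ := Q.nilElt_surjective x
    rw [nilCoord_nil, smul_smul, ← MulOpposite.op_mul]
    rfl
  | cons γ δ => rfl

theorem nilCoord_smul {b c : V} (γ : Quiver.Path v b) (α : b ⟶ c) (m : Q.bim α)
    (a : Q.alg c) (x : Q.PathSpace γ) (i : FirstIdx n) :
    Q.nilCoord β γ α (a • m) x i =
      Q.compBilin i.1 c c (Q.nilCoord β γ α m x i) (Q.algElt c a) := by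
  cases γ with
  | nil =>
    obtain ⟨x, rfl⟩ := Q.nilElt_surjective x
    rw [nilCoord_nil, nilCoord_nil, ← arrowCoord_smul, smul_comm a (MulOpposite.op x) m]
  | cons γ δ => 
    change (0 : Q.HomSpace i.1 c) = Q.compBilin i.1 c c 0 _
    rw [map_zero, LinearMap.zero_apply]

/-- A family of coordinates on the module of a path that is compatible with the algebra. -/
abbrev CoordMap (n : ∀ {u : V}, (v ⟶ u) → ℕ) {b : V} (γ : Quiver.Path v b) :=
  {φ : Q.PathSpace γ →ₗ[k] ∀ i : FirstIdx n, Q.HomSpace i.1 b //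
    ∀ a x i, φ (a • x) i = Q.compBilin i.1 b b (φ x i) (Q.algElt b a)}

/-- The composition of coordinates with an arrow. -/
def postCoord {b c : V} (γ : Quiver.Path v b) (α : b ⟶ c) (φ : Q.CoordMap n γ) :
    Q.bim α →ₗ[k] Q.PathSpace γ →ₗ[k] ∀ i : FirstIdx n, Q.HomSpace i.1 c where
  toFun m := LinearMap.pi fun i =>
    ((Q.compBilin i.1 b c).flip (Q.arrowElt α m)).comp ((LinearMap.proj i).comp φ.1)
  map_add' m m' := LinearMap.ext fun x => funext fun i => by
    change Q.compBilin i.1 b c (φ.1 x i) (Q.arrowElt α (m + m')) =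
      Q.compBilin i.1 b c (φ.1 x i) (Q.arrowElt α m) +
        Q.compBilin i.1 b c (φ.1 x i) (Q.arrowElt α m')
    rw [arrowElt_add, map_add]
  map_smul' r m := LinearMap.ext fun x => funext fun i => by
    change Q.compBilin i.1 b c (φ.1 x i) (Q.arrowElt α (r • m)) =
      r • Q.compBilin i.1 b c (φ.1 x i) (Q.arrowElt α m)
    rw [arrowElt_smul_base, map_smul]

theorem postCoord_apply {b c : V} (γ : Quiver.Path v b) (α : b ⟶ c) (φ : Q.CoordMap n γ)
    (m : Q.bim α) (x : Q.PathSpace γ) (i : FirstIdx n) :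
    Q.postCoord γ α φ m x i = Q.compBilin i.1 b c (φ.1 x i) (Q.arrowElt α m) := rfl

/-- The coordinates on the module of a path extended by an arrow. -/
def consCoord {b c : V} (γ : Quiver.Path v b) (α : b ⟶ c) (φ : Q.CoordMap n γ) :
    Q.PathSpace (γ.cons α) →ₗ[k] ∀ i : FirstIdx n, Q.HomSpace i.1 c :=
  -- For the coordinates built by `pathCoordAux` at most one summand is nonzero: `nilCoord` when `α`
  -- is the first arrow, `postCoord` when the first arrow is already in `γ`.
  Q.consLift γ α (Q.postCoord γ α φ + Q.nilCoord β γ α) fun m a x => by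
    rw [LinearMap.add_apply, LinearMap.add_apply, LinearMap.add_apply, LinearMap.add_apply,
      nilCoord_balanced]
    congr 1
    funext i
    rw [postCoord_apply, postCoord_apply, φ.2, arrowElt_op_smul, compBilin_assoc]

theorem consCoord_consElt {b c : V} (γ : Quiver.Path v b) (α : b ⟶ c) (φ : Q.CoordMap n γ)
    (m : Q.bim α) (x : Q.PathSpace γ) (i : FirstIdx n) :
    Q.consCoord β γ α φ (Q.consElt γ α m x) i =
      Q.compBilin i.1 b c (φ.1 x i) (Q.arrowElt α m) + Q.nilCoord β γ α m x i := rfl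

theorem consCoord_smul {b c : V} (γ : Quiver.Path v b) (α : b ⟶ c) (φ : Q.CoordMap n γ)
    (a : Q.alg c) (x : Q.PathSpace (γ.cons α)) (i : FirstIdx n) :
    Q.consCoord β γ α φ (a • x) i =
      Q.compBilin i.1 c c (Q.consCoord β γ α φ x i) (Q.algElt c a) := by
  refine Q.consElt_induction x ?_ (fun m x => ?_) fun s t hs ht => ?_
  · rw [smul_zero, map_zero, Pi.zero_apply, map_zero, LinearMap.zero_apply]
  · rw [← consElt_smul, consCoord_consElt, consCoord_consElt, arrowElt_smul, nilCoord_smul,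
      map_add, LinearMap.add_apply, compBilin_assoc]
  · rw [smul_add, map_add, map_add, Pi.add_apply, Pi.add_apply, hs, ht, map_add,
      LinearMap.add_apply]

/-- The coordinates on the module of a path, together with their linearity. -/
def pathCoordAux : ∀ {b : V} (γ : Quiver.Path v b), Q.CoordMap n γ
  -- A path of length zero has no first arrow, hence no coordinates.
  | _, .nil => ⟨0, fun a x i => by
      rw [LinearMap.zero_apply, LinearMap.zero_apply, Pi.zero_apply, map_zero,
        LinearMap.zero_apply]⟩
  | _, .cons γ α => ⟨Q.consCoord β γ α (pathCoordAux γ), Q.consCoord_smul β γ α (pathCoordAux γ)⟩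

/-- The coordinates on the module of a path with respect to the bases on its first arrow. -/
def pathCoord {b : V} (γ : Quiver.Path v b) :
    Q.PathSpace γ →ₗ[k] ∀ i : FirstIdx n, Q.HomSpace i.1 b :=
  (Q.pathCoordAux β γ).1

theorem pathCoord_smul {b : V} (γ : Quiver.Path v b) (a : Q.alg b) (x : Q.PathSpace γ)
    (i : FirstIdx n) :
    Q.pathCoord β γ (a • x) i = Q.compBilin i.1 b b (Q.pathCoord β γ x i) (Q.algElt b a) :=
  (Q.pathCoordAux β γ).2 a x i

theorem pathCoord_consElt {b c : V} (γ : Quiver.Path v b) (α : b ⟶ c) (m : Q.bim α)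
    (x : Q.PathSpace γ) (i : FirstIdx n) :
    Q.pathCoord β (γ.cons α) (Q.consElt γ α m x) i =
      Q.compBilin i.1 b c (Q.pathCoord β γ x i) (Q.arrowElt α m) + Q.nilCoord β γ α m x i := rfl

open scoped Classical in
-- Coordinates commute with composition by later arrows, so it suffices to know them on the first
-- arrow, where `β` is a basis.
theorem pathCoord_pathMul (i : FirstIdx n) {w : V} (δ : Quiver.Path i.1 w) (y : Q.PathSpace δ) :
    Q.pathCoord β ((Quiver.Path.nil.cons i.2.1).comp δ)
      (Q.pathMul (Quiver.Path.nil.cons i.2.1)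
        (Q.consElt Quiver.Path.nil i.2.1 (β i.2.1 i.2.2) (Q.nilElt v 1)) δ y) =
      Pi.single (M := fun i : FirstIdx n => Q.HomSpace i.1 w) i (Q.inj δ y) := by
  funext i'
  induction δ with
  | nil =>
    obtain ⟨a, rfl⟩ := Q.nilElt_surjective y
    rw [pathMul_nilElt]
    refine (Q.pathCoord_smul β _ a _ i').trans ?_
    change Q.compBilin _ _ _ (Q.pathCoord β (Quiver.Path.nil.cons i.2.1)
      (Q.consElt Quiver.Path.nil i.2.1 (β i.2.1 i.2.2) (Q.nilElt v 1)) i') (Q.algElt i.1 a) =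
        Pi.single (M := fun i'' : FirstIdx n => Q.HomSpace i''.1 i.1) i (Q.algElt i.1 a) i'
    rw [pathCoord_consElt, nilCoord_nil, MulOpposite.op_one, one_smul, arrowCoord_basis]
    change Q.compBilin _ _ _ (Q.compBilin _ _ _ 0 _ + _) _ = _
    rw [map_zero, LinearMap.zero_apply, zero_add]
    by_cases h : i' = i
    · subst h
      rw [Pi.single_eq_same]
      refine Eq.trans ?_ (Pi.single_eq_same (M := fun i : FirstIdx n => Q.HomSpace i.1 _) _ _).symm
      exact Q.compBilin_one_left _
    · rw [Pi.single_eq_of_ne h]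
      refine Eq.trans ?_ (Pi.single_eq_of_ne (M := fun i : FirstIdx n => Q.HomSpace i.1 _) h _).symm
      rw [map_zero, LinearMap.zero_apply]
  | @cons b c δ α ih =>
    refine Q.consElt_induction y ?_ (fun m x => ?_) fun s t hs ht => ?_
    · rw [map_zero, map_zero, map_zero, Pi.single_zero]
    · rw [pathMul_consElt]
      change Q.pathCoord β (((Quiver.Path.nil.cons i.2.1).comp δ).cons α) _ i' = _
      -- The path already begins with the arrow of `i`, so its length is positive and the `nilCoord`
      -- term drops out.
      rw [pathCoord_consElt, ih, nilCoord_of_length _ _ _ _ (by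
        rw [Quiver.Path.length_comp, Quiver.Path.length_cons]; omega), LinearMap.zero_apply,
        LinearMap.zero_apply, Pi.zero_apply, add_zero, ← arrowMap_inj, arrowMap_eq]
      by_cases h : i' = i
      · subst h
        rw [Pi.single_eq_same, Pi.single_eq_same]
      · rw [Pi.single_eq_of_ne h, Pi.single_eq_of_ne h, map_zero, LinearMap.zero_apply]
    · rw [map_add, map_add, map_add, Pi.single_add, Pi.add_apply, Pi.add_apply, hs, ht]

open scoped Classical in
/-- The coordinates of a morphism with respect to the bases on the arrows that start at `v`. -/
def homCoord (w : V) : Q.HomSpace v w →ₗ[k] ∀ i : FirstIdx n, Q.HomSpace i.1 w :=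
  DirectSum.toModule k _ _ fun γ => Q.pathCoord β γ

open scoped Classical in
theorem homCoord_compBilin (i : FirstIdx n) {w : V} (f : Q.HomSpace i.1 w) :
    Q.homCoord β w (Q.compBilin v i.1 w (Q.firstElt β i) f) =
      Pi.single (M := fun i : FirstIdx n => Q.HomSpace i.1 w) i f := by
  refine Q.homSpace_induction f ?_ (fun δ y => ?_) fun x y hx hy => ?_
  · rw [map_zero, map_zero, Pi.single_zero]
  · rw [firstElt, arrowElt, compBilin_inj]
    refine Eq.trans ?_ (Q.pathCoord_pathMul β i δ y)
    simp only [homCoord, inj, DirectSum.toModule_lof]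
  · rw [map_add, map_add, Pi.single_add, hx, hy]

/-- The purpose of the coordinates: `homCoord` is an explicit left inverse. -/
theorem injective_firstMap [Fintype (FirstIdx n)] (w : V) :
    Function.Injective (Q.firstMap (Q.firstElt β) w) := by
  classical
  refine Function.LeftInverse.injective (g := Q.homCoord β w) fun f => ?_
  rw [firstMap_apply, map_sum]
  simp only [homCoord_compBilin]
  exact Finset.univ_sum_single f

/-- Expanding an arrow's element in the basis supplies the hypothesis of `mem_range_firstMap`. -/
theorem exists_eq_firstMap [Fintype (FirstIdx n)] {w : V} (hvw : v ≠ w) (f : Q.HomSpace v w) :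
    ∃ g, Q.firstMap (Q.firstElt β) w g = f := by
  classical
  refine Q.mem_range_firstMap _ (fun u α x => ?_) hvw f
  have h : Q.arrowElt α x = ∑ j, Q.arrowElt α ((β α).repr x j • β α j) := by
    conv_lhs => rw [← (β α).sum_repr x]
    exact map_sum (AddMonoidHom.mk' (Q.arrowElt α) (Q.arrowElt_add α)) _ _
  rw [h]
  refine Submodule.sum_mem _ fun j _ => ⟨Pi.single (M := fun i : FirstIdx n => Q.HomSpace i.1 u)
    ⟨u, α, j⟩ (Q.algElt u ((β α).repr x j)), ?_⟩
  rw [firstMap_apply, Finset.sum_eq_single ⟨u, α, j⟩]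
  · rw [Pi.single_eq_same, arrowElt_smul]
    rfl
  · intro i _ hi
    rw [Pi.single_eq_of_ne hi, map_zero]
  · exact fun h => absurd (Finset.mem_univ _) h

end Left

/-! #### The right side -/

section Right

variable {w : V} {n : ∀ {u : V}, (u ⟶ w) → ℕ}
  (β : ∀ {u : V} (α : u ⟶ w), Module.Basis (Fin (n α)) (Q.alg u)ᵐᵒᵖ (Q.bim α))

/-- The index set of the elements of the bases of the bimodules on the arrows that end at `w`. -/
abbrev LastIdx {w : V} (n : ∀ {u : V}, (u ⟶ w) → ℕ) : Type w :=
  Σ (u : V) (α : u ⟶ w), Fin (n α)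

/-- A basis element of the bimodule on an arrow that ends at `w`, as a morphism. -/
def lastElt (i : LastIdx n) : Q.HomSpace i.1 w := Q.arrowElt i.2.1 (β i.2.1 i.2.2)

/-- The map `(f_i) ↦ ∑ η_i ∘ f_i`. -/
def lastMap [Fintype (LastIdx n)] (v : V) :
    (∀ i : LastIdx n, Q.HomSpace v i.1) →ₗ[k] Q.HomSpace v w :=
  ∑ i, ((Q.compBilin v i.1 w).flip (Q.lastElt β i)).comp (LinearMap.proj i)

theorem lastMap_apply [Fintype (LastIdx n)] (v : V) (f : ∀ i : LastIdx n, Q.HomSpace v i.1) :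
    Q.lastMap β v f = ∑ i, Q.compBilin v i.1 w (f i) (Q.lastElt β i) := by
  simp [lastMap, LinearMap.sum_apply]

open scoped Classical in
/-- The coordinates on the module of a path with respect to the bases on its last arrow. -/
def lastPathCoord {v : V} : ∀ {c : V} (γ : Quiver.Path v c) (_h : c = w),
    Q.PathSpace γ →ₗ[k] ∀ i : LastIdx n, Q.HomSpace v i.1
  | _, .nil, _ => 0
  -- The end of the path is a variable tied to the fixed vertex `w` by an equation, so that a match
  -- on the path is possible.
  | _, .cons (b := b) γ α, rfl =>
    Q.consLift γ α
      (LinearMap.mk₂ k (fun m x => ∑ j, Pi.single (M := fun i : LastIdx n => Q.HomSpace v i.1)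
          ⟨b, α, j⟩ (Q.inj γ (((β α).repr m j).unop • x)))
        (fun m m' x => by
          simp only [map_add, Finsupp.add_apply, MulOpposite.unop_add, add_smul, Pi.single_add,
            Finset.sum_add_distrib])
        (fun r m x => by
          rw [Finset.smul_sum]
          refine Finset.sum_congr rfl fun j _ => ?_
          have h : ((β α).repr (r • m) j).unop • x = r • ((β α).repr m j).unop • x := by
            rw [← algebraMap_smul (Q.alg b)ᵐᵒᵖ r m, map_smul (β α).repr, Finsupp.smul_apply,
              smul_eq_mul, MulOpposite.unop_mul, MulOpposite.algebraMap_apply,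
              MulOpposite.unop_op, mul_smul, algebraMap_smul, smul_comm]
          rw [h, map_smul, Pi.single_smul])
        (fun m x x' => by
          simp only [smul_add, map_add, Pi.single_add, Finset.sum_add_distrib])
        (fun r m x => by
          rw [Finset.smul_sum]
          refine Finset.sum_congr rfl fun j _ => ?_
          rw [smul_comm, map_smul, Pi.single_smul]))
      (fun m a x => by
        rw [LinearMap.mk₂_apply, LinearMap.mk₂_apply]
        refine Finset.sum_congr rfl fun j _ => ?_
        rw [map_smul (β α).repr, Finsupp.smul_apply, smul_eq_mul, MulOpposite.unop_mul,
          MulOpposite.unop_op, mul_smul])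

open scoped Classical in
theorem lastPathCoord_consElt {v b : V} (γ : Quiver.Path v b) (α : b ⟶ w) (m : Q.bim α)
    (x : Q.PathSpace γ) :
    Q.lastPathCoord β (γ.cons α) rfl (Q.consElt γ α m x) =
      ∑ j, Pi.single (M := fun i : LastIdx n => Q.HomSpace v i.1)
          ⟨b, α, j⟩ (Q.inj γ (((β α).repr m j).unop • x)) := rfl

open scoped Classical in
/-- The coordinates of a morphism with respect to the bases on the arrows that end at `w`. -/
def lastCoord (v : V) : Q.HomSpace v w →ₗ[k] ∀ i : LastIdx n, Q.HomSpace v i.1 :=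
  DirectSum.toModule k _ _ fun γ => Q.lastPathCoord β γ rfl

open scoped Classical in
-- The last arrow is the outermost tensor factor, so a single expansion in the basis gives the
-- coordinates; no recursion along the path is needed, unlike for the first arrow.
theorem lastCoord_compBilin (i : LastIdx n) {v : V} (f : Q.HomSpace v i.1) :
    Q.lastCoord β v (Q.compBilin v i.1 w f (Q.lastElt β i)) =
      Pi.single (M := fun i : LastIdx n => Q.HomSpace v i.1) i f := by
  refine Q.homSpace_induction f ?_ (fun γ x => ?_) fun x y hx hy => ?_
  · rw [map_zero, LinearMap.zero_apply, map_zero, Pi.single_zero]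
  · rw [lastElt, ← arrowMap_eq, arrowMap_inj]
    have h : Q.lastCoord β v (Q.inj (γ.cons i.2.1)
        (Q.consElt γ i.2.1 (β i.2.1 i.2.2) x)) = Q.lastPathCoord β (γ.cons i.2.1) rfl
          (Q.consElt γ i.2.1 (β i.2.1 i.2.2) x) := by
      simp only [lastCoord, inj, DirectSum.toModule_lof]
    rw [h, lastPathCoord_consElt, Finset.sum_eq_single i.2.2]
    · rw [Module.Basis.repr_self, Finsupp.single_eq_same, MulOpposite.unop_one, one_smul]
    · intro j _ hj
      rw [Module.Basis.repr_self, Finsupp.single_eq_of_ne hj, MulOpposite.unop_zero, zero_smul,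
        map_zero, Pi.single_zero]
    · exact fun h => absurd (Finset.mem_univ _) h
  · rw [map_add, LinearMap.add_apply, map_add, Pi.single_add, hx, hy]

theorem injective_lastMap [Fintype (LastIdx n)] (v : V) :
    Function.Injective (Q.lastMap β v) := by
  classical
  refine Function.LeftInverse.injective (g := Q.lastCoord β v) fun f => ?_
  rw [lastMap_apply, map_sum]
  simp only [lastCoord_compBilin]
  exact Finset.univ_sum_single f

theorem inj_mem_range_lastMap [Fintype (LastIdx n)] {v c : V} (γ : Quiver.Path v c)
    (hγ : γ.length ≠ 0) (h : c = w) (x : Q.PathSpace γ) :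
    ∃ g, Q.lastMap β v g = h ▸ Q.inj γ x := by
  classical
  cases γ with
  | nil => exact absurd rfl hγ
  | @cons b c γ α =>
    subst h
    refine Q.consElt_induction x ⟨0, ?_⟩ (fun m x => ?_) ?_
    · rw [map_zero, map_zero]
    · refine ⟨∑ j, Pi.single (M := fun i : LastIdx n => Q.HomSpace v i.1)
        ⟨b, α, j⟩ (Q.inj γ (((β α).repr m j).unop • x)), ?_⟩
      have hm : Q.consElt γ α m x = ∑ j, Q.consElt γ α (β α j) (((β α).repr m j).unop • x) := by
        conv_lhs => rw [← (β α).sum_repr m]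
        refine (map_sum (AddMonoidHom.mk' (fun m => Q.consElt γ α m x)
          fun m m' => Q.consElt_add γ α m m' x) _ _).trans ?_
        exact Finset.sum_congr rfl fun j _ =>
          Q.consElt_op_smul γ α ((β α).repr m j).unop (β α j) x
      rw [hm, map_sum, map_sum]
      refine Finset.sum_congr rfl fun j _ => ?_
      rw [lastMap_apply, Finset.sum_eq_single ⟨b, α, j⟩]
      · rw [Pi.single_eq_same, lastElt, ← arrowMap_eq, arrowMap_inj]
      · intro i _ hi
        rw [Pi.single_eq_of_ne hi, map_zero, LinearMap.zero_apply]
      · exact fun h => absurd (Finset.mem_univ _) h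
    · rintro s t ⟨g, hg⟩ ⟨g', hg'⟩
      exact ⟨g + g', by rw [map_add, map_add, hg, hg']⟩

theorem exists_eq_lastMap [Fintype (LastIdx n)] {v : V} (hvw : v ≠ w) (f : Q.HomSpace v w) :
    ∃ g, Q.lastMap β v g = f := by
  refine Q.homSpace_induction f ⟨0, map_zero _⟩ (fun γ x => ?_) ?_
  · exact Q.inj_mem_range_lastMap β γ (fun h => hvw (Quiver.Path.eq_of_length_zero γ h)) rfl x
  · rintro _ _ ⟨g, rfl⟩ ⟨g', rfl⟩
    exact ⟨g + g', map_add _ _ _⟩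

end Right

end BimoduleQuiver

/-! ### Freeness from a presentation of the graded category -/

namespace BimoduleQuiver

variable {k : Type uk} [Field k] {V : Type w} [Quiver.{w} V] (Q : BimoduleQuiver.{uk, u, w} k V)

/-- The algebras at the vertices are local, so the projective bimodules are free and regularity can
be used through bases. -/
theorem exists_basis_of_leftRegular (hQ : Q.LeftRegular) (v : V) :
    ∃ n : ∀ {u : V}, (v ⟶ u) → ℕ, Nonempty
      (∀ {u : V} (α : v ⟶ u), Module.Basis (Fin (n α)) (Q.alg u) (Q.bim α)) := by
  have h : ∀ (u : V) (α : v ⟶ u), ∃ n : ℕ,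
      Nonempty (Module.Basis (Fin n) (Q.alg u) (Q.bim α)) := fun u α => by
    have := hQ α
    have : Module.Finite (Q.alg u) (Q.bim α) := Module.Finite.of_restrictScalars_finite k _ _
    exact exists_basis_of_isLocalRing k (Q.bim α)
  choose n hn using h
  exact ⟨fun {u} α => n u α, ⟨fun {u} α => (hn u α).some⟩⟩

theorem exists_basis_of_rightRegular (hQ : Q.RightRegular) (w : V) :
    ∃ n : ∀ {u : V}, (u ⟶ w) → ℕ, Nonempty
      (∀ {u : V} (α : u ⟶ w), Module.Basis (Fin (n α)) (Q.alg u)ᵐᵒᵖ (Q.bim α)) := by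
  have h : ∀ (u : V) (α : u ⟶ w), ∃ n : ℕ,
      Nonempty (Module.Basis (Fin n) (Q.alg u)ᵐᵒᵖ (Q.bim α)) := fun u α => by
    have := hQ α
    have : Module.Finite (Q.alg u)ᵐᵒᵖ (Q.bim α) := Module.Finite.of_restrictScalars_finite k _ _
    exact exists_basis_of_isLocalRing k (Q.bim α)
  choose n hn using h
  exact ⟨fun {u} α => n u α, ⟨fun {u} α => (hn u α).some⟩⟩

end BimoduleQuiver

theorem IsFiniteAcyclic.ne_of_hom {V : Type w} [Quiver.{w} V] (hV : IsFiniteAcyclic V) {v u : V}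
    (α : v ⟶ u) : v ≠ u := by
  rintro rfl
  have := hV.acyclic v (Quiver.Path.nil.cons α)
  rw [Quiver.Path.length_cons] at this
  omega

/-! ### Functors into an associated category. -/

namespace AssocCat

variable {k : Type uk} [Field k] {A : Type u} [Ring A] [Algebra k A] {Λ : Type w} {e : Λ → A}
  {he : ∀ l, IsIdempotentElem (e l)} {C : Type w} [Category.{max u w} C] [Preadditive C]
  (F : C ⥤ AssocCat k e he)

/-- The element of `A` underlying the image of a morphism. -/
def mapVal {X Y : C} (f : X ⟶ Y) : A := (F.map f).1

theorem mapVal_mem {X Y : C} (f : X ⟶ Y) :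
    mapVal F f ∈ corner k e (F.obj X).idx (F.obj Y).idx := (F.map f).2

theorem mapVal_comp {X Y Z : C} (f : X ⟶ Y) (g : Y ⟶ Z) :
    mapVal F (f ≫ g) = mapVal F g * mapVal F f := congrArg Subtype.val (F.map_comp f g)

theorem exists_mapVal_eq [F.Full] {X Y : C} {z : A}
    (hz : z ∈ corner k e (F.obj X).idx (F.obj Y).idx) : ∃ f : X ⟶ Y, mapVal F f = z := by
  obtain ⟨f, hf⟩ := F.map_surjective (X := X) (Y := Y) ⟨z, hz⟩
  exact ⟨f, congrArg Subtype.val hf⟩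

theorem mapVal_injective [F.Faithful] {X Y : C} :
    Function.Injective (mapVal F : (X ⟶ Y) → A) := fun _ _ h =>
  F.map_injective (Subtype.ext h)

variable [F.Additive]

theorem mapVal_zero (X Y : C) : mapVal F (0 : X ⟶ Y) = 0 := congrArg Subtype.val (F.map_zero X Y)

theorem mapVal_sum {X Y : C} {ι : Type*} (s : Finset ι) (f : ι → (X ⟶ Y)) :
    mapVal F (∑ i ∈ s, f i) = ∑ i ∈ s, mapVal F (f i) :=
  (congrArg Subtype.val (F.map_sum f s)).trans (Submodule.coe_sum _ _ _)

end AssocCat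

namespace DirectedStructure

variable {k : Type uk} [Field k] {A : Type u} [Ring A] [Algebra k A] {Λ : Type w} [Fintype Λ]
  {e : Λ → A} [FiniteDimensional k A] (he : CompleteOrthogonalIdempotents e)
  (hd : IsDirectedFamily k e)

/-- The functor need not respect degrees. Being bijective, it carries the decomposition by first
arrows to one of the corners of the graded algebra, and `leftFreeAt_of_gr_basis` accepts
inhomogeneous generators. -/
theorem leftFreeAt_of_presents (d : DirectedStructure k e) {V : Type w} [Quiver.{w} V]
    (Q : BimoduleQuiver.{uk, u, w} k V) (hV : IsFiniteAcyclic V) (hQ : Q.LeftRegular)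
    (hP : Q.Presents (GradedCat he hd)) (l : Λ) : LeftFreeAt e l := by
  obtain ⟨F, _, _, _, _, hF⟩ := hP
  obtain ⟨⟨v⟩, hv⟩ := hF.2 ⟨l⟩
  obtain rfl : (F.obj ⟨v⟩).idx = l := congrArg AssocCat.idx hv
  obtain ⟨n, ⟨β⟩⟩ := Q.exists_basis_of_leftRegular hQ v
  have hne : ∀ {u u' : V}, u ≠ u' → (F.obj ⟨u⟩).idx ≠ (F.obj ⟨u'⟩).idx := fun {u u'} h h' =>
    h (congrArg BimoduleQuiver.FreeCat.vertex (hF.1 (congrArg AssocCat.mk h')))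
  have : Fintype (BimoduleQuiver.FirstIdx n) := by
    have := hV.finite_vertices
    have := hV.finite_arrows
    exact Fintype.ofFinite _
  have hmap : ∀ (w : V) (f : ∀ i : BimoduleQuiver.FirstIdx n, Q.HomSpace i.1 w),
      AssocCat.mapVal F (X := ⟨v⟩) (Y := ⟨w⟩) (Q.firstMap (Q.firstElt β) w f) =
        ∑ i, AssocCat.mapVal F (X := ⟨i.1⟩) (Y := ⟨w⟩) (f i) *
          AssocCat.mapVal F (X := ⟨v⟩) (Y := ⟨i.1⟩) (Q.firstElt β i) := by
    intro w f
    rw [Q.firstMap_apply]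
    refine (AssocCat.mapVal_sum F (X := ⟨v⟩) (Y := ⟨w⟩) Finset.univ
      fun i => Q.compBilin v i.1 w (Q.firstElt β i) (f i)).trans ?_
    exact Finset.sum_congr rfl fun i _ => AssocCat.mapVal_comp F (X := ⟨v⟩) (Y := ⟨i.1⟩) (Z := ⟨w⟩)
      (Q.firstElt β i) (f i)
  refine leftFreeAt_of_gr_basis he hd d (fun i : BimoduleQuiver.FirstIdx n => (F.obj ⟨i.1⟩).idx)
    (fun i => AssocCat.mapVal F (X := ⟨v⟩) (Y := ⟨i.1⟩) (Q.firstElt β i))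
    (fun i => hne (hV.ne_of_hom i.2.1).symm) (fun i => AssocCat.mapVal_mem F _) ?_ ?_
  · intro p hp z hz
    obtain ⟨⟨w⟩, hw⟩ := hF.2 ⟨p⟩
    obtain rfl : (F.obj ⟨w⟩).idx = p := congrArg AssocCat.idx hw
    have hvw : v ≠ w := by rintro rfl; exact hp rfl
    obtain ⟨f, hf⟩ := AssocCat.exists_mapVal_eq F (X := ⟨v⟩) (Y := ⟨w⟩) hz
    obtain ⟨g, rfl⟩ := Q.exists_eq_firstMap β hvw f
    exact ⟨fun i => AssocCat.mapVal F (X := ⟨i.1⟩) (Y := ⟨w⟩) (g i),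
      fun i => AssocCat.mapVal_mem F (X := ⟨i.1⟩) (Y := ⟨w⟩) (g i), hf.symm.trans (hmap w g)⟩
  · intro p s hs h0
    obtain ⟨⟨w⟩, hw⟩ := hF.2 ⟨p⟩
    obtain rfl : (F.obj ⟨w⟩).idx = p := congrArg AssocCat.idx hw
    choose f hf using fun i : BimoduleQuiver.FirstIdx n =>
      AssocCat.exists_mapVal_eq F (X := ⟨i.1⟩) (Y := ⟨w⟩) (hs i)
    obtain rfl : (fun i => AssocCat.mapVal F (X := ⟨i.1⟩) (Y := ⟨w⟩) (f i)) = s := funext hf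
    have h2 : Q.firstMap (Q.firstElt β) w f = 0 :=
      AssocCat.mapVal_injective F (X := ⟨v⟩) (Y := ⟨w⟩)
        (((hmap w f).trans h0).trans (AssocCat.mapVal_zero F ⟨v⟩ ⟨w⟩).symm)
    obtain rfl : f = 0 := Q.injective_firstMap β w (h2.trans (map_zero _).symm)
    exact fun i => AssocCat.mapVal_zero F ⟨i.1⟩ ⟨w⟩

/-- The same transport, now of the decomposition by last arrows. -/
theorem rightFreeAt_of_presents (d : DirectedStructure k e) {V : Type w} [Quiver.{w} V]
    (Q : BimoduleQuiver.{uk, u, w} k V) (hV : IsFiniteAcyclic V) (hQ : Q.RightRegular)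
    (hP : Q.Presents (GradedCat he hd)) (p : Λ) : RightFreeAt e p := by
  obtain ⟨F, _, _, _, _, hF⟩ := hP
  obtain ⟨⟨w⟩, hw⟩ := hF.2 ⟨p⟩
  obtain rfl : (F.obj ⟨w⟩).idx = p := congrArg AssocCat.idx hw
  obtain ⟨n, ⟨β⟩⟩ := Q.exists_basis_of_rightRegular hQ w
  have hne : ∀ {u u' : V}, u ≠ u' → (F.obj ⟨u⟩).idx ≠ (F.obj ⟨u'⟩).idx := fun {u u'} h h' =>
    h (congrArg BimoduleQuiver.FreeCat.vertex (hF.1 (congrArg AssocCat.mk h')))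
  have : Fintype (BimoduleQuiver.LastIdx n) := by
    have := hV.finite_vertices
    have := fun u => hV.finite_arrows u w
    exact Fintype.ofFinite _
  have hmap : ∀ (v : V) (f : ∀ i : BimoduleQuiver.LastIdx n, Q.HomSpace v i.1),
      AssocCat.mapVal F (X := ⟨v⟩) (Y := ⟨w⟩) (Q.lastMap β v f) =
        ∑ i, AssocCat.mapVal F (X := ⟨i.1⟩) (Y := ⟨w⟩) (Q.lastElt β i) *
          AssocCat.mapVal F (X := ⟨v⟩) (Y := ⟨i.1⟩) (f i) := by
    intro v f
    rw [Q.lastMap_apply]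
    refine (AssocCat.mapVal_sum F (X := ⟨v⟩) (Y := ⟨w⟩) Finset.univ
      fun i => Q.compBilin v i.1 w (f i) (Q.lastElt β i)).trans ?_
    exact Finset.sum_congr rfl fun i _ => AssocCat.mapVal_comp F (X := ⟨v⟩) (Y := ⟨i.1⟩) (Z := ⟨w⟩)
      (f i) (Q.lastElt β i)
  refine rightFreeAt_of_gr_basis he hd d (fun i : BimoduleQuiver.LastIdx n => (F.obj ⟨i.1⟩).idx)
    (fun i => AssocCat.mapVal F (X := ⟨i.1⟩) (Y := ⟨w⟩) (Q.lastElt β i))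
    (fun i => hne (hV.ne_of_hom i.2.1)) (fun i => AssocCat.mapVal_mem F _) ?_ ?_
  · intro l hl z hz
    obtain ⟨⟨v⟩, hv⟩ := hF.2 ⟨l⟩
    obtain rfl : (F.obj ⟨v⟩).idx = l := congrArg AssocCat.idx hv
    have hvw : v ≠ w := by rintro rfl; exact hl rfl
    obtain ⟨f, hf⟩ := AssocCat.exists_mapVal_eq F (X := ⟨v⟩) (Y := ⟨w⟩) hz
    obtain ⟨g, rfl⟩ := Q.exists_eq_lastMap β hvw f
    exact ⟨fun i => AssocCat.mapVal F (X := ⟨v⟩) (Y := ⟨i.1⟩) (g i),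
      fun i => AssocCat.mapVal_mem F (X := ⟨v⟩) (Y := ⟨i.1⟩) (g i), hf.symm.trans (hmap v g)⟩
  · intro l s hs h0
    obtain ⟨⟨v⟩, hv⟩ := hF.2 ⟨l⟩
    obtain rfl : (F.obj ⟨v⟩).idx = l := congrArg AssocCat.idx hv
    choose f hf using fun i : BimoduleQuiver.LastIdx n =>
      AssocCat.exists_mapVal_eq F (X := ⟨v⟩) (Y := ⟨i.1⟩) (hs i)
    obtain rfl : (fun i => AssocCat.mapVal F (X := ⟨v⟩) (Y := ⟨i.1⟩) (f i)) = s := funext hf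
    have h2 : Q.lastMap β v f = 0 :=
      AssocCat.mapVal_injective F (X := ⟨v⟩) (Y := ⟨w⟩)
        (((hmap v f).trans h0).trans (AssocCat.mapVal_zero F ⟨v⟩ ⟨w⟩).symm)
    obtain rfl : f = 0 := Q.injective_lastMap β v (h2.trans (map_zero _).symm)
    exact fun i => AssocCat.mapVal_zero F ⟨v⟩ ⟨i.1⟩

end DirectedStructure

end

/-! ### Proof of the theorem. -/

theorem theorem2p4 {k : Type uk} [Field k] [IsAlgClosed k] {A : Type u} [Ring A] [Algebra k A]
    [FiniteDimensional k A] {Λ : Type w} [Fintype Λ] (e : Λ → A) (he : IsBasicFamily e)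
    (hd : IsDirectedFamily k e) :
    ((∀ o : LinearOrder Λ, IsStandardlyStratified e o) ↔
      IsLeftRegularFreeDirected k (GradedCat he.toCompleteOrthogonalIdempotents hd)) ∧
    ((∀ o : LinearOrder Λ, IsProperlyStratified e o) ↔
      IsRegularFreeDirected k (GradedCat he.toCompleteOrthogonalIdempotents hd)) := by
  obtain ⟨d⟩ := exists_directedStructure he hd
  have hc := he.toCompleteOrthogonalIdempotents
  refine ⟨⟨fun h => d.isLeftRegularFreeDirected hc hd (d.leftFreeAt_of_isStandardlyStratified h),
    ?_⟩, ⟨fun h => d.isRegularFreeDirected hc hd (d.leftFreeAt_of_isProperlyStratified h)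
      (d.rightFreeAt_of_isProperlyStratified h), ?_⟩⟩
  · rintro ⟨V, _, Q, hV, hQ, hP⟩ o
    exact d.isStandardlyStratified_of_leftFreeAt (d.leftFreeAt_of_presents hc hd Q hV hQ hP) o
  · rintro ⟨V, _, Q, hV, ⟨hQ, hQ'⟩, hP⟩ o
    exact d.isProperlyStratified_of_free (d.leftFreeAt_of_presents hc hd Q hV hQ hP)
      (d.rightFreeAt_of_presents hc hd Q hV hQ' hP) o
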